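/- A virtual knot is an equivalence class of Gauss diagrams (finitely many directed signed chords on an oriented circle, each chord pointing from the over passage to the under passage of a real crossing) under the Reidemeister moves of Gauss diagrams. It is trivial if it contains the diagram without chords, and classical if it contains the Gauss diagram of a planar knot diagram without virtual crossings. Virtualizing a real crossing deletes its chord. For a positive integer $n$, a virtual knot $K$ is called $GPV_n$-trivial if some diagram of $K$ has $n$ pairwise disjoint nonempty sets $A_1,\dots,A_n$ of real crossings such that, for every nonempty $I\subseteq\{1,\dots,n\}$, virtualizing all the crossings in $\bigcup_{i\in I}A_i$ yields a diagram of the trivial knot. Let $V_K(t)$ denote the Jones polynomial, normalized by $V_{\mathrm{unknot}}(t)=1$. For every positive integer $n$ there are a classical knot $K_n$ with $V_{K_n}(t)\neq 1$ and classical knots $K_n^{\ell}$, $\ell=1,2,3,\dots$, such that for every $\ell\ge 1$ the knot $K_n^{\ell}$ is nontrivial and $GPV_n$-trivial and $$V_{K_n^{\ell}}(t)=(t^{-2}-1)\,\bigl(V_{K_n}(t)-1\bigr)\sum_{i=0}^{\ell-1}t^{-2i}+V_{K_n}(t),$$ and such that $K_n^{\ell}$ and $K_n^{\ell'}$ are different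 knots (also up to orientation) whenever $\ell\neq\ell'$. -/

import Mathlib

/-! Virtual knots through Gauss diagrams, classical knots, virtualization, and the Jones polynomial. -/

open scoped LaurentPolynomial

/-- One of the two passages of a knot diagram through a real crossing, i.e. one endpoint of a chord
of a Gauss diagram: the name of the chord, whether this is the over passage (the tail of the arrow)
or the under passage (the head), and the sign of the crossing. -/
structure ChordEnd where
  label : ℕ
  isOver : Bool
  sign : ℤˣ
deriving DecidableEq

namespace ChordEnd

/-- The other endpoint of the same chord. -/
def opp (e : ChordEnd) : ChordEnd := ⟨e.label, !e.isOver, e.sign⟩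

/-- Change the name of the chord. -/
def relabel (f : Equiv.Perm ℕ) (e : ChordEnd) : ChordEnd := ⟨f e.label, e.isOver, e.sign⟩

end ChordEnd

/-- A Gauss diagram: an oriented circle with finitely many directed, signed chords with distinct
endpoints. It is recorded by the list of the chord endpoints met when the circle is traversed once
from some base point; every chord contributes exactly one over and one under endpoint, and both
carry its sign. -/
structure GaussDiagram where
  word : List ChordEnd
  nodup : word.Nodup
  opp_mem : ∀ e ∈ word, e.opp ∈ word
  sign_eq : ∀ e ∈ word, ∀ f ∈ word, e.label = f.label → e.sign = f.sign

namespace GaussDiagram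

/-- The Gauss diagram without chords: the diagram of a circle without crossings. -/
def empty : GaussDiagram where
  word := []
  nodup := List.nodup_nil
  opp_mem := by simp
  sign_eq := by simp

/-- The (names of the) real crossings. -/
def crossings (D : GaussDiagram) : Finset ℕ := (D.word.map ChordEnd.label).toFinset

/-- Virtualization of the crossings in `S`: the real crossings in `S` become virtual, so their
chords disappear from the Gauss diagram. -/
def virtualize (D : GaussDiagram) (S : Finset ℕ) : GaussDiagram where
  word := D.word.filter (fun e => e.label ∉ S)
  nodup := D.nodup.filter _
  opp_mem := by
    intro e he
    simp only [List.mem_filter, decide_eq_true_eq] at he ⊢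
    exact ⟨D.opp_mem e he.1, he.2⟩
  sign_eq := by
    intro e he f hf h
    exact D.sign_eq e (List.mem_filter.1 he).1 f (List.mem_filter.1 hf).1 h

/-- The same diagram with the opposite orientation (over/under and signs do not change). -/
def reverse (D : GaussDiagram) : GaussDiagram where
  word := D.word.reverse
  nodup := List.nodup_reverse.2 D.nodup
  opp_mem := by
    intro e he
    rw [List.mem_reverse] at he ⊢
    exact D.opp_mem e he
  sign_eq := by
    intro e he f hf h
    exact D.sign_eq e (List.mem_reverse.1 he) f (List.mem_reverse.1 hf) h

/-- The pair `x, y` in this order if `a = 1`, in the opposite order if `a = -1`. -/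
def ordered (a : ℤˣ) (x y : ChordEnd) : List ChordEnd := if a = 1 then [x, y] else [y, x]

/-- In a Reidemeister move III there are a top, a middle and a bottom strand, and three crossings
`i` (top over middle), `j` (top over bottom), `k` (middle over bottom). The number `a` tells whether
the top strand meets `i` before `j`, `b` whether the middle strand meets `i` before `k`, `c` whether
the bottom strand meets `j` before `k`, and `η` is the orientation of the triangle with vertices
`i, j, k`. These determine the signs of the crossings. -/
def topBlock (i j : ℕ) (a b c η : ℤˣ) (d : ℤˣ) : List ChordEnd :=
  ordered (d * a) ⟨i, true, a * b * η⟩ ⟨j, true, a * c * η⟩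

/-- The endpoints on the middle strand, see `topBlock`. -/
def middleBlock (i k : ℕ) (a b c η : ℤˣ) (d : ℤˣ) : List ChordEnd :=
  ordered (d * b) ⟨i, false, a * b * η⟩ ⟨k, true, b * c * η⟩

/-- The endpoints on the bottom strand, see `topBlock`. -/
def bottomBlock (j k : ℕ) (a b c η : ℤˣ) (d : ℤˣ) : List ChordEnd :=
  ordered (d * c) ⟨j, false, a * c * η⟩ ⟨k, false, b * c * η⟩

/-- The elementary changes of Gauss diagrams: change of base point, change of the names of the
chords, and the Reidemeister moves I, II, III (the moves that involve virtual crossings do not change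
the Gauss diagram). -/
inductive Move : GaussDiagram → GaussDiagram → Prop
  | rotate (D D' : GaussDiagram) (u v : List ChordEnd)
      (h : D.word = u ++ v) (h' : D'.word = v ++ u) : Move D D'
  | relabel (D D' : GaussDiagram) (f : Equiv.Perm ℕ)
      (h : D'.word = D.word.map (ChordEnd.relabel f)) : Move D D'
  | r1 (D D' : GaussDiagram) (u v : List ChordEnd) (e : ChordEnd)
      (h : D.word = u ++ [e, e.opp] ++ v) (h' : D'.word = u ++ v) : Move D D'
  | r2_parallel (D D' : GaussDiagram) (u v w : List ChordEnd) (i j : ℕ) (s : ℤˣ)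
      (h : D.word = u ++ [⟨i, true, s⟩, ⟨j, true, -s⟩] ++ v
        ++ [⟨i, false, s⟩, ⟨j, false, -s⟩] ++ w)
      (h' : D'.word = u ++ v ++ w) : Move D D'
  | r2_antiparallel (D D' : GaussDiagram) (u v w : List ChordEnd) (i j : ℕ) (s : ℤˣ)
      (h : D.word = u ++ [⟨i, true, s⟩, ⟨j, true, -s⟩] ++ v
        ++ [⟨j, false, -s⟩, ⟨i, false, s⟩] ++ w)
      (h' : D'.word = u ++ v ++ w) : Move D D'
  | r3_tmb (D D' : GaussDiagram) (u v w x : List ChordEnd) (i j k : ℕ) (a b c η : ℤˣ)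
      (h : D.word = u ++ topBlock i j a b c η 1 ++ v ++ middleBlock i k a b c η 1 ++ w
        ++ bottomBlock j k a b c η 1 ++ x)
      (h' : D'.word = u ++ topBlock i j a b c η (-1) ++ v ++ middleBlock i k a b c η (-1) ++ w
        ++ bottomBlock j k a b c η (-1) ++ x) : Move D D'
  | r3_tbm (D D' : GaussDiagram) (u v w x : List ChordEnd) (i j k : ℕ) (a b c η : ℤˣ)
      (h : D.word = u ++ topBlock i j a b c η 1 ++ v ++ bottomBlock j k a b c η 1 ++ w
        ++ middleBlock i k a b c η 1 ++ x)
      (h' : D'.word = u ++ topBlock i j a b c η (-1) ++ v ++ bottomBlock j k a b c η (-1) ++ w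
        ++ middleBlock i k a b c η (-1) ++ x) : Move D D'

/-! ### Arcs, faces, planarity -/

/-- The passages of the knot through its real crossings. The arc of the diagram that leads from the
preceding passage to `p` is also named `p`; so the arc that leaves `p` is named `D.succ p`. -/
abbrev Passage (D : GaussDiagram) : Type := {e : ChordEnd // e ∈ D.word}

/-- The next passage along the oriented circle. -/
def succ (D : GaussDiagram) (p : D.Passage) : D.Passage :=
  ⟨D.word.next p.1 p.2, List.next_mem _ _ _⟩

/-- The preceding passage along the oriented circle. -/
def pred (D : GaussDiagram) (p : D.Passage) : D.Passage :=
  ⟨D.word.prev p.1 p.2, List.prev_mem _ _ _⟩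

/-- The other passage through the same crossing. -/
def partner (D : GaussDiagram) (p : D.Passage) : D.Passage := ⟨p.1.opp, D.opp_mem _ p.2⟩

/-- `1` if the strand that crosses at `p` runs from right to left as seen in the direction of
the passage `p`, and `-1` if it runs from left to right. -/
def crossingDirection (D : GaussDiagram) (p : D.Passage) : ℤˣ :=
  if p.1.isOver then p.1.sign else -p.1.sign

/-- Walk along the diagram and turn left at every crossing. The pair `(p, d)` stands for a walker
who arrives at the crossing of `p` along the strand of `p`, in the direction of the orientation if
`d = 1` and against it if `d = -1`. -/
def turnLeft (D : GaussDiagram) (x : D.Passage × ℤˣ) : D.Passage × ℤˣ :=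
  if x.2 * D.crossingDirection x.1 = 1 then (D.succ (D.partner x.1), 1)
  else (D.pred (D.partner x.1), -1)

/-- The number of boundary circles of the complement of the diagram in its surface: the number of
closed walks that always turn left. -/
noncomputable def faceCount (D : GaussDiagram) : ℕ :=
  Nat.card (Quot (fun x y : D.Passage × ℤˣ => y = D.turnLeft x))

/-- The Gauss diagram comes from a knot diagram in the plane without virtual crossings: the closed
surface obtained by gluing discs to the faces has Euler characteristic `V - E + F = 2`, where
`E = 2 * V` is the length of the word. -/
def IsPlanar (D : GaussDiagram) : Prop :=
  D.word = [] ∨ 2 * D.faceCount = D.word.length + 4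

/-! ### The Jones polynomial -/

/-- How the smoothing of all crossings joins the arcs, where the crossings in `S` get the
`A`-smoothing and the others the `B`-smoothing. The `A`-smoothing of a positive crossing and the
`B`-smoothing of a negative crossing respect the orientation, the other two do not. -/
inductive Joined (D : GaussDiagram) (S : Finset ℕ) : D.Passage → D.Passage → Prop
  | oriented (p : D.Passage) (h : p.1.label ∈ S ↔ p.1.sign = 1) :
      Joined D S p (D.succ (D.partner p))
  | unoriented_in (p : D.Passage) (h : ¬ (p.1.label ∈ S ↔ p.1.sign = 1)) :
      Joined D S p (D.partner p)
  | unoriented_out (p : D.Passage) (h : ¬ (p.1.label ∈ S ↔ p.1.sign = 1)) :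
      Joined D S (D.succ p) (D.succ (D.partner p))

/-- The number of circles of the state in which exactly the crossings in `S` get the
`A`-smoothing. -/
noncomputable def loopCount (D : GaussDiagram) (S : Finset ℕ) : ℕ :=
  if D.word = [] then 1 else Nat.card (Quot (Joined D S))

/-- The Kauffman bracket in the variable `A = T 1`, with value `1` on a circle. -/
noncomputable def bracket (D : GaussDiagram) : ℤ[T;T⁻¹] :=
  ∑ S ∈ D.crossings.powerset,
    LaurentPolynomial.T ((S.card : ℤ) - ((D.crossings \ S).card : ℤ)) *
      (-LaurentPolynomial.T 2 - LaurentPolynomial.T (-2)) ^ (D.loopCount S - 1)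

/-- The writhe: the sum of the signs of the crossings. -/
def writhe (D : GaussDiagram) : ℤ :=
  ((D.word.filter ChordEnd.isOver).map (fun e => (e.sign : ℤ))).sum

/-- The Jones polynomial `(-A ^ 3) ^ (-writhe) * bracket`, as a Laurent polynomial in `A`, where the
usual variable is `t = A ^ (-4)`. (The writhe has the parity of the number of crossings.) -/
noncomputable def jones (D : GaussDiagram) : ℤ[T;T⁻¹] :=
  (-1) ^ D.crossings.card * LaurentPolynomial.T (-3 * D.writhe) * D.bracket

end GaussDiagram

/-- A virtual knot: an equivalence class of Gauss diagrams. -/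
def VirtualKnot : Type := Quot GaussDiagram.Move

namespace VirtualKnot

/-- The virtual knot with Gauss diagram `D`. -/
def ofDiagram (D : GaussDiagram) : VirtualKnot := Quot.mk _ D

/-- The trivial knot. -/
def unknot : VirtualKnot := ofDiagram GaussDiagram.empty

/-- A classical knot: it has a planar diagram without virtual crossings. -/
def IsClassical (K : VirtualKnot) : Prop := ∃ D, ofDiagram D = K ∧ D.IsPlanar

/-- `K` and `L` are the same knot up to the choice of an orientation. -/
def SameUnoriented (K L : VirtualKnot) : Prop :=
  K = L ∨ ∃ D, ofDiagram D = K ∧ ofDiagram D.reverse = L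

/-- `K` is `GPV_n`-trivial: some diagram of `K` has `n` pairwise disjoint nonempty sets of real
crossings such that virtualizing all the crossings in any nonempty subfamily gives a diagram of the
trivial knot. -/
def GPVTrivial (n : ℕ) (K : VirtualKnot) : Prop :=
  ∃ (D : GaussDiagram) (A : Fin n → Finset ℕ), ofDiagram D = K ∧
    (∀ i, (A i).Nonempty ∧ A i ⊆ D.crossings) ∧
    (∀ i j, i ≠ j → Disjoint (A i) (A j)) ∧
    ∀ s : Finset (Fin n), s.Nonempty → ofDiagram (D.virtualize (s.biUnion A)) = unknot

/-- The Jones polynomial of `K` is `V`: every diagram of `K` has the Jones polynomial `V`. -/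
def HasJones (K : VirtualKnot) (V : ℤ[T;T⁻¹]) : Prop := ∀ D, ofDiagram D = K → D.jones = V

end VirtualKnot

/-- The power `t ^ m` of the variable `t = A ^ (-4)` of the Jones polynomial. -/
noncomputable def tpow (m : ℤ) : ℤ[T;T⁻¹] := LaurentPolynomial.T (-4 * m)

/-! The knots are closures of two three-strand tangles and a row of ℓ clasps, everything built from
clasps of antiparallel strands (`Clasp.knotWord`). In a tangle, every clasp joins the middle strand
to its left or right neighbour, so the tangle spells a word in the free group on two letters;
adjacent inverse letters cancel by two Reidemeister II moves. The lower tangle spells the same word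
with mirror-image clasps. When the word is 1 in the free group both tangles disappear, and the row
of clasps left over untwists by Reidemeister I (`Clasp.isTrivialWord_knotWord`).

GPV-triviality: the letters carry colours, and `commutatorWord` is an iterated commutator that
becomes 1 as soon as all letters of one colour are left out. The crossings of the letters of colour
i, in both tangles, form the i-th set (`Clasp.gpvTrivial_commutatorWord`).

Jones polynomial: after normalization by the writhe, a negative clasp is t⁻² times the identity plus
a multiple of the turn-back, so a row of ℓ clasps is t^(-2ℓ) · identity + κ · turn-back, with
t^(-2ℓ) + κδ = 1 for δ the value of a circle. With the turn-back in place of the row, the upper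
tangle cancels against its mirror image (`Clasp.capCoeff_mirror`), whatever the word. Hence V_ℓ - 1
= t^(-2ℓ) (V_0 - 1) (`Clasp.jones_knotDiagram_sub_one`); summed as a geometric series this is the
stated formula. If V_0 ≠ 1, it also gives nontriviality, and it separates the knots, because V is
unchanged by reversal.

V_0 ≠ 1 is checked at A = 2 modulo 11. The commutator step is conjugated so that it fixes the linear
action of the starting word on the caps; the value is therefore the same for every n
(`Clasp.closureValue_commutatorWord`).

Both the bracket and the number of faces are computed as state sums: colour the arcs, weigh the
crossings, multiply matrices along the Gauss word and take the trace. For the bracket, a circle has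
the value N, the number of colours, when N = -A² - A⁻². Reidemeister invariance is then a local
identity of weights, and infinitely many N determine the Laurent polynomial. For faces, the two
sides of each arc are coloured (`GaussDiagram.two_pow_faceCount`), which yields planarity by Euler
characteristic. -/

set_option linter.unusedSectionVars false

/-! ### State sums of Gauss words. -/

namespace StateSum

variable {C k : Type*} [Fintype C] [DecidableEq C] [CommRing k]

/-- A choice, for every chord, of the colours before and after the over passage and before and after
the under passage. -/
abbrev Assignment (C : Type*) : Type _ := ℕ → (C × C) × (C × C)

/-- The matrix unit that forces the chosen colours at a chord endpoint, scaled by the weight of the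
chord at the over passage. -/
def endMatrix (w : ℤˣ → C → C → C → C → k) (f : Assignment C) (e : ChordEnd) : Matrix C C k :=
  if e.isOver then
    Matrix.single (f e.label).1.1 (f e.label).1.2
      (w e.sign (f e.label).1.1 (f e.label).1.2 (f e.label).2.1 (f e.label).2.2)
  else Matrix.single (f e.label).2.1 (f e.label).2.2 1

/-- The product of the matrices of the endpoints along a word. -/
def path (w : ℤˣ → C → C → C → C → k) (f : Assignment C) (W : List ChordEnd) : Matrix C C k :=
  (W.map (endMatrix w f)).prod

/-- Sum over the colours of the chords in a list. -/
def sumOver : List ℕ → (Assignment C → k) → Assignment C → k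
  | [], F => F
  | i :: L, F => fun f => ∑ x, sumOver L F (Function.update f i x)

/-- The labels of the over passages. -/
def overLabels (W : List ChordEnd) : List ℕ := (W.filter ChordEnd.isOver).map ChordEnd.label

/-- The state sum of a closed word. -/
def stateSum (w : ℤˣ → C → C → C → C → k) (W : List ChordEnd) : Assignment C → k :=
  sumOver (overLabels W) fun f => (path w f W).trace

variable (w : ℤˣ → C → C → C → C → k)

@[simp] lemma path_nil (f : Assignment C) : path w f [] = 1 := rfl

lemma path_append (f : Assignment C) (U V : List ChordEnd) :
    path w f (U ++ V) = path w f U * path w f V := by simp [path]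

lemma path_congr {f g : Assignment C} {W : List ChordEnd}
    (h : ∀ e ∈ W, f e.label = g e.label) : path w f W = path w g W := by
  unfold path
  congr 1
  refine List.map_congr_left fun e he => ?_
  simp [endMatrix, h e he]

/-- `F` does not depend on the colours of the chords in `L`. -/
def IndepOf {R : Type*} (F : Assignment C → R) (L : List ℕ) : Prop :=
  ∀ f g : Assignment C, (∀ i, i ∉ L → f i = g i) → F f = F g

lemma indepOf_path {W : List ChordEnd} {L : List ℕ} (h : ∀ e ∈ W, e.label ∉ L) :
    IndepOf (fun f => path w f W) L := fun _ _ hfg =>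
  path_congr w fun e he => hfg _ (h e he)

lemma sumOver_append (L L' : List ℕ) (F : Assignment C → k) :
    sumOver (L ++ L') F = sumOver L (sumOver L' F) := by
  induction L with
  | nil => rfl
  | cons i L ih => simp [sumOver, ih]

lemma sumOver_perm {L L' : List ℕ} (h : L.Perm L') (F : Assignment C → k) :
    sumOver L F = sumOver L' F := by
  induction h with
  | nil => rfl
  | cons i _ ih => simp [sumOver, ih]
  | swap i j L =>
    funext f
    simp only [sumOver]
    by_cases hij : i = j
    · subst hij; simp
    · rw [Finset.sum_comm]
      refine Finset.sum_congr rfl fun x _ => Finset.sum_congr rfl fun y _ => ?_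
      rw [Function.update_comm hij]
  | trans _ _ ih₁ ih₂ => rw [ih₁, ih₂]

lemma sumOver_sum {ι : Type*} (s : Finset ι) (L : List ℕ) (F : ι → Assignment C → k)
    (f : Assignment C) :
    sumOver L (fun f => ∑ a ∈ s, F a f) f = ∑ a ∈ s, sumOver L (F a) f := by
  induction L generalizing f with
  | nil => rfl
  | cons i L ih =>
    simp only [sumOver, ih]
    exact Finset.sum_comm

lemma sumOver_mul_left {L : List ℕ} {G : Assignment C → k} (hG : IndepOf G L)
    (F : Assignment C → k) (f : Assignment C) :
    sumOver L (fun f => G f * F f) f = G f * sumOver L F f := by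
  induction L generalizing f with
  | nil => rfl
  | cons i L ih =>
    have hG' : IndepOf G L := fun f g h => hG f g fun j hj => h j fun h' => hj (by simp [h'])
    simp only [sumOver, ih hG', Finset.mul_sum]
    refine Finset.sum_congr rfl fun x _ => ?_
    congr 1
    refine hG _ _ fun j hj => ?_
    rw [Function.update_of_ne]
    rintro rfl; simp at hj

lemma sumOver_const_mul (L : List ℕ) (c : k) (F : Assignment C → k) (f : Assignment C) :
    sumOver L (fun f => c * F f) f = c * sumOver L F f :=
  sumOver_mul_left (G := fun _ => c) (fun _ _ _ => rfl) F f

lemma sumOver_congr {L : List ℕ} {F G : Assignment C → k} (h : ∀ f, F f = G f) :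
    sumOver L F = sumOver L G := by rw [funext h]

lemma overLabels_append (U V : List ChordEnd) :
    overLabels (U ++ V) = overLabels U ++ overLabels V := by simp [overLabels]

/-- Replacing three blocks of a word by blocks with the same local state sum does not change the
state sum. -/
lemma sumOver_trace_replace {u v x y B₁ B₂ B₃ B₁' B₂' B₃' : List ChordEnd} {L I I' : List ℕ}
    (hI : ∀ e ∈ u ++ v ++ x ++ y, e.label ∉ I) (hI' : ∀ e ∈ u ++ v ++ x ++ y, e.label ∉ I')
    (h : ∀ (f : Assignment C) p₁ q₁ p₂ q₂ p₃ q₃,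
      sumOver I (fun f => path w f B₁ p₁ q₁ * path w f B₂ p₂ q₂ * path w f B₃ p₃ q₃) f =
      sumOver I' (fun f => path w f B₁' p₁ q₁ * path w f B₂' p₂ q₂ * path w f B₃' p₃ q₃) f) :
    sumOver (L ++ I) (fun f => (path w f (u ++ B₁ ++ v ++ B₂ ++ x ++ B₃ ++ y)).trace) =
    sumOver (L ++ I') (fun f => (path w f (u ++ B₁' ++ v ++ B₂' ++ x ++ B₃' ++ y)).trace) := by
  -- Cutting the cyclic word at the ends of the three blocks leaves the pieces `y ++ u`, `v` and
  -- `x`, the first of which passes the base point. Only the block factor depends on the chords in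
  -- `I`.
  have expand : ∀ (T₁ T₂ T₃ : List ChordEnd) (f : Assignment C),
      (path w f (u ++ T₁ ++ v ++ T₂ ++ x ++ T₃ ++ y)).trace =
        ∑ p : (C × C) × (C × C) × (C × C),
          (path w f (y ++ u) p.2.2.2 p.1.1 * path w f v p.1.2 p.2.1.1 *
            path w f x p.2.1.2 p.2.2.1) *
          (path w f T₁ p.1.1 p.1.2 * path w f T₂ p.2.1.1 p.2.1.2 *
            path w f T₃ p.2.2.1 p.2.2.2) := by
    intro T₁ T₂ T₃ f
    have : (path w f (u ++ T₁ ++ v ++ T₂ ++ x ++ T₃ ++ y)).trace =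
        (path w f (y ++ u) * (path w f T₁ * (path w f v * (path w f T₂ *
          (path w f x * path w f T₃))))).trace := by
      simp only [path_append]
      rw [Matrix.trace_mul_comm, ← Matrix.mul_assoc]
      simp only [Matrix.mul_assoc]
    rw [this]
    simp only [Matrix.trace, Matrix.diag, Matrix.mul_apply, Fintype.sum_prod_type, Finset.mul_sum]
    rw [Finset.sum_comm]
    refine Finset.sum_congr rfl fun a _ => ?_
    rw [Finset.sum_comm]
    refine Finset.sum_congr rfl fun b _ => ?_
    rw [Finset.sum_comm]
    refine Finset.sum_congr rfl fun c _ => ?_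
    rw [Finset.sum_comm]
    refine Finset.sum_congr rfl fun d _ => ?_
    rw [Finset.sum_comm]
    refine Finset.sum_congr rfl fun e _ => ?_
    refine Finset.sum_congr rfl fun g _ => ?_
    ring
  have indep : ∀ (J : List ℕ), (∀ e ∈ u ++ v ++ x ++ y, e.label ∉ J) → ∀ a b c d e g,
      IndepOf (fun f => path w f (y ++ u) a b * path w f v c d * path w f x e g) J := by
    intro J hJ a b c d e g f₁ f₂ hf
    have h₁ := indepOf_path w (W := y ++ u) (L := J) (fun t ht => hJ t (by
      simp only [List.mem_append] at ht ⊢; tauto)) f₁ f₂ hf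
    have h₂ := indepOf_path w (W := v) (L := J) (fun t ht => hJ t (by
      simp only [List.mem_append] at ht ⊢; tauto)) f₁ f₂ hf
    have h₃ := indepOf_path w (W := x) (L := J) (fun t ht => hJ t (by
      simp only [List.mem_append] at ht ⊢; tauto)) f₁ f₂ hf
    simp only at h₁ h₂ h₃ ⊢
    rw [h₁, h₂, h₃]
  rw [sumOver_append, sumOver_append]
  congr 1
  funext f
  rw [sumOver_congr (expand B₁ B₂ B₃), sumOver_congr (expand B₁' B₂' B₃'), sumOver_sum, sumOver_sum]
  refine Finset.sum_congr rfl fun p _ => ?_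
  rw [sumOver_mul_left (indep I hI _ _ _ _ _ _), sumOver_mul_left (indep I' hI' _ _ _ _ _ _), h]

lemma stateSum_rotate (u v : List ChordEnd) : stateSum w (u ++ v) = stateSum w (v ++ u) := by
  unfold stateSum
  rw [sumOver_perm (L := overLabels (u ++ v)) (L' := overLabels (v ++ u))]
  · refine sumOver_congr fun f => ?_
    rw [path_append, path_append, Matrix.trace_mul_comm]
  · rw [overLabels_append, overLabels_append]
    exact List.perm_append_comm

lemma path_relabel (σ : Equiv.Perm ℕ) (f : Assignment C) (W : List ChordEnd) :
    path w f (W.map (ChordEnd.relabel σ)) = path w (f ∘ σ) W := by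
  simp only [path, List.map_map]
  rfl

lemma sumOver_relabel (σ : Equiv.Perm ℕ) (L : List ℕ) (F : Assignment C → k) (f : Assignment C) :
    sumOver (L.map σ) (fun f => F (f ∘ σ)) f = sumOver L F (f ∘ σ) := by
  induction L generalizing f with
  | nil => rfl
  | cons i L ih =>
    simp only [List.map_cons, sumOver, ih]
    refine Finset.sum_congr rfl fun x _ => ?_
    congr 1
    funext j
    simp [Function.update_apply]

/-- Colours are indexed by labels, so renaming chords acts on assignments by precomposition. This is
why `stateSum_eq_of_move` allows a different assignment on the other side. -/
lemma stateSum_relabel (σ : Equiv.Perm ℕ) (W : List ChordEnd) (f : Assignment C) :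
    stateSum w (W.map (ChordEnd.relabel σ)) f = stateSum w W (f ∘ σ) := by
  unfold stateSum
  rw [← sumOver_relabel]
  have : overLabels (W.map (ChordEnd.relabel σ)) = (overLabels W).map σ := by
    simp [overLabels, List.filter_map, Function.comp_def, ChordEnd.relabel]
  rw [this]
  simp only [path_relabel]

end StateSum

open StateSum

/-! ### State sums as sums over colourings of the arcs. -/

namespace StateSum

variable {C k : Type*} [Fintype C] [DecidableEq C] [CommRing k]

lemma ofFn_prod_apply (n : ℕ) (M : Fin (n + 1) → Matrix C C k) (a b : C) :
    (List.ofFn M).prod a b = ∑ c : Fin n → C, ∏ t, M t ((Fin.cons a c : Fin (n + 1) → C) t)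
      ((Fin.snoc c b : Fin (n + 1) → C) t) := by
  induction n generalizing a with
  | zero => simp [Fin.snoc]
  | succ n ih =>
    rw [List.ofFn_succ, List.prod_cons, Matrix.mul_apply,
      ← (Fin.consEquiv (fun _ : Fin (n + 1) => C)).sum_comp, Fintype.sum_prod_type]
    refine Finset.sum_congr rfl fun x _ => ?_
    rw [ih, Finset.mul_sum]
    refine Finset.sum_congr rfl fun c _ => ?_
    have hc : Fin.consEquiv (fun _ : Fin (n + 1) => C) (x, c) = Fin.cons x c := rfl
    rw [hc, ← Fin.cons_snoc_eq_snoc_cons, Fin.prod_univ_succ (n := n + 1)]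
    simp only [Fin.cons_zero, Fin.cons_succ]

lemma trace_ofFn_prod (n : ℕ) (M : Fin (n + 1) → Matrix C C k) :
    (List.ofFn M).prod.trace = ∑ c : Fin (n + 1) → C, ∏ t, M t (c t) (c (t + 1)) := by
  rw [← (Fin.consEquiv (fun _ : Fin (n + 1) => C)).sum_comp, Fintype.sum_prod_type]
  refine Finset.sum_congr rfl fun a _ => ?_
  rw [Matrix.diag_apply, ofFn_prod_apply]
  refine Finset.sum_congr rfl fun c _ => Finset.prod_congr rfl fun t _ => ?_
  congr 1
  refine Fin.lastCases ?_ (fun i => ?_) t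
  · simp
  · simp [Fin.coeSucc_eq_succ]

/-- Each entry of the word has one arc in front of it, and the intermediate indices of the matrix
product are the colours of these arcs. The trace closes the cycle, so the arc behind an entry is
that of the cyclic `next`, which is the index `t + 1` in `Fin (n + 1)`. -/
lemma trace_prod_eq_sum_colorings {α : Type*} [DecidableEq α] (W : List α) (hW : W ≠ [])
    (hn : W.Nodup) (M : α → Matrix C C k) :
    (W.map M).prod.trace = ∑ c : {e // e ∈ W} → C,
      ∏ p : {e // e ∈ W}, M p.1 (c p) (c ⟨W.next p.1 p.2, List.next_mem _ _ _⟩) := by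
  obtain ⟨n, hlen⟩ : ∃ n, W.length = n + 1 :=
    Nat.exists_eq_succ_of_ne_zero (by simpa using hW)
  let e : Fin (n + 1) ≃ {e // e ∈ W} := (finCongr hlen.symm).trans (List.Nodup.getEquiv W hn)
  have he : ∀ t : Fin (n + 1), (e t).1 = W[t.1]'(by omega) := fun t => rfl
  have hsucc : ∀ t : Fin (n + 1),
      (⟨W.next (e t).1 (e t).2, List.next_mem _ _ _⟩ : {e // e ∈ W}) = e (t + 1) := by
    intro t
    apply Subtype.ext
    have := List.next_getElem W hn t.1 (by omega)
    simp only [he]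
    rw [this]
    congr 1
    rw [Fin.val_add, hlen]
    simp
  have hM : W.map M = List.ofFn fun t : Fin (n + 1) => M (e t).1 := by
    apply List.ext_getElem
    · simp [hlen]
    · intro i h₁ h₂
      simp only [List.getElem_map, List.getElem_ofFn, he]
  rw [hM, trace_ofFn_prod, ← (Equiv.arrowCongr e (Equiv.refl C)).sum_comp]
  refine Finset.sum_congr rfl fun c _ => ?_
  rw [← e.prod_comp]
  refine Finset.prod_congr rfl fun t _ => ?_
  rw [hsucc]
  simp [Equiv.arrowCongr]

/-- Distributivity: since the labels are distinct, each summation variable occurs in a single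
factor. -/
lemma sumOver_prod {P : Type*} (lab : P → ℕ) (l : List P) (hl : (l.map lab).Nodup)
    (h : P → (C × C) × (C × C) → k) (f : Assignment C) :
    sumOver (l.map lab) (fun f => (l.map fun p => h p (f (lab p))).prod) f =
      (l.map fun p => ∑ x, h p x).prod := by
  induction l generalizing f with
  | nil => rfl
  | cons a l ih =>
    rw [List.map_cons, List.nodup_cons] at hl
    simp only [List.map_cons, List.prod_cons, sumOver, Finset.sum_mul]
    refine Finset.sum_congr rfl fun x _ => ?_
    have hind : ∀ F : Assignment C → k, sumOver (l.map lab) (fun f => h a (f (lab a)) * F f)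
        (Function.update f (lab a) x) = h a x * sumOver (l.map lab) F
          (Function.update f (lab a) x) := by
      intro F
      rw [sumOver_mul_left (G := fun f => h a (f (lab a)))]
      · simp
      · intro f g hfg
        simp only [hfg _ hl.1]
    rw [hind, ih hl.2]

end StateSum

namespace GaussDiagram


variable {C k : Type*} [Fintype C] [DecidableEq C] [CommRing k]
variable (w : ℤˣ → C → C → C → C → k)

lemma opp_opp (e : ChordEnd) : e.opp.opp = e := by
  cases e; simp [ChordEnd.opp]

lemma eq_or_eq_opp (D : GaussDiagram) {e f : ChordEnd} (he : e ∈ D.word) (hf : f ∈ D.word)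
    (h : e.label = f.label) : f = e ∨ f = e.opp := by
  have hs := D.sign_eq e he f hf h
  obtain ⟨i, o, s⟩ := e
  obtain ⟨j, o', s'⟩ := f
  simp only at h hs
  subst h; subst hs
  cases o <;> cases o' <;> simp [ChordEnd.opp]

/-- The passages of a diagram that are over passages. -/
abbrev OverPassage (D : GaussDiagram) : Type := {p : D.Passage // p.1.isOver = true}

lemma overLabels_eq (D : GaussDiagram) : overLabels D.word =
    ((D.word.attach.filter fun p => p.1.isOver).map fun p => p.1.label) := by
  have : D.word = D.word.attach.map Subtype.val := by simp
  conv_lhs => rw [overLabels, this, List.filter_map, List.map_map]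
  rfl

lemma overLabels_nodup (D : GaussDiagram) : (overLabels D.word).Nodup := by
  refine List.Nodup.map_on ?_ (D.nodup.filter _)
  intro e he f hf h
  rw [List.mem_filter] at he hf
  rcases D.eq_or_eq_opp he.1 hf.1 h with h' | h'
  · exact h'.symm
  · rw [h'] at hf
    simp [ChordEnd.opp, he.2] at hf

lemma prod_over_mul_partner (D : GaussDiagram) (F : D.Passage → k) :
    ∏ p, F p = ((D.word.attach.filter fun p => p.1.isOver).map
      fun p => F p * F (D.partner p)).prod := by
  have hnd : (D.word.attach.filter fun p => p.1.isOver).Nodup :=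
    (List.nodup_attach.2 D.nodup).filter _
  rw [← List.prod_toFinset _ hnd, Finset.prod_mul_distrib]
  have h1 : (D.word.attach.filter fun p => p.1.isOver).toFinset =
      Finset.univ.filter fun p : D.Passage => p.1.isOver = true := by
    ext p; simp
  rw [h1, ← Finset.prod_filter_mul_prod_filter_not Finset.univ
    (fun p : D.Passage => p.1.isOver = true) F]
  congr 1
  refine Finset.prod_bij' (fun p _ => D.partner p) (fun p _ => D.partner p) ?_ ?_ ?_ ?_ ?_
  · intro p hp; simpa [partner, ChordEnd.opp] using hp
  · intro p hp; simpa [partner, ChordEnd.opp] using hp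
  · intro p _; exact Subtype.ext (opp_opp _)
  · intro p _; exact Subtype.ext (opp_opp _)
  · intro p _; congr 1; exact Subtype.ext (opp_opp _).symm

/-- The state sum of a diagram is the sum over all colourings of the arcs of the product of the
weights of the crossings. -/
lemma stateSum_eq_sum_colorings (D : GaussDiagram) (hD : D.word ≠ []) (f : Assignment C) :
    stateSum w D.word f = ∑ c : D.Passage → C,
      ((D.word.attach.filter fun p => p.1.isOver).map fun p =>
        w p.1.sign (c p) (c (D.succ p)) (c (D.partner p)) (c (D.succ (D.partner p)))).prod := by
  have h1 : ∀ f : Assignment C, (path w f D.word).trace = ∑ c : D.Passage → C,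
      ((D.word.attach.filter fun p => p.1.isOver).map fun p =>
        endMatrix w f p.1 (c p) (c (D.succ p)) *
          endMatrix w f p.1.opp (c (D.partner p)) (c (D.succ (D.partner p)))).prod := by
    intro f
    rw [path, trace_prod_eq_sum_colorings D.word hD D.nodup]
    refine Finset.sum_congr rfl fun c _ => ?_
    exact D.prod_over_mul_partner fun p => endMatrix w f p.1 (c p) (c (D.succ p))
  rw [stateSum, sumOver_congr h1, sumOver_sum]
  refine Finset.sum_congr rfl fun c _ => ?_
  -- With the arcs coloured, the factor of a chord involves only the colours chosen for that chord,
  -- and the matrix units leave the one choice that agrees with the arcs.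
  let h : D.Passage → (C × C) × (C × C) → k := fun p x =>
    Matrix.single x.1.1 x.1.2 (w p.1.sign x.1.1 x.1.2 x.2.1 x.2.2) (c p) (c (D.succ p)) *
    Matrix.single x.2.1 x.2.2 (1 : k) (c (D.partner p)) (c (D.succ (D.partner p)))
  have h2 : ∀ f : Assignment C, ((D.word.attach.filter fun p => p.1.isOver).map fun p =>
        endMatrix w f p.1 (c p) (c (D.succ p)) *
          endMatrix w f p.1.opp (c (D.partner p)) (c (D.succ (D.partner p)))).prod =
      ((D.word.attach.filter fun p => p.1.isOver).map fun p => h p (f p.1.label)).prod := by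
    intro f
    congr 1
    refine List.map_congr_left fun p hp => ?_
    have hp' : p.1.isOver = true := by simpa using (List.mem_filter.1 hp).2
    simp [h, endMatrix, hp', ChordEnd.opp]
  have hnd : ((D.word.attach.filter fun p => p.1.isOver).map
      fun p : D.Passage => p.1.label).Nodup := by
    rw [← overLabels_eq]; exact D.overLabels_nodup
  rw [sumOver_congr h2, overLabels_eq]
  refine (sumOver_prod (fun p : D.Passage => p.1.label) _ hnd h f).trans ?_
  congr 1
  refine List.map_congr_left fun p _ => ?_
  simp only [h, Matrix.single_apply, Fintype.sum_prod_type, ite_and, mul_ite,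
    mul_one, mul_zero]
  simp

end GaussDiagram

/-! ### Kauffman weights and the local identities behind the Reidemeister moves. -/

namespace StateSum
variable {C k : Type*} [Fintype C] [DecidableEq C] [CommRing k]

/-- Kronecker delta. -/
def delta (k : Type*) [CommRing k] (a b : C) : k := if a = b then 1 else 0

lemma delta_comm (a b : C) : delta k a b = delta k b a := by simp [delta, eq_comm]

@[simp] lemma delta_self (a : C) : delta k a a = 1 := by simp [delta]

lemma sum_delta_mul (a : C) (F : C → k) : ∑ m, delta k m a * F m = F a := by
  simp [delta]

lemma sum_delta_mul' (a : C) (F : C → k) : ∑ m, delta k a m * F m = F a := by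
  simp [delta]

lemma one_apply_eq_delta (a b : C) : (1 : Matrix C C k) a b = delta k a b := by
  simp [Matrix.one_apply, delta]

/-- The weight of a crossing of which the two smoothings get the coefficients `α` and `β`. -/
def smoothingWeight (α β : k) (a b c d : C) : k :=
  α * (delta k a d * delta k b c) + β * (delta k a c * delta k b d)

section contraction
variable (α β : k) (a b c d : C) (F : C → k)

lemma sum_weight_in : ∑ m, smoothingWeight α β m b c d * F m =
    α * (delta k b c * F d) + β * (delta k b d * F c) := by
  have : ∀ m, smoothingWeight α β m b c d * F m = delta k m d * (α * (delta k b c * F m)) +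
      delta k m c * (β * (delta k b d * F m)) := fun m => by simp only [smoothingWeight]; ring
  simp only [this, Finset.sum_add_distrib, sum_delta_mul]

lemma sum_weight_out : ∑ m, smoothingWeight α β a m c d * F m =
    α * (delta k a d * F c) + β * (delta k a c * F d) := by
  have : ∀ m, smoothingWeight α β a m c d * F m = delta k m c * (α * (delta k a d * F m)) +
      delta k m d * (β * (delta k a c * F m)) := fun m => by simp only [smoothingWeight]; ring
  simp only [this, Finset.sum_add_distrib, sum_delta_mul]

lemma weight_symm : smoothingWeight α β c d a b = smoothingWeight α β a b c d := by
  simp only [smoothingWeight, delta_comm c, delta_comm d]; ring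

lemma weight_reverse_fst : smoothingWeight α β b a c d = smoothingWeight β α a b c d := by
  simp only [smoothingWeight]; ring

end contraction

variable {α β : k}

/-- Of the eight states of the triangle, four, one of them with a circle, join the ends in the same
way; `hN` and `h` collapse their coefficients to the single `α`. The other four states give the
remaining terms. -/
lemma smoothingWeight_triangle_left (h : α * β = 1)
    (hN : (Fintype.card C : k) = -α ^ 2 - β ^ 2) (p₁ q₁ p₂ q₂ p₃ q₃ : C) :
    ∑ m₃, ∑ m₂, ∑ m₁, smoothingWeight α β p₁ m₁ p₂ m₂ * (smoothingWeight α β m₁ q₁ p₃ m₃ *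
      smoothingWeight α β m₂ q₂ m₃ q₃) =
    α ^ 3 * (delta k p₁ q₃ * delta k p₂ q₂ * delta k q₁ p₃)
      + α * (delta k p₁ p₂ * delta k q₂ q₃ * delta k q₁ p₃)
      + α * (delta k p₁ q₃ * delta k q₁ q₂ * delta k p₂ p₃)
      + β * (delta k p₁ q₁ * delta k q₂ q₃ * delta k p₂ p₃)
      + β * (delta k p₃ q₃ * delta k q₁ q₂ * delta k p₁ p₂) := by
  have e1 : ∀ m₃, ∑ m₂, ∑ m₁, smoothingWeight α β p₁ m₁ p₂ m₂ *
      (smoothingWeight α β m₁ q₁ p₃ m₃ * smoothingWeight α β m₂ q₂ m₃ q₃) =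
      α * (smoothingWeight α β p₂ q₁ p₃ m₃ * smoothingWeight α β p₁ q₂ m₃ q₃) +
      β * delta k p₁ p₂ * (α * (delta k q₁ p₃ * smoothingWeight α β m₃ q₂ m₃ q₃) +
        β * (delta k q₁ m₃ * smoothingWeight α β p₃ q₂ m₃ q₃)) := by
    intro m₃
    rw [← sum_weight_in α β q₁ p₃ m₃ fun m => smoothingWeight α β m q₂ m₃ q₃]
    simp only [sum_weight_out]
    rw [Finset.sum_add_distrib, Finset.mul_sum]
    congr 1
    · rw [← sum_delta_mul' p₁ (fun m => α * (smoothingWeight α β p₂ q₁ p₃ m₃ *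
        smoothingWeight α β m q₂ m₃ q₃))]
      exact Finset.sum_congr rfl fun m _ => by ring
    · exact Finset.sum_congr rfl fun m _ => by ring
  have e2 : ∑ m₃, smoothingWeight α β p₂ q₁ p₃ m₃ * smoothingWeight α β p₁ q₂ m₃ q₃ =
      α * (delta k q₁ p₃ * smoothingWeight α β p₁ q₂ p₂ q₃) +
        β * (delta k p₂ p₃ * smoothingWeight α β p₁ q₂ q₁ q₃) := by
    simp only [← weight_symm α β p₂ q₁]
    rw [sum_weight_out]
    simp only [delta_comm p₃]
  have e3 : ∑ m₃, smoothingWeight α β m₃ q₂ m₃ q₃ =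
      (α + β * Fintype.card C) * delta k q₂ q₃ := by
    have : ∀ m, smoothingWeight α β m q₂ m q₃ = delta k m q₃ * (α * delta k q₂ m) +
      β * delta k q₂ q₃ := fun m => by simp only [smoothingWeight, delta_self]; ring
    simp only [this, Finset.sum_add_distrib, sum_delta_mul, Finset.sum_const, Finset.card_univ,
      nsmul_eq_mul]
    ring
  have e4 : ∑ m₃, (α * (smoothingWeight α β p₂ q₁ p₃ m₃ * smoothingWeight α β p₁ q₂ m₃ q₃) +
      β * delta k p₁ p₂ * (α * (delta k q₁ p₃ * smoothingWeight α β m₃ q₂ m₃ q₃) +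
        β * (delta k q₁ m₃ * smoothingWeight α β p₃ q₂ m₃ q₃))) =
      α * (∑ m₃, smoothingWeight α β p₂ q₁ p₃ m₃ * smoothingWeight α β p₁ q₂ m₃ q₃) +
      β * delta k p₁ p₂ * (α * (delta k q₁ p₃ * ∑ m₃, smoothingWeight α β m₃ q₂ m₃ q₃) +
        β * smoothingWeight α β p₃ q₂ q₁ q₃) := by
    rw [← sum_delta_mul' q₁ fun m => smoothingWeight α β p₃ q₂ m q₃]
    simp only [Finset.sum_add_distrib, Finset.mul_sum, mul_add]
  rw [Finset.sum_congr rfl fun m _ => e1 m, e4, e2, e3, hN]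
  simp only [smoothingWeight, delta_comm q₂ p₂, delta_comm q₂ q₁, delta_comm p₃ q₁]
  linear_combination (delta k p₁ p₂ * delta k q₂ q₃ * delta k q₁ p₃) *
      (2 * α - β ^ 3 - α * (α * β + 1)) * h + (delta k p₁ q₃ * delta k p₂ p₃ * delta k q₁ q₂) * α * h +
    (delta k p₁ p₂ * delta k q₁ q₂ * delta k p₃ q₃ +
      delta k q₂ q₃ * delta k p₂ p₃ * delta k p₁ q₁) * β * h

/-- The five-term value of `smoothingWeight_triangle_left` is symmetric under exchanging `p` and `q`
on all strands, and this exchange turns one side of Reidemeister III into the other. -/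
lemma smoothingWeight_triangle (h : α * β = 1)
    (hN : (Fintype.card C : k) = -α ^ 2 - β ^ 2) (p₁ q₁ p₂ q₂ p₃ q₃ : C) :
    ∑ m₃, ∑ m₂, ∑ m₁, smoothingWeight α β p₁ m₁ p₂ m₂ * (smoothingWeight α β m₁ q₁ p₃ m₃ *
      smoothingWeight α β m₂ q₂ m₃ q₃) =
    ∑ m₃, ∑ m₂, ∑ m₁, smoothingWeight α β m₁ q₁ m₂ q₂ * (smoothingWeight α β p₁ m₁ m₃ q₃ *
      smoothingWeight α β p₂ m₂ p₃ m₃) := by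
  have hr : ∀ a b c d : C, smoothingWeight α β a b c d = smoothingWeight α β b a d c := by
    intro a b c d; simp only [smoothingWeight]; ring
  have h2 := smoothingWeight_triangle_left h hN q₁ p₁ q₂ p₂ q₃ p₃
  rw [smoothingWeight_triangle_left h hN p₁ q₁ p₂ q₂ p₃ q₃]
  simp only [hr _ q₁, hr p₁, hr p₂]
  rw [h2]
  simp only [delta_comm q₁ p₁, delta_comm q₂ p₂, delta_comm q₃ p₃]
  ring

/-- The value of a normalising factor of a crossing of sign `s`. -/
def curlFactor (A : kˣ) (s : ℤˣ) : k := -((A ^ (-3 * (s : ℤ)) : kˣ) : k)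

/-- The weight of a crossing of sign `s` in the Kauffman bracket. -/
def bracketWeight (A : kˣ) (s : ℤˣ) (a b c d : C) : k :=
  smoothingWeight ((A ^ (s : ℤ) : kˣ) : k) ((A ^ (-(s : ℤ)) : kˣ) : k) a b c d

/-- The weight of a crossing of sign `s` in the Jones polynomial. -/
def jonesWeight (A : kˣ) (s : ℤˣ) (a b c d : C) : k :=
  curlFactor A s * bracketWeight A s a b c d

/-- Reversing one of the two strands exchanges the oriented and the unoriented smoothing, as does a
change of sign. -/
lemma bracketWeight_neg (A : kˣ) (s : ℤˣ) (a b c d : C) :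
    bracketWeight A (-s) a b c d = bracketWeight A s b a c d := by
  simp only [bracketWeight, Units.val_neg, neg_neg]
  rw [weight_reverse_fst]

lemma bracketWeight_swap (A : kˣ) (s : ℤˣ) (a b c d : C) :
    bracketWeight A s b a d c = bracketWeight A s a b c d := by
  simp only [bracketWeight, smoothingWeight]; ring

lemma bracketWeight_triangle (A : kˣ)
    (hN : (Fintype.card C : k) = -(A : k) ^ 2 - ((A⁻¹ : kˣ) : k) ^ 2) (s : ℤˣ)
    (p₁ q₁ p₂ q₂ p₃ q₃ : C) :
    ∑ m₃, ∑ m₂, ∑ m₁, bracketWeight A s p₁ m₁ p₂ m₂ * (bracketWeight A s m₁ q₁ p₃ m₃ *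
      bracketWeight A s m₂ q₂ m₃ q₃) =
    ∑ m₃, ∑ m₂, ∑ m₁, bracketWeight A s m₁ q₁ m₂ q₂ * (bracketWeight A s p₁ m₁ m₃ q₃ *
      bracketWeight A s p₂ m₂ p₃ m₃) := by
  refine smoothingWeight_triangle ?_ ?_ p₁ q₁ p₂ q₂ p₃ q₃
  · rw [← Units.val_mul, ← zpow_add]; simp
  · rw [hN]
    rcases Int.units_eq_one_or s with rfl | rfl
    · simp
    · simp; ring

lemma curlFactor_mul_neg (A : kˣ) (s : ℤˣ) : curlFactor A s * curlFactor A (-s) = 1 := by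
  rw [curlFactor, curlFactor, neg_mul_neg, ← Units.val_mul, ← zpow_add]
  simp

/-- Reidemeister II. One state is the identity with coefficient αβ = 1; the other three, one of them
with a circle, are turn-backs with total coefficient α² + β² + αβN = 0. -/
lemma bracketWeight_bigon (A : kˣ)
    (hN : (Fintype.card C : k) = -(A : k) ^ 2 - ((A⁻¹ : kˣ) : k) ^ 2) (s : ℤˣ) (p₁ q₁ p₂ q₂ : C) :
    ∑ m₂, ∑ m₁, bracketWeight A s p₁ m₁ p₂ m₂ * bracketWeight A s q₁ m₁ m₂ q₂ =
    delta k p₁ q₁ * delta k p₂ q₂ := by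
  have hαβ : ((A ^ (s : ℤ) : kˣ) : k) * ((A ^ (-(s : ℤ)) : kˣ) : k) = 1 := by
    rw [← Units.val_mul, ← zpow_add]; simp
  have hN' : (Fintype.card C : k) =
      -((A ^ (s : ℤ) : kˣ) : k) ^ 2 - ((A ^ (-(s : ℤ)) : kˣ) : k) ^ 2 := by
    rw [hN]
    rcases Int.units_eq_one_or s with rfl | rfl
    · simp
    · simp; ring
  simp only [bracketWeight]
  set α := ((A ^ (s : ℤ) : kˣ) : k)
  set β := ((A ^ (-(s : ℤ)) : kˣ) : k)
  have e : ∀ m, ∑ m₁, smoothingWeight α β p₁ m₁ p₂ m * smoothingWeight α β q₁ m₁ m q₂ =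
      delta k p₁ m * (α * smoothingWeight α β q₁ p₂ m q₂) +
      β * delta k p₁ p₂ * (α * delta k q₁ q₂ + delta k m q₁ * (β * delta k m q₂)) := by
    intro m
    rw [sum_weight_out]
    simp only [smoothingWeight, delta_self, delta_comm q₁ m]
    ring
  simp only [e, Finset.sum_add_distrib, sum_delta_mul', ← Finset.mul_sum, sum_delta_mul,
    Finset.sum_const, Finset.card_univ, nsmul_eq_mul, hN']
  simp only [smoothingWeight, delta_comm q₁ p₁, delta_comm p₂ p₁]
  linear_combination (delta k p₁ q₁ * delta k p₂ q₂ - delta k p₁ p₂ * delta k q₁ q₂ * (α ^ 2 + β ^ 2)) * hαβ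

/-- Reidemeister I. A curl contributes αN + β = -α³ with α = A^s, which `curlFactor` is designed to
cancel. -/
lemma bracketWeight_curl (A : kˣ)
    (hN : (Fintype.card C : k) = -(A : k) ^ 2 - ((A⁻¹ : kˣ) : k) ^ 2) (s : ℤˣ) (p q : C) :
    curlFactor A s * ∑ m, bracketWeight A s p m m q = delta k p q := by
  have e : ∑ m, bracketWeight A s p m m q =
      (((A ^ (s : ℤ) : kˣ) : k) * Fintype.card C + ((A ^ (-(s : ℤ)) : kˣ) : k)) * delta k p q := by
    have : ∀ m, bracketWeight A s p m m q = ((A ^ (s : ℤ) : kˣ) : k) * delta k p q +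
        delta k p m * (((A ^ (-(s : ℤ)) : kˣ) : k) * delta k m q) := fun m => by
      simp only [bracketWeight, smoothingWeight, delta_self]; ring
    simp only [this, Finset.sum_add_distrib, sum_delta_mul', Finset.sum_const, Finset.card_univ,
      nsmul_eq_mul]
    ring
  have h1 : (A : k) * ((A⁻¹ : kˣ) : k) = 1 := by simp
  rw [e, hN]
  rcases Int.units_eq_one_or s with rfl | rfl
  · have : curlFactor A 1 = -((A⁻¹ : kˣ) : k) ^ 3 := by
      simp only [curlFactor, Units.val_one, mul_one]
      rw [show (-3 : ℤ) = -((3 : ℕ) : ℤ) from rfl, zpow_neg, zpow_natCast, ← inv_pow]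
      simp
    rw [this]
    simp only [Units.val_one, zpow_one, zpow_neg]
    set a := (A : k); set b := ((A⁻¹ : kˣ) : k)
    linear_combination (a ^ 2 * b ^ 2 + a * b + 1 + b ^ 4) * delta k p q * h1
  · have : curlFactor A (-1) = -(A : k) ^ 3 := by
      simp only [curlFactor, Units.val_neg, Units.val_one, mul_neg, mul_one, neg_neg]
      rw [show (3 : ℤ) = ((3 : ℕ) : ℤ) from rfl, zpow_natCast]
      simp
    rw [this]
    simp only [Units.val_neg, Units.val_one, zpow_one, zpow_neg, neg_neg]
    set a := (A : k); set b := ((A⁻¹ : kˣ) : k)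
    linear_combination (a ^ 2 * b ^ 2 + a * b + 1 + a ^ 4) * delta k p q * h1

end StateSum

/-! ### Invariance of the state sum under the moves. -/

namespace StateSum

variable {C k : Type*} [Fintype C] [DecidableEq C] [CommRing k]

lemma overLabels_perm {U V : List ChordEnd} (h : U.Perm V) :
    (overLabels U).Perm (overLabels V) := (h.filter _).map _

/-- Summing the product of the matrix entries of both endpoints of some chords gives the product of
the weights. -/
lemma sumOver_chords (w : ℤˣ → C → C → C → C → k) (l : List (ℕ × ℤˣ × C × C × C × C))
    (L : List ℕ) (hL : L.Perm (l.map Prod.fst)) (hl : L.Nodup) (F : Assignment C → k)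
    (hF : ∀ f, F f = (l.map fun t => endMatrix w f ⟨t.1, true, t.2.1⟩ t.2.2.1 t.2.2.2.1 *
      endMatrix w f ⟨t.1, false, t.2.1⟩ t.2.2.2.2.1 t.2.2.2.2.2).prod) (f : Assignment C) :
    sumOver L F f =
      (l.map fun t => w t.2.1 t.2.2.1 t.2.2.2.1 t.2.2.2.2.1 t.2.2.2.2.2).prod := by
  let h : (ℕ × ℤˣ × C × C × C × C) → (C × C) × (C × C) → k := fun t x =>
    Matrix.single x.1.1 x.1.2 (w t.2.1 x.1.1 x.1.2 x.2.1 x.2.2) t.2.2.1 t.2.2.2.1 *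
    Matrix.single x.2.1 x.2.2 (1 : k) t.2.2.2.2.1 t.2.2.2.2.2
  have hF' : ∀ f, F f = (l.map fun t => h t (f t.1)).prod := fun f => by
    rw [hF]; simp [h, endMatrix]
  rw [sumOver_congr hF', sumOver_perm hL]
  refine (sumOver_prod Prod.fst l (hL.nodup_iff.1 hl) h f).trans ?_
  congr 1
  refine List.map_congr_left fun t _ => ?_
  simp only [h, Matrix.single_apply, Fintype.sum_prod_type, ite_and, mul_ite, mul_one, mul_zero]
  simp

lemma path_pair_apply (w : ℤˣ → C → C → C → C → k) (f : Assignment C) (e e' : ChordEnd) (p q : C) :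
    path w f [e, e'] p q = ∑ m, endMatrix w f e p m * endMatrix w f e' m q := by
  simp [path, Matrix.mul_apply]

end StateSum

namespace GaussDiagram

variable {C k : Type*} [Fintype C] [DecidableEq C] [CommRing k]

lemma label_ne_of_perm (D : GaussDiagram) {R B : List ChordEnd} (h : D.word.Perm (R ++ B))
    (hB : ∀ b ∈ B, b.opp ∈ B) : ∀ e ∈ R, ∀ b ∈ B, e.label ≠ b.label := by
  intro e he b hb hl
  have hd : R.Disjoint B := (List.nodup_append'.1 (h.nodup_iff.1 D.nodup)).2.2
  rcases D.eq_or_eq_opp (h.mem_iff.2 (by simp [hb])) (h.mem_iff.2 (by simp [he])) hl.symm with h' | h'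
  · exact hd he (h' ▸ hb)
  · exact hd he (h' ▸ hB b hb)

/-- Blocks closed under `opp` contain both ends of their chords, so their labels occur nowhere else
and the comparison becomes local. Moves I and II fit in by taking some blocks empty. -/
lemma stateSum_replace (w : ℤˣ → C → C → C → C → k) {D D' : GaussDiagram}
    {u v x y B₁ B₂ B₃ B₁' B₂' B₃' : List ChordEnd}
    (hD : D.word = u ++ B₁ ++ v ++ B₂ ++ x ++ B₃ ++ y)
    (hD' : D'.word = u ++ B₁' ++ v ++ B₂' ++ x ++ B₃' ++ y)
    (hB : ∀ b ∈ B₁ ++ B₂ ++ B₃, b.opp ∈ B₁ ++ B₂ ++ B₃)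
    (hB' : ∀ b ∈ B₁' ++ B₂' ++ B₃', b.opp ∈ B₁' ++ B₂' ++ B₃')
    (h : (overLabels (B₁ ++ B₂ ++ B₃)).Nodup → (overLabels (B₁' ++ B₂' ++ B₃')).Nodup →
      ∀ (f : Assignment C) p₁ q₁ p₂ q₂ p₃ q₃,
      sumOver (overLabels (B₁ ++ B₂ ++ B₃))
        (fun f => path w f B₁ p₁ q₁ * path w f B₂ p₂ q₂ * path w f B₃ p₃ q₃) f =
      sumOver (overLabels (B₁' ++ B₂' ++ B₃'))
        (fun f => path w f B₁' p₁ q₁ * path w f B₂' p₂ q₂ * path w f B₃' p₃ q₃) f) :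
    stateSum w D.word = stateSum w D'.word := by
  have perm : ∀ T₁ T₂ T₃ : List ChordEnd, (u ++ T₁ ++ v ++ T₂ ++ x ++ T₃ ++ y).Perm
      ((u ++ v ++ x ++ y) ++ (T₁ ++ T₂ ++ T₃)) := by
    intro T₁ T₂ T₃
    rw [List.perm_iff_count]
    intro a
    simp only [List.count_append]
    omega
  have hP : D.word.Perm _ := hD ▸ perm B₁ B₂ B₃
  have hP' : D'.word.Perm _ := hD' ▸ perm B₁' B₂' B₃'
  have ne : ∀ {E : GaussDiagram} {T : List ChordEnd}, E.word.Perm ((u ++ v ++ x ++ y) ++ T) →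
      (∀ b ∈ T, b.opp ∈ T) → ∀ e ∈ u ++ v ++ x ++ y, e.label ∉ overLabels T := by
    intro E T hE hT e he hmem
    obtain ⟨b, hb, hbe⟩ := List.mem_map.1 hmem
    exact E.label_ne_of_perm hE hT e he b (List.mem_filter.1 hb).1 hbe.symm
  have nd : ∀ {E : GaussDiagram} {R T : List ChordEnd}, E.word.Perm (R ++ T) →
      (overLabels T).Nodup := by
    intro E R T hE
    have := (overLabels_perm hE).nodup_iff.1 E.overLabels_nodup
    rw [overLabels_append] at this
    exact (List.nodup_append'.1 this).2.1
  unfold stateSum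
  rw [sumOver_perm (overLabels_perm hP), sumOver_perm (overLabels_perm hP'),
    overLabels_append (u ++ v ++ x ++ y), overLabels_append (u ++ v ++ x ++ y), hD, hD']
  exact sumOver_trace_replace w (ne hP hB) (ne hP' hB') (h (nd hP) (nd hP'))

lemma path_ordered_apply (w : ℤˣ → C → C → C → C → k) (f : Assignment C) (a : ℤˣ)
    (e e' : ChordEnd) (p q : C) :
    path w f (ordered a e e') p q = ∑ m,
      endMatrix w f e (if a = 1 then p else m) (if a = 1 then m else q) *
      endMatrix w f e' (if a = 1 then m else p) (if a = 1 then q else m) := by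
  rcases Int.units_eq_one_or a with rfl | rfl
  · simp only [ordered, if_true, path_pair_apply]
  · simp only [ordered, show ¬ (-1 : ℤˣ) = 1 by decide, if_false, path_pair_apply]
    exact Finset.sum_congr rfl fun _ _ => mul_comm _ _

/-- The colours `m₁`, `m₂`, `m₃` sit on the sides of the triangle of a move III; the conditions
record, strand by strand, which of its two crossings is met first. -/
lemma sumOver_blocks_eq (A : kˣ) {i j l : ℕ} (hij : [i, j, l].Nodup) (a b c η d : ℤˣ)
    (f : Assignment C) (p₁ q₁ p₂ q₂ p₃ q₃ : C) :
    sumOver [i, j, l] (fun f => path (jonesWeight A) f (topBlock i j a b c η d) p₁ q₁ *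
      path (jonesWeight A) f (middleBlock i l a b c η d) p₂ q₂ *
      path (jonesWeight A) f (bottomBlock j l a b c η d) p₃ q₃) f =
    (curlFactor A (a * b * η) * curlFactor A (a * c * η) * curlFactor A (b * c * η)) *
    ∑ m₃, ∑ m₂, ∑ m₁,
      bracketWeight A (a * b * η) (if d * a = 1 then p₁ else m₁) (if d * a = 1 then m₁ else q₁)
        (if d * b = 1 then p₂ else m₂) (if d * b = 1 then m₂ else q₂) *
      (bracketWeight A (a * c * η) (if d * a = 1 then m₁ else p₁) (if d * a = 1 then q₁ else m₁)
        (if d * c = 1 then p₃ else m₃) (if d * c = 1 then m₃ else q₃) *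
      bracketWeight A (b * c * η) (if d * b = 1 then m₂ else p₂) (if d * b = 1 then q₂ else m₂)
        (if d * c = 1 then m₃ else p₃) (if d * c = 1 then q₃ else m₃)) := by
  have hchord : ∀ (s₁ s₂ s₃ : ℤˣ) (a₁ b₁ c₁ d₁ a₂ b₂ c₂ d₂ a₃ b₃ c₃ d₃ : C),
      sumOver [i, j, l] (fun f =>
        (endMatrix (jonesWeight A) f ⟨i, true, s₁⟩ a₁ b₁ *
          endMatrix (jonesWeight A) f ⟨j, true, s₂⟩ a₂ b₂) *
        (endMatrix (jonesWeight A) f ⟨i, false, s₁⟩ c₁ d₁ *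
          endMatrix (jonesWeight A) f ⟨l, true, s₃⟩ a₃ b₃) *
        (endMatrix (jonesWeight A) f ⟨j, false, s₂⟩ c₂ d₂ *
          endMatrix (jonesWeight A) f ⟨l, false, s₃⟩ c₃ d₃)) f =
      (curlFactor A s₁ * curlFactor A s₂ * curlFactor A s₃) *
        (bracketWeight A s₁ a₁ b₁ c₁ d₁ * (bracketWeight A s₂ a₂ b₂ c₂ d₂ *
          bracketWeight A s₃ a₃ b₃ c₃ d₃)) := by
    intro s₁ s₂ s₃ a₁ b₁ c₁ d₁ a₂ b₂ c₂ d₂ a₃ b₃ c₃ d₃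
    rw [sumOver_chords (jonesWeight A) [(i, s₁, a₁, b₁, c₁, d₁), (j, s₂, a₂, b₂, c₂, d₂),
      (l, s₃, a₃, b₃, c₃, d₃)] _ (by simp) hij _ (by intro f; simp; ring)]
    simp only [List.map_cons, List.map_nil, List.prod_cons, List.prod_nil, jonesWeight, mul_one]
    ring
  simp only [Finset.mul_sum, ← hchord, ← sumOver_sum]
  refine congrFun (sumOver_congr fun f => ?_) f
  simp only [topBlock, middleBlock, bottomBlock, path_ordered_apply, Finset.mul_sum,
    Finset.sum_mul]

lemma overLabels_blocks_perm (i j l : ℕ) (a b c η d : ℤˣ) :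
    (overLabels (topBlock i j a b c η d ++ middleBlock i l a b c η d ++
      bottomBlock j l a b c η d)).Perm [i, j, l] := by
  rcases Int.units_eq_one_or (d * a) with ha | ha <;>
  rcases Int.units_eq_one_or (d * b) with hb | hb <;>
  rcases Int.units_eq_one_or (d * c) with hc | hc <;>
  simp [topBlock, middleBlock, bottomBlock, ordered, ha, hb, hc, overLabels, 
    show ¬ (-1 : ℤˣ) = 1 by decide, List.Perm.swap]

lemma opp_mem_blocks (i j l : ℕ) (a b c η d : ℤˣ) :
    ∀ e ∈ topBlock i j a b c η d ++ middleBlock i l a b c η d ++ bottomBlock j l a b c η d,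
      e.opp ∈ topBlock i j a b c η d ++ middleBlock i l a b c η d ++ bottomBlock j l a b c η d := by
  rcases Int.units_eq_one_or (d * a) with ha | ha <;>
  rcases Int.units_eq_one_or (d * b) with hb | hb <;>
  rcases Int.units_eq_one_or (d * c) with hc | hc <;>
  simp [topBlock, middleBlock, bottomBlock, ordered, ha, hb, hc, ChordEnd.opp,
    show ¬ (-1 : ℤˣ) = 1 by decide]

section moves

variable (A : kˣ) (hN : (Fintype.card C : k) = -(A : k) ^ 2 - ((A⁻¹ : kˣ) : k) ^ 2)
include hN

lemma stateSum_r1 {D D' : GaussDiagram} {u v : List ChordEnd} {e : ChordEnd}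
    (h : D.word = u ++ [e, e.opp] ++ v) (h' : D'.word = u ++ v) :
    stateSum (jonesWeight (C := C) A) D.word = stateSum (jonesWeight A) D'.word := by
  refine stateSum_replace (u := u) (v := v) (x := []) (y := []) (B₁ := [e, e.opp]) (B₂ := [])
    (B₃ := []) (B₁' := []) (B₂' := []) (B₃' := []) _ (by simpa using h) (by simpa using h')
    (by simp [opp_opp]) (by simp) ?_
  intro hnd _ f p₁ q₁ p₂ q₂ p₃ q₃
  obtain ⟨i, o, s⟩ := e
  have hL : overLabels ([⟨i, o, s⟩, ChordEnd.opp ⟨i, o, s⟩] ++ [] ++ []) = [i] := by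
    cases o <;> simp [overLabels, ChordEnd.opp]
  rw [hL, sumOver_congr (G := fun f => ∑ m, (1 : Matrix C C k) p₂ q₂ * (1 : Matrix C C k) p₃ q₃ *
    (endMatrix (jonesWeight A) f ⟨i, o, s⟩ p₁ m * endMatrix (jonesWeight A) f ⟨i, !o, s⟩ m q₁)),
    sumOver_sum]
  · have key : ∀ m, sumOver [i] (fun f => endMatrix (jonesWeight A) f ⟨i, o, s⟩ p₁ m *
        endMatrix (jonesWeight A) f ⟨i, !o, s⟩ m q₁) f =
        jonesWeight A s p₁ m m q₁ := by
      intro m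
      cases o
      · rw [sumOver_chords (jonesWeight A) [(i, s, m, q₁, p₁, m)] _ (by simp) (by simp) _ (by simp [mul_comm])]
        simp only [List.map_cons, List.map_nil, List.prod_singleton, jonesWeight, bracketWeight]
        rw [weight_symm]
      · rw [sumOver_chords (jonesWeight A) [(i, s, p₁, m, m, q₁)] _ (by simp) (by simp) _ (by simp)]
        simp
    simp only [sumOver_const_mul, key, jonesWeight, ← Finset.mul_sum]
    rw [bracketWeight_curl A hN]
    simp only [overLabels, List.append_nil, List.filter_nil, List.map_nil, sumOver, path_nil,
      one_apply_eq_delta]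
    ring
  · intro f
    rw [path_pair_apply, ← Finset.mul_sum]
    simp only [path_nil, ChordEnd.opp]
    ring

lemma stateSum_r2_parallel {D D' : GaussDiagram} {u v x : List ChordEnd} {i j : ℕ} {s : ℤˣ}
    (h : D.word = u ++ [⟨i, true, s⟩, ⟨j, true, -s⟩] ++ v
        ++ [⟨i, false, s⟩, ⟨j, false, -s⟩] ++ x)
    (h' : D'.word = u ++ v ++ x) :
    stateSum (jonesWeight (C := C) A) D.word = stateSum (jonesWeight A) D'.word := by
  refine stateSum_replace (u := u) (v := v) (x := x) (y := [])
    (B₁ := [⟨i, true, s⟩, ⟨j, true, -s⟩]) (B₂ := [⟨i, false, s⟩, ⟨j, false, -s⟩])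
    (B₃ := []) (B₁' := []) (B₂' := []) (B₃' := []) _ (by simpa using h) (by simpa using h')
    (by simp [ChordEnd.opp]) (by simp) ?_
  intro hnd _ f p₁ q₁ p₂ q₂ p₃ q₃
  rw [sumOver_congr (G := fun f => ∑ m₂, ∑ m₁, (1 : Matrix C C k) p₃ q₃ *
    ((endMatrix (jonesWeight A) f ⟨i, true, s⟩ p₁ m₁ *
      endMatrix (jonesWeight A) f ⟨j, true, -s⟩ m₁ q₁) *
    (endMatrix (jonesWeight A) f ⟨i, false, s⟩ p₂ m₂ *
      endMatrix (jonesWeight A) f ⟨j, false, -s⟩ m₂ q₂)))]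
  · simp only [sumOver_sum, sumOver_const_mul]
    have key : ∀ m₂ m₁, sumOver (overLabels ([⟨i, true, s⟩, ⟨j, true, -s⟩] ++
        [⟨i, false, s⟩, ⟨j, false, -s⟩] ++ [])) (fun f =>
        ((endMatrix (jonesWeight A) f ⟨i, true, s⟩ p₁ m₁ *
          endMatrix (jonesWeight A) f ⟨j, true, -s⟩ m₁ q₁) *
        (endMatrix (jonesWeight A) f ⟨i, false, s⟩ p₂ m₂ *
          endMatrix (jonesWeight A) f ⟨j, false, -s⟩ m₂ q₂))) f =
        bracketWeight A s p₁ m₁ p₂ m₂ * bracketWeight A s q₁ m₁ m₂ q₂ := by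
      intro m₂ m₁
      rw [sumOver_chords (jonesWeight A) [(i, s, p₁, m₁, p₂, m₂), (j, -s, m₁, q₁, m₂, q₂)] _
        (by simp [overLabels]) hnd _ (by intro f; simp; ring)]
      simp only [List.map_cons, List.map_nil, List.prod_cons, List.prod_nil, jonesWeight, mul_one,
        bracketWeight_neg]
      linear_combination (bracketWeight A s p₁ m₁ p₂ m₂ * bracketWeight A s q₁ m₁ m₂ q₂) *
        curlFactor_mul_neg A s
    simp only [key, ← Finset.mul_sum]
    rw [bracketWeight_bigon A hN]
    simp only [overLabels, List.append_nil, List.filter_nil, List.map_nil, sumOver, path_nil,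
      one_apply_eq_delta]
    ring
  · intro f
    rw [path_pair_apply, path_pair_apply, Finset.sum_mul_sum, Finset.sum_comm, Finset.sum_mul]
    simp only [path_nil, Finset.sum_mul]
    exact Finset.sum_congr rfl fun _ _ => Finset.sum_congr rfl fun _ _ => by ring

lemma stateSum_r2_antiparallel {D D' : GaussDiagram} {u v x : List ChordEnd} {i j : ℕ} {s : ℤˣ}
    (h : D.word = u ++ [⟨i, true, s⟩, ⟨j, true, -s⟩] ++ v
        ++ [⟨j, false, -s⟩, ⟨i, false, s⟩] ++ x)
    (h' : D'.word = u ++ v ++ x) :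
    stateSum (jonesWeight (C := C) A) D.word = stateSum (jonesWeight A) D'.word := by
  refine stateSum_replace (u := u) (v := v) (x := x) (y := [])
    (B₁ := [⟨i, true, s⟩, ⟨j, true, -s⟩]) (B₂ := [⟨j, false, -s⟩, ⟨i, false, s⟩])
    (B₃ := []) (B₁' := []) (B₂' := []) (B₃' := []) _ (by simpa using h) (by simpa using h')
    (by simp [ChordEnd.opp]) (by simp) ?_
  intro hnd _ f p₁ q₁ p₂ q₂ p₃ q₃
  rw [sumOver_congr (G := fun f => ∑ m₂, ∑ m₁, (1 : Matrix C C k) p₃ q₃ *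
    ((endMatrix (jonesWeight A) f ⟨i, true, s⟩ p₁ m₁ *
      endMatrix (jonesWeight A) f ⟨j, true, -s⟩ m₁ q₁) *
    (endMatrix (jonesWeight A) f ⟨j, false, -s⟩ p₂ m₂ *
      endMatrix (jonesWeight A) f ⟨i, false, s⟩ m₂ q₂)))]
  · simp only [sumOver_sum, sumOver_const_mul]
    -- Reading the second strand backwards turns the antiparallel bigon into the parallel one with
    -- sign `-s`.
    have key : ∀ m₂ m₁, sumOver (overLabels ([⟨i, true, s⟩, ⟨j, true, -s⟩] ++
        [⟨j, false, -s⟩, ⟨i, false, s⟩] ++ [])) (fun f =>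
        ((endMatrix (jonesWeight A) f ⟨i, true, s⟩ p₁ m₁ *
          endMatrix (jonesWeight A) f ⟨j, true, -s⟩ m₁ q₁) *
        (endMatrix (jonesWeight A) f ⟨j, false, -s⟩ p₂ m₂ *
          endMatrix (jonesWeight A) f ⟨i, false, s⟩ m₂ q₂))) f =
        bracketWeight A (-s) p₁ m₁ q₂ m₂ * bracketWeight A (-s) q₁ m₁ m₂ p₂ := by
      intro m₂ m₁
      rw [sumOver_chords (jonesWeight A) [(i, s, p₁, m₁, m₂, q₂), (j, -s, m₁, q₁, p₂, m₂)] _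
        (by simp [overLabels]) hnd _ (by intro f; simp; ring)]
      simp only [List.map_cons, List.map_nil, List.prod_cons, List.prod_nil, jonesWeight, mul_one,
        bracketWeight_neg]
      rw [bracketWeight_swap A s p₁ m₁ m₂ q₂, bracketWeight_swap A s q₁ m₁ p₂ m₂] 
      linear_combination (bracketWeight A s p₁ m₁ m₂ q₂ * bracketWeight A s q₁ m₁ p₂ m₂) *
        curlFactor_mul_neg A s
    simp only [key, ← Finset.mul_sum]
    rw [bracketWeight_bigon A hN]
    simp only [overLabels, List.append_nil, List.filter_nil, List.map_nil, sumOver, path_nil,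
      one_apply_eq_delta, delta_comm q₂]
    ring
  · intro f
    rw [path_pair_apply, path_pair_apply, Finset.sum_mul_sum, Finset.sum_comm, Finset.sum_mul]
    simp only [path_nil, Finset.sum_mul]
    exact Finset.sum_congr rfl fun _ _ => Finset.sum_congr rfl fun _ _ => by ring

/-- Reversing strands brings all eight orders to the case `a = b = c = 1`. Each reversal changes the
sign of the two crossings on that strand, and the signs `a * b * η`, `a * c * η`, `b * c * η` are
such that every weight ends up with the same sign `η`; then one triangle identity suffices. -/
lemma sumOver_blocks {i j l : ℕ} (hij : [i, j, l].Nodup) (a b c η : ℤˣ) (f : Assignment C)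
    (p₁ q₁ p₂ q₂ p₃ q₃ : C) :
    sumOver [i, j, l] (fun f => path (jonesWeight A) f (topBlock i j a b c η 1) p₁ q₁ *
      path (jonesWeight A) f (middleBlock i l a b c η 1) p₂ q₂ *
      path (jonesWeight A) f (bottomBlock j l a b c η 1) p₃ q₃) f =
    sumOver [i, j, l] (fun f => path (jonesWeight A) f (topBlock i j a b c η (-1)) p₁ q₁ *
      path (jonesWeight A) f (middleBlock i l a b c η (-1)) p₂ q₂ *
      path (jonesWeight A) f (bottomBlock j l a b c η (-1)) p₃ q₃) f := by
  rw [sumOver_blocks_eq A hij, sumOver_blocks_eq A hij]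
  congr 1
  have hne : ¬ (-1 : ℤˣ) = 1 := by decide
  have tri := bracketWeight_triangle (C := C) A hN η
  have hr : ∀ x y z t : C, bracketWeight A η x y z t = bracketWeight A η y x t z :=
    fun x y z t => bracketWeight_swap A η y x t z
  rcases Int.units_eq_one_or a with rfl | rfl <;> rcases Int.units_eq_one_or b with rfl | rfl <;>
  rcases Int.units_eq_one_or c with rfl | rfl <;>
  simp only [mul_one, one_mul, mul_neg, neg_mul, neg_neg, hne, if_true, if_false,
    bracketWeight_neg]
  · exact tri p₁ q₁ p₂ q₂ p₃ q₃
  · refine Eq.trans ?_ ((tri p₁ q₁ p₂ q₂ q₃ p₃).trans ?_) <;> simp only [hr] 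
  · refine Eq.trans ?_ ((tri p₁ q₁ q₂ p₂ p₃ q₃).trans ?_) <;> simp only [hr]
  · refine Eq.trans ?_ ((tri p₁ q₁ q₂ p₂ q₃ p₃).trans ?_) <;> simp only [hr]
  · refine Eq.trans ?_ ((tri q₁ p₁ p₂ q₂ p₃ q₃).trans ?_) <;> simp only [hr]
  · refine Eq.trans ?_ ((tri q₁ p₁ p₂ q₂ q₃ p₃).trans ?_) <;> simp only [hr]
  · refine Eq.trans ?_ ((tri q₁ p₁ q₂ p₂ p₃ q₃).trans ?_) <;> simp only [hr]
  · refine Eq.trans ?_ ((tri q₁ p₁ q₂ p₂ q₃ p₃).trans ?_) <;> simp only [hr]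

lemma stateSum_r3_tmb {D D' : GaussDiagram} {u v x y : List ChordEnd} {i j l : ℕ} {a b c η : ℤˣ}
    (h : D.word = u ++ topBlock i j a b c η 1 ++ v ++ middleBlock i l a b c η 1 ++ x
        ++ bottomBlock j l a b c η 1 ++ y)
    (h' : D'.word = u ++ topBlock i j a b c η (-1) ++ v ++ middleBlock i l a b c η (-1) ++ x
        ++ bottomBlock j l a b c η (-1) ++ y) :
    stateSum (jonesWeight (C := C) A) D.word = stateSum (jonesWeight A) D'.word := by
  refine stateSum_replace _ h h' (opp_mem_blocks i j l a b c η 1)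
    (opp_mem_blocks i j l a b c η (-1)) ?_
  intro hnd _ f p₁ q₁ p₂ q₂ p₃ q₃
  rw [sumOver_perm (overLabels_blocks_perm ..), sumOver_perm (overLabels_blocks_perm ..)]
  exact sumOver_blocks A hN ((overLabels_blocks_perm ..).nodup_iff.1 hnd) ..

lemma stateSum_r3_tbm {D D' : GaussDiagram} {u v x y : List ChordEnd} {i j l : ℕ} {a b c η : ℤˣ}
    (h : D.word = u ++ topBlock i j a b c η 1 ++ v ++ bottomBlock j l a b c η 1 ++ x
        ++ middleBlock i l a b c η 1 ++ y)
    (h' : D'.word = u ++ topBlock i j a b c η (-1) ++ v ++ bottomBlock j l a b c η (-1) ++ x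
        ++ middleBlock i l a b c η (-1) ++ y) :
    stateSum (jonesWeight (C := C) A) D.word = stateSum (jonesWeight A) D'.word := by
  have hp : ∀ d : ℤˣ, (topBlock i j a b c η d ++ bottomBlock j l a b c η d ++
      middleBlock i l a b c η d).Perm (topBlock i j a b c η d ++ middleBlock i l a b c η d ++
        bottomBlock j l a b c η d) := by
    intro d
    rw [List.append_assoc, List.append_assoc]
    exact List.Perm.append_left _ List.perm_append_comm
  have ho : ∀ d : ℤˣ, ∀ e ∈ topBlock i j a b c η d ++ bottomBlock j l a b c η d ++
      middleBlock i l a b c η d, e.opp ∈ topBlock i j a b c η d ++ bottomBlock j l a b c η d ++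
      middleBlock i l a b c η d := by
    intro d e he
    rw [(hp d).mem_iff] at he ⊢
    exact opp_mem_blocks i j l a b c η d e he
  have hq : ∀ d : ℤˣ, (overLabels (topBlock i j a b c η d ++ bottomBlock j l a b c η d ++
      middleBlock i l a b c η d)).Perm [i, j, l] := fun d =>
    (overLabels_perm (hp d)).trans (overLabels_blocks_perm ..)
  refine stateSum_replace _ h h' (ho 1) (ho (-1)) ?_
  intro hnd _ f p₁ q₁ p₂ q₂ p₃ q₃
  rw [sumOver_perm (hq _), sumOver_perm (hq _)]
  simpa only [mul_right_comm] using
    sumOver_blocks A hN ((hq _).nodup_iff.1 hnd) a b c η f p₁ q₁ p₃ q₃ p₂ q₂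

lemma stateSum_eq_of_move {D D' : GaussDiagram} (h : Move D D') (f : Assignment C) :
    ∃ g : Assignment C, stateSum (jonesWeight A) D.word f = stateSum (jonesWeight A) D'.word g := by
  cases h with
  | rotate u v h h' => exact ⟨f, by rw [h, h', stateSum_rotate]⟩
  | relabel σ h => exact ⟨f ∘ σ.symm, by
      rw [h, stateSum_relabel (C := C) (jonesWeight A) σ, Function.comp_assoc]; simp⟩
  | r1 u v e h h' => exact ⟨f, by rw [stateSum_r1 A hN h h']⟩
  | r2_parallel u v x i j s h h' => exact ⟨f, by rw [stateSum_r2_parallel A hN h h']⟩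
  | r2_antiparallel u v x i j s h h' => exact ⟨f, by rw [stateSum_r2_antiparallel A hN h h']⟩
  | r3_tmb u v x y i j l a b c η h h' => exact ⟨f, by rw [stateSum_r3_tmb A hN h h']⟩
  | r3_tbm u v x y i j l a b c η h h' => exact ⟨f, by rw [stateSum_r3_tbm A hN h h']⟩

end moves

end GaussDiagram

/-! ### The Jones polynomial as a state sum. -/

/-- Functions on a quotient are the functions that are constant on its classes. -/
def quotFunEquiv {α C : Type*} (r : α → α → Prop) :
    (Quot r → C) ≃ {c : α → C // ∀ a b, r a b → c a = c b} where
  toFun g := ⟨fun a => g (Quot.mk r a), fun _ _ h => congrArg g (Quot.sound h)⟩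
  invFun c := Quot.lift c.1 c.2
  left_inv g := by ext x; induction x using Quot.ind; rfl
  right_inv c := rfl

-- Turns a number of classes into a sum over colourings; used for the circles of a Kauffman state
-- and for the faces of a diagram.
open Classical in
lemma card_pow_card_quot {α C : Type*} [Fintype α] [Fintype C] (r : α → α → Prop) :
    Fintype.card C ^ Nat.card (Quot r) =
      ∑ c : α → C, if ∀ a b, r a b → c a = c b then 1 else 0 := by
  have : Finite (Quot r) := Finite.of_surjective (Quot.mk r) Quot.mk_surjective
  rw [← Nat.card_eq_fintype_card, ← Nat.card_fun, Nat.card_congr (quotFunEquiv (C := C) r),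
    Nat.card_eq_fintype_card, Fintype.card_subtype, Finset.card_filter]

namespace GaussDiagram

variable {C k : Type*} [Fintype C] [DecidableEq C] [CommRing k]

/-- The label of an over passage. -/
def OverPassage.label {D : GaussDiagram} (p : D.OverPassage) : ℕ := p.1.1.label

lemma OverPassage.label_injective (D : GaussDiagram) :
    Function.Injective (OverPassage.label : D.OverPassage → ℕ) := by
  intro p q h
  rcases D.eq_or_eq_opp p.1.2 q.1.2 h with h' | h'
  · exact Subtype.ext (Subtype.ext h'.symm)
  · have := q.2
    rw [h'] at this
    simp [ChordEnd.opp, p.2] at this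

lemma crossings_eq (D : GaussDiagram) :
    D.crossings = Finset.univ.image (OverPassage.label : D.OverPassage → ℕ) := by
  ext i
  simp only [crossings, List.mem_toFinset, List.mem_map, Finset.mem_image, Finset.mem_univ,
    true_and]
  constructor
  · rintro ⟨e, he, rfl⟩
    by_cases ho : e.isOver = true
    · exact ⟨⟨⟨e, he⟩, ho⟩, rfl⟩
    · exact ⟨⟨⟨e.opp, D.opp_mem e he⟩, by simpa [ChordEnd.opp] using ho⟩, rfl⟩
  · rintro ⟨p, rfl⟩
    exact ⟨p.1.1, p.1.2, rfl⟩

lemma prod_filter_over (D : GaussDiagram) (F : D.Passage → k) :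
    ((D.word.attach.filter fun p => p.1.isOver).map F).prod = ∏ p : D.OverPassage, F p.1 := by
  have hnd : (D.word.attach.filter fun p => p.1.isOver).Nodup :=
    (List.nodup_attach.2 D.nodup).filter _
  rw [← List.prod_toFinset _ hnd]
  refine Finset.prod_subtype _ ?_ _
  intro p; simp

lemma writhe_eq (D : GaussDiagram) : D.writhe = ∑ p : D.OverPassage, (p.1.1.sign : ℤ) := by
  have h : D.word = D.word.attach.map Subtype.val := by simp
  have hnd : (D.word.attach.filter fun p => p.1.isOver).Nodup :=
    (List.nodup_attach.2 D.nodup).filter _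
  have h2 : D.writhe = ((D.word.attach.filter fun p => p.1.isOver).map
      fun p : D.Passage => (p.1.sign : ℤ)).sum := by
    conv_lhs => rw [writhe, h, List.filter_map, List.map_map]
    rfl
  rw [h2, ← List.sum_toFinset _ hnd]
  refine Finset.sum_subtype _ ?_ _
  intro p; simp

/-- A colouring of the arcs is constant on the circles of a state if and only if it is so near every
crossing. -/
lemma forall_joined_iff (D : GaussDiagram) (S : Finset ℕ) (c : D.Passage → C) :
    (∀ p q, Joined D S p q → c p = c q) ↔ ∀ p : D.OverPassage,
      if (p.label ∈ S ↔ p.1.1.sign = 1)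
      then c p.1 = c (D.succ (D.partner p.1)) ∧ c (D.succ p.1) = c (D.partner p.1)
      else c p.1 = c (D.partner p.1) ∧ c (D.succ p.1) = c (D.succ (D.partner p.1)) := by
  have hpp : ∀ p, D.partner (D.partner p) = p := fun p => Subtype.ext (opp_opp _)
  constructor
  · intro h p
    split_ifs with hp
    · refine ⟨h _ _ (.oriented p.1 hp), ?_⟩
      have := h _ _ (.oriented (D.partner p.1) hp)
      rw [hpp] at this
      exact this.symm
    · exact ⟨h _ _ (.unoriented_in p.1 hp), h _ _ (.unoriented_out p.1 hp)⟩
  · intro h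
    have key : ∀ p : D.Passage, if (p.1.label ∈ S ↔ p.1.sign = 1)
        then c p = c (D.succ (D.partner p)) ∧ c (D.succ p) = c (D.partner p)
        else c p = c (D.partner p) ∧ c (D.succ p) = c (D.succ (D.partner p)) := by
      intro p
      by_cases ho : p.1.isOver = true
      · exact h ⟨p, ho⟩
      · have := h ⟨D.partner p, by simpa [partner, ChordEnd.opp] using ho⟩
        simp only [OverPassage.label, partner, ChordEnd.opp] at this
        change if (p.1.label ∈ S ↔ p.1.sign = 1)
          then c (D.partner p) = c (D.succ (D.partner (D.partner p))) ∧
            c (D.succ (D.partner p)) = c (D.partner (D.partner p))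
          else c (D.partner p) = c (D.partner (D.partner p)) ∧
            c (D.succ (D.partner p)) = c (D.succ (D.partner (D.partner p))) at this
        rw [hpp] at this
        split_ifs at this ⊢
        · exact ⟨this.2.symm, this.1.symm⟩
        · exact ⟨this.1.symm, this.2.symm⟩
    intro p q hpq
    cases hpq with
    | oriented p h' => have := key p; rw [if_pos h'] at this; exact this.1
    | unoriented_in p h' => have := key p; rw [if_neg h'] at this; exact this.1
    | unoriented_out p h' => have := key p; rw [if_neg h'] at this; exact this.2

/-- Counting the colourings of the circles of a state as colourings of the arcs. -/
lemma card_pow_loopCount (D : GaussDiagram) (hD : D.word ≠ []) (S : Finset ℕ) :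
    (Fintype.card C : k) ^ D.loopCount S = ∑ c : D.Passage → C, ∏ p : D.OverPassage,
      if (p.label ∈ S ↔ p.1.1.sign = 1)
      then delta k (c p.1) (c (D.succ (D.partner p.1))) *
        delta k (c (D.succ p.1)) (c (D.partner p.1))
      else delta k (c p.1) (c (D.partner p.1)) *
        delta k (c (D.succ p.1)) (c (D.succ (D.partner p.1))) := by
  classical
  rw [loopCount, if_neg hD, ← Nat.cast_pow, card_pow_card_quot, Nat.cast_sum]
  refine Finset.sum_congr (by ext; simp) fun c _ => ?_
  simp only [forall_joined_iff]
  by_cases h : ∀ p : D.OverPassage,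
      if (p.label ∈ S ↔ p.1.1.sign = 1)
      then c p.1 = c (D.succ (D.partner p.1)) ∧ c (D.succ p.1) = c (D.partner p.1)
      else c p.1 = c (D.partner p.1) ∧ c (D.succ p.1) = c (D.succ (D.partner p.1))
  · rw [if_pos h, Nat.cast_one]
    refine (Finset.prod_eq_one fun p _ => ?_).symm
    have := h p
    split_ifs at this ⊢ <;> simp [delta, this.1, this.2]
  · rw [if_neg h, Nat.cast_zero]
    obtain ⟨p, hp⟩ := not_forall.1 h
    refine (Finset.prod_eq_zero (Finset.mem_univ p) ?_).symm
    split_ifs at hp ⊢ <;> rw [not_and_or] at hp <;> rcases hp with hp | hp <;> simp [delta, hp]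

lemma one_le_loopCount (D : GaussDiagram) (S : Finset ℕ) : 1 ≤ D.loopCount S := by
  unfold loopCount
  split_ifs with h
  · rfl
  · obtain ⟨e, he⟩ := List.exists_mem_of_ne_nil _ h
    have : Nonempty (Quot (Joined D S)) := ⟨Quot.mk _ ⟨e, he⟩⟩
    have : Finite (Quot (Joined D S)) := Finite.of_surjective (Quot.mk _) Quot.mk_surjective
    exact Nat.card_pos

lemma sum_powerset_crossings (D : GaussDiagram) (F : Finset ℕ → k) :
    ∑ S ∈ D.crossings.powerset, F S =
      ∑ t ∈ (Finset.univ : Finset D.OverPassage).powerset, F (t.image OverPassage.label) := by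
  rw [crossings_eq, Finset.powerset_image, Finset.sum_image]
  exact fun a _ b _ h => Finset.image_injective (OverPassage.label_injective D) h

variable (A : kˣ) (hN : (Fintype.card C : k) = -(A : k) ^ 2 - ((A⁻¹ : kˣ) : k) ^ 2)
include hN

/-- Evaluation of a Laurent polynomial with integer coefficients. -/
noncomputable abbrev _root_.LaurentPolynomial.evalInt {k : Type*} [CommRing k] (A : kˣ) :
    ℤ[T;T⁻¹] →+* k := LaurentPolynomial.eval₂ (Int.castRingHom k) A

/-- The extra factor N restores the circle that the exponent `loopCount S - 1` leaves out. Then N to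
the number of circles counts the arc colourings constant on circles, and summing over states before
colours gives a product over crossings. -/
lemma evalInt_bracket_mul_card (D : GaussDiagram) (hD : D.word ≠ []) :
    LaurentPolynomial.evalInt A D.bracket * Fintype.card C = ∑ c : D.Passage → C,
      ∏ p : D.OverPassage, bracketWeight A p.1.1.sign (c p.1) (c (D.succ p.1)) (c (D.partner p.1))
        (c (D.succ (D.partner p.1))) := by
  have hval : LaurentPolynomial.evalInt A (-LaurentPolynomial.T 2 - LaurentPolynomial.T (-2)) =
      Fintype.card C := by
    rw [hN, map_sub, map_neg, LaurentPolynomial.eval₂_T, LaurentPolynomial.eval₂_T, zpow_neg,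
      ← inv_zpow]
    norm_cast
  rw [bracket, map_sum, Finset.sum_mul]
  have h1 : ∀ S : Finset ℕ, LaurentPolynomial.evalInt A
      (LaurentPolynomial.T ((S.card : ℤ) - ((D.crossings \ S).card : ℤ)) *
      (-LaurentPolynomial.T 2 - LaurentPolynomial.T (-2)) ^ (D.loopCount S - 1)) *
        (Fintype.card C : k) =
      (A : k) ^ S.card * ((A⁻¹ : kˣ) : k) ^ (D.crossings \ S).card *
        (Fintype.card C : k) ^ D.loopCount S := by
    intro S
    rw [map_mul, map_pow, hval, LaurentPolynomial.eval₂_T, mul_assoc, ← pow_succ,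
      Nat.sub_add_cancel (D.one_le_loopCount S), sub_eq_add_neg, zpow_add, zpow_neg, ← inv_zpow]
    norm_cast
  simp only [h1]
  rw [sum_powerset_crossings]
  simp only [card_pow_loopCount D hD, Finset.mul_sum]
  rw [Finset.sum_comm]
  refine Finset.sum_congr rfl fun c _ => ?_
  have h2 : ∀ p : D.OverPassage, bracketWeight A p.1.1.sign (c p.1) (c (D.succ p.1))
      (c (D.partner p.1)) (c (D.succ (D.partner p.1))) =
      (A : k) * (if p.1.1.sign = 1
        then delta k (c p.1) (c (D.succ (D.partner p.1))) *
          delta k (c (D.succ p.1)) (c (D.partner p.1))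
        else delta k (c p.1) (c (D.partner p.1)) *
          delta k (c (D.succ p.1)) (c (D.succ (D.partner p.1)))) +
      ((A⁻¹ : kˣ) : k) * (if p.1.1.sign = 1
        then delta k (c p.1) (c (D.partner p.1)) *
          delta k (c (D.succ p.1)) (c (D.succ (D.partner p.1)))
        else delta k (c p.1) (c (D.succ (D.partner p.1))) *
          delta k (c (D.succ p.1)) (c (D.partner p.1))) := by
    intro p
    rcases Int.units_eq_one_or p.1.1.sign with hs | hs
    · simp [hs, bracketWeight, smoothingWeight]
    · simp [hs, bracketWeight, smoothingWeight, show ¬ (-1 : ℤˣ) = 1 by decide]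
      ring
  -- Expanding the product over crossings chooses a smoothing at each: `t` is the set of those that
  -- get the `A`-smoothing.
  rw [Finset.prod_congr rfl fun p _ => h2 p, Finset.prod_add]
  refine Finset.sum_congr rfl fun t _ => ?_
  have hc1 : (t.image (OverPassage.label : D.OverPassage → ℕ)).card = t.card :=
    Finset.card_image_of_injective _ (OverPassage.label_injective D)
  have hc2 : (D.crossings \ t.image (OverPassage.label : D.OverPassage → ℕ)).card =
      (Finset.univ \ t).card := by
    rw [crossings_eq, ← Finset.image_sdiff _ _ (OverPassage.label_injective D),
      Finset.card_image_of_injective _ (OverPassage.label_injective D)]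
  have hmem : ∀ p : D.OverPassage, p.label ∈ t.image OverPassage.label ↔ p ∈ t := fun p =>
    (OverPassage.label_injective D).mem_finset_image
  rw [hc1, hc2, Finset.prod_mul_distrib, Finset.prod_mul_distrib, Finset.prod_const,
    Finset.prod_const, mul_mul_mul_comm]
  congr 1
  rw [← Finset.prod_mul_prod_compl t, ← Finset.compl_eq_univ_sdiff]
  congr 1
  · refine Finset.prod_congr rfl fun p hp => ?_
    simp only [hmem, hp, true_iff]
  · refine Finset.prod_congr rfl fun p hp => ?_
    have hp' : p ∉ t := by simpa using hp
    by_cases hs : p.1.1.sign = 1 <;> simp [hmem, hp', hs]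

/-- The Jones polynomial, evaluated where the value of a circle is the number of colours, is a state
sum. -/
lemma evalInt_jones_mul_card (D : GaussDiagram) (f : Assignment C) :
    LaurentPolynomial.evalInt A D.jones * Fintype.card C = stateSum (jonesWeight A) D.word f := by
  by_cases hD : D.word = []
  · have h1 : D.crossings = ∅ := by simp [crossings, hD]
    have h2 : D.writhe = 0 := by simp [writhe, hD]
    have h3 : ∀ S, D.loopCount S = 1 := fun S => by simp [loopCount, hD]
    simp [jones, bracket, h1, h2, h3, stateSum, hD, overLabels, sumOver, Matrix.trace_one]
  · rw [jones, map_mul, mul_assoc, evalInt_bracket_mul_card A hN D hD,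
      stateSum_eq_sum_colorings _ D hD, Finset.mul_sum]
    refine Finset.sum_congr rfl fun c _ => ?_
    rw [D.prod_filter_over fun p => jonesWeight A p.1.sign (c p) (c (D.succ p)) (c (D.partner p))
      (c (D.succ (D.partner p)))]
    simp only [jonesWeight, Finset.prod_mul_distrib]
    congr 1
    have hcard : D.crossings.card = Fintype.card D.OverPassage := by
      rw [crossings_eq, Finset.card_image_of_injective _ (OverPassage.label_injective D),
        Finset.card_univ]
    simp only [curlFactor]
    rw [map_mul, map_pow, map_neg, map_one, LaurentPolynomial.eval₂_T, hcard, Finset.prod_neg,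
      writhe_eq, Finset.mul_sum, Finset.card_univ]
    congr 1
    have : ∀ (s : Finset D.OverPassage), ((A ^ (∑ p ∈ s, -3 * (p.1.1.sign : ℤ)) : kˣ) : k) =
        ∏ p ∈ s, ((A ^ (-3 * (p.1.1.sign : ℤ)) : kˣ) : k) := by
      intro s
      induction s using Finset.induction_on with
      | empty => simp
      | insert a s ha ih => rw [Finset.sum_insert ha, Finset.prod_insert ha, zpow_add, ← ih]; simp
    exact this _

end GaussDiagram

/-! ### Recovering a Laurent polynomial from its values at integral circle values. -/

namespace LaurentPolynomial

/-- Every positive integer is the value of a circle for some complex parameter. -/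
lemma exists_unit_circleValue (N : ℕ) :
    ∃ A : ℂˣ, (N : ℂ) = -(A : ℂ) ^ 2 - ((A⁻¹ : ℂˣ) : ℂ) ^ 2 := by
  -- The quartic is x² (N + x² + x⁻²).
  obtain ⟨x, hx⟩ := IsAlgClosed.exists_root
    (Polynomial.X ^ 4 + Polynomial.C (N : ℂ) * Polynomial.X ^ 2 + 1 : Polynomial ℂ) (by
      have : (Polynomial.X ^ 4 + Polynomial.C (N : ℂ) * Polynomial.X ^ 2 + 1 :
        Polynomial ℂ).degree = 4 := by compute_degree!
      rw [this]; norm_num)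
  simp only [Polynomial.IsRoot, Polynomial.eval_add, Polynomial.eval_pow, Polynomial.eval_X,
    Polynomial.eval_mul, Polynomial.eval_C, Polynomial.eval_one] at hx
  have hx0 : x ≠ 0 := by
    rintro rfl
    simp at hx
  refine ⟨Units.mk0 x hx0, ?_⟩
  simp only [Units.val_inv_eq_inv_val, Units.val_mk0]
  field_simp
  linear_combination hx

/-- Each N has a parameter `a N`, and distinct N have distinct parameters because N is a function of
the parameter. So the difference, cleared of denominators, has infinitely many complex roots. -/
lemma eq_of_evalInt {P Q : ℤ[T;T⁻¹]}
    (h : ∀ (N : ℕ) (A : ℂˣ), (Fintype.card (Fin (N + 1)) : ℂ) =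
      -(A : ℂ) ^ 2 - ((A⁻¹ : ℂˣ) : ℂ) ^ 2 → evalInt A P = evalInt A Q) : P = Q := by
  rw [← sub_eq_zero]
  set R := P - Q with hR
  obtain ⟨n, p, hp⟩ := exists_T_pow R
  by_contra hne
  have hp0 : p ≠ 0 := by
    rintro rfl
    rw [map_zero] at hp
    exact hne ((isUnit_T (n : ℤ)).mul_left_eq_zero.1 hp.symm)
  have hq0 : p.map (Int.castRingHom ℂ) ≠ 0 := by
    rwa [Ne, Polynomial.map_eq_zero_iff (Int.castRingHom ℂ).injective_int]
  choose a ha using fun N : ℕ => exists_unit_circleValue (N + 1)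
  have hinj : Function.Injective fun N => (a N : ℂ) := by
    intro N M hNM
    have h1 := ha N
    have h2 := ha M
    have h3 : a N = a M := Units.ext hNM
    rw [h3] at h1
    have := h1.trans h2.symm
    exact_mod_cast Nat.cast_injective (R := ℂ) this |> Nat.succ_injective
  have hroot : ∀ N, (a N : ℂ) ∈ {x | (p.map (Int.castRingHom ℂ)).IsRoot x} := by
    intro N
    have h1 : evalInt (a N) R = 0 := by
      rw [hR, map_sub, h N (a N) (by simpa using ha N), sub_self]
    have h2 : evalInt (a N) (Polynomial.toLaurent p) = 0 := by
      rw [hp, map_mul, h1, zero_mul]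
    rw [eval₂_toLaurent] at h2
    simpa [Polynomial.IsRoot, Polynomial.eval_map] using h2
  exact Set.infinite_range_of_injective hinj
    ((Polynomial.finite_setOfPred_isRoot hq0).subset (Set.range_subset_iff.2 hroot))

end LaurentPolynomial

/-! ### Invariance of the Jones polynomial under moves and reversal. -/

namespace GaussDiagram

open LaurentPolynomial

lemma jones_eq_of_stateSum {D D' : GaussDiagram}
    (h : ∀ (N : ℕ) (A : ℂˣ), (Fintype.card (Fin (N + 1)) : ℂ) =
      -(A : ℂ) ^ 2 - ((A⁻¹ : ℂˣ) : ℂ) ^ 2 → ∃ f g : Assignment (Fin (N + 1)),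
      stateSum (jonesWeight A) D.word f = stateSum (jonesWeight A) D'.word g) :
    D.jones = D'.jones := by
  refine eq_of_evalInt fun N A hN => ?_
  obtain ⟨f, g, hfg⟩ := h N A hN
  rw [← evalInt_jones_mul_card A hN, ← evalInt_jones_mul_card A hN] at hfg
  exact mul_right_cancel₀ (Nat.cast_ne_zero.2 (by simp)) hfg

/-- The Jones polynomial is invariant under the Reidemeister moves. -/
theorem jones_eq_of_move {D D' : GaussDiagram} (h : Move D D') : D.jones = D'.jones :=
  jones_eq_of_stateSum fun _ A hN => ⟨fun _ => ((0, 0), (0, 0)),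
    stateSum_eq_of_move A hN h _⟩

lemma endMatrix_reverse {C k : Type*} [Fintype C] [DecidableEq C] [CommRing k] (A : kˣ)
    (f : Assignment C) (e : ChordEnd) :
    (endMatrix (jonesWeight A) f e).transpose =
      endMatrix (jonesWeight A) (fun i => ((f i).1.swap, (f i).2.swap)) e := by
  unfold endMatrix
  split_ifs
  · rw [Matrix.transpose_single]
    simp only [Prod.fst_swap, Prod.snd_swap, jonesWeight, bracketWeight_swap]
  · rw [Matrix.transpose_single]
    simp

lemma trace_path_reverse {C k : Type*} [Fintype C] [DecidableEq C] [CommRing k] (A : kˣ)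
    (f : Assignment C) (W : List ChordEnd) :
    (path (jonesWeight A) f W.reverse).trace =
      (path (jonesWeight A) (fun i => ((f i).1.swap, (f i).2.swap)) W).trace := by
  rw [← Matrix.trace_transpose, path, path, Matrix.transpose_list_prod, List.map_map,
    List.map_reverse, List.reverse_reverse]
  congr 3
  funext e
  exact endMatrix_reverse A f e

lemma sumOver_swap {C k : Type*} [Fintype C] [DecidableEq C] [CommRing k] (L : List ℕ)
    (F : Assignment C → k) (f : Assignment C) :
    sumOver L (fun f => F fun i => ((f i).1.swap, (f i).2.swap)) f =
      sumOver L F fun i => ((f i).1.swap, (f i).2.swap) := by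
  induction L generalizing f with
  | nil => rfl
  | cons i L ih =>
    simp only [sumOver, ih]
    refine Fintype.sum_equiv ((Equiv.prodComm C C).prodCongr (Equiv.prodComm C C)) _ _ fun x => ?_
    congr 1
    funext j
    by_cases hj : j = i
    · subst hj; simp [Prod.map]
    · simp [Function.update_of_ne hj]

/-- Transposition reverses a product of matrices without changing its trace, and the weight of a
crossing does not change when both its strands are reversed. -/
lemma jones_reverse (D : GaussDiagram) : D.reverse.jones = D.jones := by
  refine jones_eq_of_stateSum fun N A _ =>
    ⟨fun _ => ((0, 0), (0, 0)), fun _ => ((0, 0), (0, 0)), ?_⟩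
  unfold stateSum
  have hL : (overLabels D.reverse.word).Perm (overLabels D.word) :=
    overLabels_perm (List.reverse_perm _)
  rw [sumOver_perm hL, sumOver_congr (F := fun f => (path (jonesWeight A) f D.reverse.word).trace)
    (fun f => trace_path_reverse A f D.word),
    sumOver_swap _ (fun f => (path (jonesWeight A) f D.word).trace)]
  rfl

end GaussDiagram

namespace VirtualKnot

/-- The Jones polynomial of a virtual knot. -/
noncomputable def jones : VirtualKnot → ℤ[T;T⁻¹] :=
  Quot.lift GaussDiagram.jones fun _ _ h => GaussDiagram.jones_eq_of_move h

@[simp] lemma jones_ofDiagram (D : GaussDiagram) : (ofDiagram D).jones = D.jones := rfl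

lemma hasJones (K : VirtualKnot) : K.HasJones K.jones := by
  rintro D rfl; rfl

lemma jones_eq_of_sameUnoriented {K L : VirtualKnot} (h : K.SameUnoriented L) :
    K.jones = L.jones := by
  rcases h with rfl | ⟨D, rfl, rfl⟩
  · rfl
  · simp [GaussDiagram.jones_reverse]

lemma jones_unknot : unknot.jones = 1 := by
  have h3 : ∀ S, GaussDiagram.empty.loopCount S = 1 := fun S => by
    simp [GaussDiagram.loopCount, GaussDiagram.empty]
  have h1 : GaussDiagram.empty.crossings = ∅ := rfl
  have h2 : GaussDiagram.empty.writhe = 0 := rfl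
  simp [unknot, GaussDiagram.jones, GaussDiagram.bracket, h1, h2, h3]

end VirtualKnot

/-! ### Clasps and the Gauss words built from them. -/

/-- Two crossings of two antiparallel strands. The first strand meets the crossings `label` and
`label + 1` in this order, the second one in the opposite order. -/
structure Clasp where
  label : ℕ
  isOver : Bool
  sign : ℤˣ

namespace Clasp

/-- The endpoints on the first strand. -/
def down (c : Clasp) : List ChordEnd := [⟨c.label, c.isOver, c.sign⟩, ⟨c.label + 1, !c.isOver, c.sign⟩]

/-- The endpoints on the second strand. -/
def up (c : Clasp) : List ChordEnd := [⟨c.label + 1, c.isOver, c.sign⟩, ⟨c.label, !c.isOver, c.sign⟩]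

/-- The endpoints on the first strands of consecutive clasps. -/
def downs (l : List Clasp) : List ChordEnd := l.flatMap down

/-- The endpoints on the second strands of consecutive clasps. -/
def ups (l : List Clasp) : List ChordEnd := l.reverse.flatMap up

/-- The labels of the crossings. -/
def labels (l : List Clasp) : List ℕ := l.flatMap fun c => [c.label, c.label + 1]

/-- All endpoints. -/
def ends (l : List Clasp) : List ChordEnd := l.flatMap fun c => c.down ++ c.up

/-- The clasps on the left of the middle strand. -/
def left (u : List (Bool × Clasp)) : List Clasp := (u.filter fun x => x.1).map Prod.snd

/-- The clasps on the right of the middle strand. -/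
def right (u : List (Bool × Clasp)) : List Clasp := (u.filter fun x => !x.1).map Prod.snd

/-- All clasps with the middle strand. -/
def all (u : List (Bool × Clasp)) : List Clasp := u.map Prod.snd

@[simp] lemma downs_nil : downs [] = [] := rfl
@[simp] lemma ups_nil : ups [] = [] := rfl
@[simp] lemma labels_nil : labels [] = [] := rfl
@[simp] lemma left_nil : left [] = [] := rfl
@[simp] lemma right_nil : right [] = [] := rfl
@[simp] lemma all_nil : all [] = [] := rfl
@[simp] lemma ends_nil : ends [] = [] := rfl
@[simp] lemma downs_cons (c l) : downs (c :: l) = c.down ++ downs l := rfl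
@[simp] lemma ups_cons (c l) : ups (c :: l) = ups l ++ c.up := by simp [ups]
@[simp] lemma labels_cons (c l) : labels (c :: l) = [c.label, c.label + 1] ++ labels l := rfl
@[simp] lemma ends_cons (c l) : ends (c :: l) = c.down ++ c.up ++ ends l := rfl
@[simp] lemma left_cons_true (c u) : left ((true, c) :: u) = c :: left u := rfl
@[simp] lemma left_cons_false (c u) : left ((false, c) :: u) = left u := rfl
@[simp] lemma right_cons_true (c u) : right ((true, c) :: u) = right u := rfl
@[simp] lemma right_cons_false (c u) : right ((false, c) :: u) = c :: right u := rfl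
@[simp] lemma all_cons (x u) : all (x :: u) = x.2 :: all u := rfl

lemma labels_append (l l' : List Clasp) : labels (l ++ l') = labels l ++ labels l' := by
  simp [labels]

lemma ends_append (l l' : List Clasp) : ends (l ++ l') = ends l ++ ends l' := by
  simp [ends]

lemma label_mem_of_mem_ends {l : List Clasp} {e : ChordEnd} (h : e ∈ ends l) :
    e.label ∈ labels l := by
  simp only [ends, labels, List.mem_flatMap] at h ⊢
  obtain ⟨c, hc, he⟩ := h
  refine ⟨c, hc, ?_⟩
  simp only [down, up, List.cons_append, List.nil_append, List.mem_cons, List.not_mem_nil,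
    or_false] at he
  rcases he with rfl | rfl | rfl | rfl <;> simp

lemma opp_mem_ends {l : List Clasp} {e : ChordEnd} (h : e ∈ ends l) : e.opp ∈ ends l := by
  simp only [ends, List.mem_flatMap] at h ⊢
  obtain ⟨c, hc, he⟩ := h
  refine ⟨c, hc, ?_⟩
  simp only [down, up, List.cons_append, List.nil_append, List.mem_cons, List.not_mem_nil,
    or_false] at he ⊢
  rcases he with rfl | rfl | rfl | rfl <;> simp [ChordEnd.opp]

lemma nodup_ends {l : List Clasp} (h : (labels l).Nodup) : (ends l).Nodup := by
  induction l with
  | nil => simp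
  | cons c l ih =>
    rw [labels_cons, List.nodup_append'] at h
    rw [ends_cons, List.nodup_append']
    refine ⟨?_, ih h.2.1, ?_⟩
    · cases ho : c.isOver <;> simp [down, up, ho]
    · intro e he he'
      refine h.2.2 ?_ (label_mem_of_mem_ends he')
      have := label_mem_of_mem_ends (l := [c]) (e := e) (by simpa using he)
      simpa using this

lemma sign_eq_of_mem_ends {l : List Clasp} (h : (labels l).Nodup) {e f : ChordEnd}
    (he : e ∈ ends l) (hf : f ∈ ends l) (hef : e.label = f.label) : e.sign = f.sign := by
  induction l with
  | nil => simp at he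
  | cons c l ih =>
    rw [labels_cons, List.nodup_append'] at h
    have hmem : ∀ g ∈ c.down ++ c.up, g.label ∈ [c.label, c.label + 1] ∧ g.sign = c.sign := by
      intro g hg
      simp only [down, up, List.cons_append, List.nil_append, List.mem_cons, List.not_mem_nil,
        or_false] at hg
      rcases hg with rfl | rfl | rfl | rfl <;> simp
    rw [ends_cons, List.mem_append] at he hf
    rcases he with he | he <;> rcases hf with hf | hf
    · rw [(hmem e he).2, (hmem f hf).2]
    · exact (h.2.2 (hmem e he).1 (hef ▸ label_mem_of_mem_ends hf)).elim
    · exact (h.2.2 (hmem f hf).1 (hef ▸ label_mem_of_mem_ends he)).elim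
    · exact ih h.2.1 he hf

lemma overLabels_ends (l : List Clasp) : (overLabels (ends l)).Perm (labels l) := by
  induction l with
  | nil => rfl
  | cons c l ih =>
    rw [ends_cons, labels_cons, overLabels_append]
    refine List.Perm.append ?_ ih
    cases ho : c.isOver <;> simp [down, up, ho, overLabels, List.Perm.swap]

/-- The word of the knot formed by an upper and a lower tangle of clasps between the first three of
four strands and a twist region between them. -/
def knotWord (u l : List (Bool × Clasp)) (t : List Clasp) : List ChordEnd :=
  downs (left u) ++ ups (left l) ++ downs (all l) ++ downs t ++ ups (right l) ++ downs (right u) ++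
    ups t ++ ups (all u)

lemma count_upper (u : List (Bool × Clasp)) (e : ChordEnd) :
    (downs (left u)).count e + (downs (right u)).count e + (ups (all u)).count e =
      (ends (all u)).count e := by
  induction u with
  | nil => simp
  | cons x u ih =>
    obtain ⟨b, c⟩ := x
    cases b <;> simp only [left_cons_true, left_cons_false, right_cons_true, right_cons_false,
      all_cons, downs_cons, ups_cons, ends_cons, List.count_append] <;> omega

lemma count_lower (u : List (Bool × Clasp)) (e : ChordEnd) :
    (ups (left u)).count e + (ups (right u)).count e + (downs (all u)).count e =
      (ends (all u)).count e := by
  induction u with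
  | nil => simp
  | cons x u ih =>
    obtain ⟨b, c⟩ := x
    cases b <;> simp only [left_cons_true, left_cons_false, right_cons_true, right_cons_false,
      all_cons, downs_cons, ups_cons, ends_cons, List.count_append] <;> omega

lemma count_twist (t : List Clasp) (e : ChordEnd) :
    (downs t).count e + (ups t).count e = (ends t).count e := by
  induction t with
  | nil => simp
  | cons c t ih => simp only [downs_cons, ups_cons, ends_cons, List.count_append]; omega

lemma knotWord_perm (u l : List (Bool × Clasp)) (t : List Clasp) :
    (knotWord u l t).Perm (ends (all u ++ all l ++ t)) := by
  rw [List.perm_iff_count]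
  intro e
  have h1 := count_upper u e
  have h2 := count_lower l e
  have h3 := count_twist t e
  simp only [knotWord, ends_append, List.count_append]
  omega

/-- The Gauss diagram with word `knotWord u l t`. -/
def knotDiagram (u l : List (Bool × Clasp)) (t : List Clasp)
    (h : (labels (all u ++ all l ++ t)).Nodup) : GaussDiagram where
  word := knotWord u l t
  nodup := (knotWord_perm u l t).nodup_iff.2 (nodup_ends h)
  opp_mem e he := by
    rw [(knotWord_perm u l t).mem_iff] at he ⊢
    exact opp_mem_ends he
  sign_eq e he f hf hef := by
    rw [(knotWord_perm u l t).mem_iff] at he hf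
    exact sign_eq_of_mem_ends h he hf hef

/-! ### Transfer along three-strand tangles. -/

section transfer

variable {C k : Type*} [Fintype C] [DecidableEq C] [CommRing k]

/-- How clasps with tensors `τ` transform a function of the colours of three strands. -/
def transfer (τ : Clasp → C → C → C → C → k) :
    List (Bool × Clasp) → (C → C → C → k) → C → C → C → k
  | [], ψ => ψ
  | (true, c) :: u, ψ =>
    transfer τ u fun j₁ j₂ j₃ => ∑ i₁, ∑ i₂, ψ i₁ i₂ j₃ * τ c i₁ i₂ j₁ j₂
  | (false, c) :: u, ψ =>
    transfer τ u fun j₁ j₂ j₃ => ∑ i₃, ∑ i₂, ψ j₁ i₂ i₃ * τ c i₃ i₂ j₃ j₂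

/-- The product of the matrices of the clasps in a list. -/
def matrixProd (X : Clasp → Assignment C → Matrix C C k) (l : List Clasp) (f : Assignment C) :
    Matrix C C k := (l.map fun c => X c f).prod

lemma matrixProd_cons (X : Clasp → Assignment C → Matrix C C k) (c l f) :
    matrixProd X (c :: l) f = X c f * matrixProd X l f := by simp [matrixProd]

/-- The matrix of a clasp depends only on the colours at its crossings. -/
def IsLocal (X : Clasp → Assignment C → Matrix C C k) : Prop :=
  ∀ (c : Clasp) (f g : Assignment C), f c.label = g c.label →
    f (c.label + 1) = g (c.label + 1) → X c f = X c g

lemma indepOf_matrixProd {X : Clasp → Assignment C → Matrix C C k} (hX : IsLocal X)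
    {l : List Clasp} {L : List ℕ} (h : (labels l).Disjoint L) : IndepOf (matrixProd X l) L := by
  intro f g hfg
  unfold matrixProd
  congr 1
  refine List.map_congr_left fun c hc => ?_
  refine hX c f g (hfg _ fun h' => h ?_ h') (hfg _ fun h' => h ?_ h') <;>
  exact List.mem_flatMap.2 ⟨c, hc, by simp⟩

lemma labels_left_subset (u : List (Bool × Clasp)) : labels (left u) ⊆ labels (all u) := by
  intro n hn
  simp only [labels, left, all, List.mem_flatMap, List.mem_map, List.mem_filter] at hn ⊢
  obtain ⟨c, ⟨x, ⟨hx, _⟩, rfl⟩, hn⟩ := hn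
  exact ⟨x.2, ⟨x, hx, rfl⟩, hn⟩

lemma labels_right_subset (u : List (Bool × Clasp)) : labels (right u) ⊆ labels (all u) := by
  intro n hn
  simp only [labels, right, all, List.mem_flatMap, List.mem_map, List.mem_filter] at hn ⊢
  obtain ⟨c, ⟨x, ⟨hx, _⟩, rfl⟩, hn⟩ := hn
  exact ⟨x.2, ⟨x, hx, rfl⟩, hn⟩

lemma indepOf_tangle {X Y : Clasp → Assignment C → Matrix C C k} (hX : IsLocal X) (hY : IsLocal Y)
    {u : List (Bool × Clasp)} {L : List ℕ} (h : (labels (all u)).Disjoint L)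
    (i₁ i₂ i₃ j₁ j₂ j₃ : C) :
    IndepOf (fun f => matrixProd X (left u) f i₁ j₁ * matrixProd Y (all u) f i₂ j₂ *
      matrixProd X (right u) f i₃ j₃) L := by
  intro f g hfg
  have h1 := indepOf_matrixProd hX (fun n hn => h (labels_left_subset u hn)) f g hfg
  have h2 := indepOf_matrixProd hY h f g hfg
  have h3 := indepOf_matrixProd hX (fun n hn => h (labels_right_subset u hn)) f g hfg
  simp only [h1, h2, h3]

/-- Induction on the clasps with `ψ` general: the first clasp is summed out and absorbed into `ψ`.
`X` acts on the outer strands and `Y` on the middle one, both read from top to bottom. -/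
lemma sumOver_transfer {X Y : Clasp → Assignment C → Matrix C C k} (hX : IsLocal X)
    (hY : IsLocal Y) {τ : Clasp → C → C → C → C → k}
    (hτ : ∀ c f i₁ i₂ j₁ j₂, sumOver [c.label, c.label + 1]
      (fun f => X c f i₁ j₁ * Y c f i₂ j₂) f = τ c i₁ i₂ j₁ j₂)
    (u : List (Bool × Clasp)) (hu : (labels (all u)).Nodup) (ψ : C → C → C → k)
    (f : Assignment C) (j₁ j₂ j₃ : C) :
    sumOver (labels (all u)) (fun f => ∑ i₁, ∑ i₂, ∑ i₃, ψ i₁ i₂ i₃ *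
      (matrixProd X (left u) f i₁ j₁ * matrixProd Y (all u) f i₂ j₂ *
        matrixProd X (right u) f i₃ j₃)) f = transfer τ u ψ j₁ j₂ j₃ := by
  induction u generalizing ψ f with
  | nil =>
    simp only [all_nil, labels_nil, sumOver, matrixProd, left_nil, right_nil, List.map_nil,
      List.prod_nil, one_apply_eq_delta, transfer]
    have : ∀ i₁ i₂ i₃, ψ i₁ i₂ i₃ * (delta k i₁ j₁ * delta k i₂ j₂ * delta k i₃ j₃) =
        delta k i₃ j₃ * (delta k i₂ j₂ * (delta k i₁ j₁ * ψ i₁ i₂ i₃)) := fun _ _ _ => by ring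
    simp only [this, sum_delta_mul]
  | cons x u ih =>
    obtain ⟨b, c⟩ := x
    rw [all_cons, labels_cons, List.nodup_append'] at hu
    have hd : (labels (all u)).Disjoint [c.label, c.label + 1] := hu.2.2.symm
    rw [all_cons, labels_cons, sumOver_perm List.perm_append_comm, sumOver_append]
    cases b
    · rw [transfer, ← ih hu.2.1]
      refine congrFun (sumOver_congr fun f => ?_) f
      simp only [left_cons_false, right_cons_false, matrixProd_cons]
      rw [sumOver_congr (G := fun f => ∑ i₁, ∑ i₂, ∑ i₃, ∑ a₃, ∑ a₂,
        (matrixProd X (left u) f i₁ j₁ * matrixProd Y (all u) f i₂ j₂ *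
          matrixProd X (right u) f i₃ j₃) * (ψ i₁ a₂ a₃ * (X c f a₃ i₃ * Y c f a₂ i₂)))]
      · simp only [sumOver_sum, sumOver_mul_left (indepOf_tangle hX hY hd _ _ _ _ _ _),
          sumOver_const_mul, hτ, Finset.sum_mul]
        refine Finset.sum_congr rfl fun _ _ => Finset.sum_congr rfl fun _ _ =>
          Finset.sum_congr rfl fun _ _ => Finset.sum_congr rfl fun _ _ =>
          Finset.sum_congr rfl fun _ _ => by ring
      · intro f
        simp only [Matrix.mul_apply, Finset.mul_sum, Finset.sum_mul]
        refine Finset.sum_congr rfl fun i₁ _ => ?_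
        have e1 : ∀ F : C → C → C → C → k, ∑ a₂, ∑ a₃, ∑ i₃, ∑ i₂, F a₂ a₃ i₃ i₂ =
            ∑ i₂, ∑ i₃, ∑ a₃, ∑ a₂, F a₂ a₃ i₃ i₂ := by
          intro F
          simp only [← Fintype.sum_prod_type']
          refine Fintype.sum_equiv ⟨fun p => (p.2.2.2, p.2.2.1, p.2.1, p.1),
            fun p => (p.2.2.2, p.2.2.1, p.2.1, p.1), fun _ => rfl, fun _ => rfl⟩ _ _ fun _ => rfl
        rw [e1]
        refine Finset.sum_congr rfl fun _ _ => Finset.sum_congr rfl fun _ _ =>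
          Finset.sum_congr rfl fun _ _ => Finset.sum_congr rfl fun _ _ => by ring
    · rw [transfer, ← ih hu.2.1]
      refine congrFun (sumOver_congr fun f => ?_) f
      simp only [left_cons_true, right_cons_true, matrixProd_cons]
      rw [sumOver_congr (G := fun f => ∑ i₁, ∑ i₂, ∑ i₃, ∑ a₁, ∑ a₂,
        (matrixProd X (left u) f i₁ j₁ * matrixProd Y (all u) f i₂ j₂ *
          matrixProd X (right u) f i₃ j₃) * (ψ a₁ a₂ i₃ * (X c f a₁ i₁ * Y c f a₂ i₂)))]
      · simp only [sumOver_sum, sumOver_mul_left (indepOf_tangle hX hY hd _ _ _ _ _ _),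
          sumOver_const_mul, hτ, Finset.sum_mul]
        refine Finset.sum_congr rfl fun _ _ => Finset.sum_congr rfl fun _ _ =>
          Finset.sum_congr rfl fun _ _ => Finset.sum_congr rfl fun _ _ =>
          Finset.sum_congr rfl fun _ _ => by ring
      · intro f
        simp only [Matrix.mul_apply, Finset.mul_sum, Finset.sum_mul]
        have e1 : ∀ F : C → C → C → C → C → k, ∑ a₁, ∑ a₂, ∑ i₃, ∑ i₂, ∑ i₁, F a₁ a₂ i₃ i₂ i₁ =
            ∑ i₁, ∑ i₂, ∑ i₃, ∑ a₁, ∑ a₂, F a₁ a₂ i₃ i₂ i₁ := by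
          intro F
          simp only [← Fintype.sum_prod_type']
          refine Fintype.sum_equiv ⟨fun p => (p.2.2.2.2, p.2.2.2.1, p.2.2.1, p.1, p.2.1),
            fun p => (p.2.2.2.1, p.2.2.2.2, p.2.2.1, p.2.1, p.1), fun _ => rfl, fun _ => rfl⟩
            _ _ fun _ => rfl
        rw [e1]
        refine Finset.sum_congr rfl fun _ _ => Finset.sum_congr rfl fun _ _ =>
          Finset.sum_congr rfl fun _ _ => Finset.sum_congr rfl fun _ _ =>
          Finset.sum_congr rfl fun _ _ => by ring

end transfer

end Clasp

/-! ### The state sum of a knot word. -/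

namespace Clasp

variable {C k : Type*} [Fintype C] [DecidableEq C] [CommRing k]

/-- The local state sum of a clasp. -/
def tensor (w : ℤˣ → C → C → C → C → k) (c : Clasp) (i₁ i₂ j₁ j₂ : C) : k :=
  ∑ m, ∑ m', if c.isOver then w c.sign i₁ m m' i₂ * w c.sign j₂ m' m j₁
    else w c.sign m' i₂ i₁ m * w c.sign m j₁ j₂ m'

/-- The matrix of the first strand of a clasp. -/
def downMatrix (w : ℤˣ → C → C → C → C → k) (c : Clasp) (f : Assignment C) : Matrix C C k :=
  path w f c.down

/-- The transposed matrix of the second strand of a clasp. -/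
def upMatrix (w : ℤˣ → C → C → C → C → k) (c : Clasp) (f : Assignment C) : Matrix C C k :=
  (path w f c.up).transpose

variable (w : ℤˣ → C → C → C → C → k)

lemma isLocal_downMatrix : IsLocal (downMatrix w) := by
  intro c f g h h'
  refine path_congr w fun e he => ?_
  simp only [down, List.mem_cons, List.not_mem_nil, or_false] at he
  rcases he with rfl | rfl
  exacts [h, h']

lemma isLocal_upMatrix : IsLocal (upMatrix w) := by
  intro c f g h h'
  unfold upMatrix
  congr 1
  refine path_congr w fun e he => ?_
  simp only [up, List.mem_cons, List.not_mem_nil, or_false] at he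
  rcases he with rfl | rfl
  exacts [h', h]

lemma sumOver_clasp (c : Clasp) (f : Assignment C) (i₁ i₂ j₁ j₂ : C) :
    sumOver [c.label, c.label + 1] (fun f => downMatrix w c f i₁ j₁ * upMatrix w c f i₂ j₂) f =
      tensor w c i₁ i₂ j₁ j₂ := by
  simp only [downMatrix, upMatrix, down, up, Matrix.transpose_apply, path_pair_apply,
    Finset.sum_mul_sum, sumOver_sum, tensor]
  refine Finset.sum_congr rfl fun m _ => Finset.sum_congr rfl fun m' _ => ?_
  cases ho : c.isOver
  · rw [sumOver_chords w [(c.label, c.sign, m', i₂, i₁, m), (c.label + 1, c.sign, m, j₁, j₂, m')]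
      _ (by simp) (by simp)]
    · simp
    · intro f
      simp only [List.map_cons, List.map_nil, List.prod_cons, List.prod_nil, Bool.not_false]
      ring
  · rw [sumOver_chords w [(c.label, c.sign, i₁, m, m', i₂), (c.label + 1, c.sign, j₂, m', m, j₁)]
      _ (by simp) (by simp)]
    · simp
    · intro f
      simp only [List.map_cons, List.map_nil, List.prod_cons, List.prod_nil, Bool.not_true]
      ring

lemma path_downs (l : List Clasp) (f : Assignment C) :
    path w f (downs l) = matrixProd (downMatrix w) l f := by
  induction l with
  | nil => simp [matrixProd]
  | cons c l ih => rw [downs_cons, path_append, matrixProd_cons, ih]; rfl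

/-- The second strand meets the clasps in the opposite order, so transposing lists them from top to
bottom like the first strand. -/
lemma path_ups (l : List Clasp) (f : Assignment C) :
    path w f (ups l) = (matrixProd (upMatrix w) l f).transpose := by
  induction l with
  | nil => simp [matrixProd]
  | cons c l ih =>
    rw [ups_cons, path_append, matrixProd_cons, ih, Matrix.transpose_mul, upMatrix,
      Matrix.transpose_transpose]

/-- The colours at the top of a tangle: the first two strands are joined. -/
def cap (m i₁ i₂ i₃ : C) : k := delta k i₁ i₂ * delta k i₃ m

lemma left_map_true (t : List Clasp) : left (t.map fun c => (true, c)) = t := by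
  induction t with
  | nil => rfl
  | cons c t ih => simp [ih]

lemma right_map_true (t : List Clasp) : right (t.map fun c => (true, c)) = [] := by
  induction t with
  | nil => rfl
  | cons c t ih => simp [ih]

lemma all_map_true (t : List Clasp) : all (t.map fun c => (true, c)) = t := by
  induction t with
  | nil => rfl
  | cons c t ih => simp [ih]

/-- The local state sum of a twist region. -/
def twistTensor (τ : Clasp → C → C → C → C → k) (t : List Clasp) (i₁ i₂ j₁ j₂ : C) : k :=
  transfer τ (t.map fun c => (true, c)) (fun a b _ => delta k a i₁ * delta k b i₂) j₁ j₂ j₁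

/-- A twist region is a tangle with left clasps only. Its third strand is a spectator, and the
colour `j₁` put there in `twistTensor` is a mere placeholder. -/
lemma sumOver_twist {X Y : Clasp → Assignment C → Matrix C C k} (hX : IsLocal X)
    (hY : IsLocal Y) {τ : Clasp → C → C → C → C → k}
    (hτ : ∀ c f i₁ i₂ j₁ j₂, sumOver [c.label, c.label + 1]
      (fun f => X c f i₁ j₁ * Y c f i₂ j₂) f = τ c i₁ i₂ j₁ j₂)
    (t : List Clasp) (ht : (labels t).Nodup) (f : Assignment C) (i₁ i₂ j₁ j₂ : C) :
    sumOver (labels t) (fun f => matrixProd X t f i₁ j₁ * matrixProd Y t f i₂ j₂) f =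
      twistTensor τ t i₁ i₂ j₁ j₂ := by
  rw [twistTensor, ← sumOver_transfer hX hY hτ _ (by rwa [all_map_true]) _ f, all_map_true,
    left_map_true, right_map_true]
  refine congrFun (sumOver_congr fun f => ?_) f
  have : ∀ a b c, delta k a i₁ * delta k b i₂ * (matrixProd X t f a j₁ * matrixProd Y t f b j₂ *
      matrixProd X [] f c j₁) = delta k c j₁ * (delta k b i₂ * (delta k a i₁ *
        (matrixProd X t f a j₁ * matrixProd Y t f b j₂))) := by
    intro a b c
    simp only [matrixProd, List.map_nil, List.prod_nil, one_apply_eq_delta]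
    ring
  simp only [this, sum_delta_mul]

/-- The factors are grouped as the segments of `knotWord`: the first, sixth and eighth belong to the
upper tangle, the second, third and fifth to the lower one, the fourth and seventh to the twist
region. -/
lemma trace_prod_eight (P₁ P₂ P₃ P₄ P₅ P₆ P₇ P₈ : Matrix C C k) :
    (P₁ * P₂ * P₃ * P₄ * P₅ * P₆ * P₇ * P₈).trace =
      ∑ m, ∑ a, ∑ b, ∑ c, ∑ d, ∑ e, (∑ i, P₁ i a * P₈ b i * P₆ m c) *
        ((∑ i, P₂ a i * P₃ i d * P₅ e m) * (P₄ d e * P₇ c b)) := by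
  simp only [Matrix.trace, Matrix.diag, Matrix.mul_apply, Finset.sum_mul, Finset.mul_sum]
  have e1 : ∀ F : C → C → C → C → C → C → C → C → k,
      ∑ x₁, ∑ x₈, ∑ x₇, ∑ x₆, ∑ x₅, ∑ x₄, ∑ x₃, ∑ x₂, F x₁ x₂ x₃ x₄ x₅ x₆ x₇ x₈ =
      ∑ x₆, ∑ x₂, ∑ x₈, ∑ x₇, ∑ x₄, ∑ x₅, ∑ x₃, ∑ x₁, F x₁ x₂ x₃ x₄ x₅ x₆ x₇ x₈ := by
    intro F
    simp only [← Fintype.sum_prod_type']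
    refine Fintype.sum_equiv ⟨fun (x₁, x₈, x₇, x₆, x₅, x₄, x₃, x₂) =>
        (x₆, x₂, x₈, x₇, x₄, x₅, x₃, x₁), fun (x₆, x₂, x₈, x₇, x₄, x₅, x₃, x₁) =>
        (x₁, x₈, x₇, x₆, x₅, x₄, x₃, x₂), fun _ => rfl, fun _ => rfl⟩ _ _ fun _ => rfl
  rw [e1 fun x₁ x₂ x₃ x₄ x₅ x₆ x₇ x₈ => P₁ x₁ x₂ * P₂ x₂ x₃ * P₃ x₃ x₄ * P₄ x₄ x₅ * P₅ x₅ x₆ *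
    P₆ x₆ x₇ * P₇ x₇ x₈ * P₈ x₈ x₁]
  refine Finset.sum_congr rfl fun _ _ => Finset.sum_congr rfl fun _ _ =>
    Finset.sum_congr rfl fun _ _ => Finset.sum_congr rfl fun _ _ =>
    Finset.sum_congr rfl fun _ _ => Finset.sum_congr rfl fun _ _ => ?_
  refine Finset.sum_congr rfl fun _ _ => Finset.sum_congr rfl fun _ _ => ?_
  ring

/-- The closure of an upper and a lower tangle and a twist region. -/
def closure (U L : C → C → C → C → k) (G : C → C → C → C → k) : k :=
  ∑ m, ∑ a, ∑ b, ∑ c, ∑ d, ∑ e, U m a b c * (L m a d e * G d b e c)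

/-- In the lower tangle the middle strand is the first strand of every clasp, in the upper tangle it
is the second; the symmetry `hw` lets one tensor serve both. -/
theorem stateSum_knotWord (hw : ∀ c i₁ i₂ j₁ j₂, tensor w c i₂ i₁ j₂ j₁ = tensor w c i₁ i₂ j₁ j₂)
    (u l : List (Bool × Clasp)) (t : List Clasp) (h : (labels (all u ++ all l ++ t)).Nodup)
    (f : Assignment C) :
    stateSum w (knotWord u l t) f =
      closure (fun m => transfer (tensor w) u (cap m)) (fun m => transfer (tensor w) l (cap m))
        (twistTensor (tensor w) t) := by
  have hX := isLocal_downMatrix w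
  have hY := isLocal_upMatrix w
  have hτ' : ∀ c f i₁ i₂ j₁ j₂, sumOver [c.label, c.label + 1]
      (fun f => upMatrix w c f i₁ j₁ * downMatrix w c f i₂ j₂) f = tensor w c i₁ i₂ j₁ j₂ := by
    intro c f i₁ i₂ j₁ j₂
    rw [← hw, ← sumOver_clasp w c f]
    exact congrFun (sumOver_congr fun f => mul_comm _ _) f
  rw [labels_append, labels_append, List.append_assoc, List.nodup_append', List.nodup_append'] at h
  obtain ⟨hu, ⟨hl, ht, hlt⟩, hul⟩ := h
  have hult := hul
  rw [stateSum, sumOver_perm (L' := labels (all u) ++ (labels (all l) ++ labels t))]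
  swap
  · refine (overLabels_perm (knotWord_perm u l t)).trans ((overLabels_ends _).trans ?_)
    rw [labels_append, labels_append, List.append_assoc]
  set X := downMatrix w
  set Y := upMatrix w
  let U : C → C → C → C → Assignment C → k := fun m j₁ j₂ j₃ f => ∑ i₁, ∑ i₂, ∑ i₃,
    cap m i₁ i₂ i₃ * (matrixProd X (left u) f i₁ j₁ * matrixProd Y (all u) f i₂ j₂ *
      matrixProd X (right u) f i₃ j₃)
  let L : C → C → C → C → Assignment C → k := fun m j₁ j₂ j₃ f => ∑ i₁, ∑ i₂, ∑ i₃,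
    cap m i₁ i₂ i₃ * (matrixProd Y (left l) f i₁ j₁ * matrixProd X (all l) f i₂ j₂ *
      matrixProd Y (right l) f i₃ j₃)
  have hcap : ∀ (m : C) (F : C → C → C → k), ∑ i₁, ∑ i₂, ∑ i₃, cap m i₁ i₂ i₃ * F i₁ i₂ i₃ =
      ∑ i, F i i m := by
    intro m F
    have : ∀ i₁ i₂ i₃, cap m i₁ i₂ i₃ * F i₁ i₂ i₃ =
        delta k i₃ m * (delta k i₁ i₂ * F i₁ i₂ i₃) := fun _ _ _ => by rw [cap]; ring
    simp only [this, sum_delta_mul, sum_delta_mul']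
  have hint : ∀ f, (path w f (knotWord u l t)).trace = ∑ m, ∑ a, ∑ b, ∑ c, ∑ d, ∑ e,
      U m a b c f * (L m a d e f * (matrixProd X t f d e * matrixProd Y t f b c)) := by
    intro f
    simp only [knotWord, path_append, path_downs, path_ups]
    rw [trace_prod_eight]
    simp only [U, L, hcap, Matrix.transpose_apply]
    rfl
  have hU : ∀ m a b c, IndepOf (U m a b c) (labels (all l) ++ labels t) := by
    intro m a b c f g hfg
    refine Finset.sum_congr rfl fun i₁ _ => Finset.sum_congr rfl fun i₂ _ =>
      Finset.sum_congr rfl fun i₃ _ => ?_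
    exact congrArg (cap m i₁ i₂ i₃ * ·) (indepOf_tangle hX hY hult i₁ i₂ i₃ a b c f g hfg)
  have hL : ∀ m a b c, IndepOf (L m a b c) (labels t) := by
    intro m a b c f g hfg
    refine Finset.sum_congr rfl fun i₁ _ => Finset.sum_congr rfl fun i₂ _ =>
      Finset.sum_congr rfl fun i₃ _ => ?_
    exact congrArg (cap m i₁ i₂ i₃ * ·) (indepOf_tangle hY hX hlt i₁ i₂ i₃ a b c f g hfg)
  rw [sumOver_congr hint]
  simp only [sumOver_sum]
  refine Finset.sum_congr rfl fun m _ => Finset.sum_congr rfl fun a _ =>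
    Finset.sum_congr rfl fun b _ => Finset.sum_congr rfl fun c _ =>
    Finset.sum_congr rfl fun d _ => Finset.sum_congr rfl fun e _ => ?_
  have hlt' : ∀ f, sumOver (labels (all l) ++ labels t) (fun f => L m a d e f *
      (matrixProd X t f d e * matrixProd Y t f b c)) f =
      transfer (tensor w) l (cap m) a d e * twistTensor (tensor w) t d b e c := by
    intro f
    rw [sumOver_append]
    have : ∀ f, sumOver (labels t) (fun f => L m a d e f *
        (matrixProd X t f d e * matrixProd Y t f b c)) f =
        twistTensor (tensor w) t d b e c * L m a d e f := by
      intro f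
      rw [sumOver_mul_left (hL _ _ _ _), sumOver_twist hX hY (sumOver_clasp w) t ht, mul_comm]
    rw [sumOver_congr this, sumOver_const_mul, sumOver_transfer hY hX hτ' l hl, mul_comm]
  rw [sumOver_append]
  have : ∀ f, sumOver (labels (all l) ++ labels t) (fun f => U m a b c f * (L m a d e f *
      (matrixProd X t f d e * matrixProd Y t f b c))) f =
      transfer (tensor w) l (cap m) a d e * twistTensor (tensor w) t d b e c * U m a b c f := by
    intro f
    rw [sumOver_mul_left (hU _ _ _ _), hlt', mul_comm]
  rw [sumOver_congr this, sumOver_const_mul, sumOver_transfer hX hY (sumOver_clasp w) u hu,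
    mul_comm]

end Clasp

/-! ### Skein expansion of clasps, tangles and twists. -/

namespace Clasp

variable {C k : Type*} [Fintype C] [DecidableEq C] [CommRing k]

/-- The coefficient of the identity in the local state sum of a clasp of sign `s`. -/
def straightCoeff (A : kˣ) (s : ℤˣ) : k := ((A ^ (-8 * (s : ℤ)) : kˣ) : k)

/-- The coefficient of the turn-back in the local state sum of a clasp of sign `s`. -/
def turnCoeff (A : kˣ) (s : ℤˣ) : k :=
  ((A ^ (-6 * (s : ℤ)) : kˣ) : k) - ((A ^ (-2 * (s : ℤ)) : kˣ) : k)

lemma straightCoeff_mul_neg (A : kˣ) (s : ℤˣ) : straightCoeff A s * straightCoeff A (-s) = 1 := by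
  rw [straightCoeff, straightCoeff, ← Units.val_mul, ← zpow_add]; simp

lemma straightCoeff_mul_turnCoeff_neg (A : kˣ) (s : ℤˣ) :
    straightCoeff A s * turnCoeff A (-s) = -turnCoeff A s := by
  rw [straightCoeff, turnCoeff, turnCoeff, mul_sub, ← Units.val_mul, ← Units.val_mul, ← zpow_add,
    ← zpow_add, neg_sub, Units.val_neg]
  congr 4 <;> ring

/-- A clasp capped off at one end can be undone, so it fixes the turn-back; this is the coefficient
identity that says so. -/
lemma straightCoeff_add (A : kˣ)
    (hN : (Fintype.card C : k) = -(A : k) ^ 2 - ((A⁻¹ : kˣ) : k) ^ 2) (s : ℤˣ) :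
    straightCoeff A s + turnCoeff A s * (Fintype.card C : k) = 1 := by
  have h1 : (A : k) * ((A⁻¹ : kˣ) : k) = 1 := by simp
  rw [hN]
  obtain rfl | rfl := Int.units_eq_one_or s
  · have e : ∀ n : ℕ, ((A ^ (-(n : ℤ)) : kˣ) : k) = ((A⁻¹ : kˣ) : k) ^ n := fun n => by simp
    have e2 := e 2
    have e6 := e 6
    have e8 := e 8
    simp only [straightCoeff, turnCoeff, Units.val_one, mul_one]
    push_cast at e2 e6 e8
    rw [e2, e6, e8]
    generalize ((A⁻¹ : kˣ) : k) = B at *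
    generalize (A : k) = A at *
    linear_combination (-B ^ 4 * (A * B + 1) + (A * B + 1)) * h1
  · have e : ∀ n : ℕ, ((A ^ (n : ℤ) : kˣ) : k) = (A : k) ^ n := fun n => by simp
    have e2 := e 2
    have e6 := e 6
    have e8 := e 8
    simp only [straightCoeff, turnCoeff, Units.val_neg, Units.val_one, mul_one, mul_neg, neg_neg]
    push_cast at e2 e6 e8
    rw [e2, e6, e8]
    generalize ((A⁻¹ : kˣ) : k) = B at *
    generalize (A : k) = A at *
    linear_combination (-A ^ 4 * (A * B + 1) + (A * B + 1)) * h1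

/-- One of the four states of a clasp is the identity. The other three are turn-backs, one of them
with a circle, and `hN` simplifies their coefficients to `turnCoeff`. -/
lemma tensor_jonesWeight (A : kˣ)
    (hN : (Fintype.card C : k) = -(A : k) ^ 2 - ((A⁻¹ : kˣ) : k) ^ 2) (c : Clasp) (i₁ i₂ j₁ j₂ : C) :
    tensor (jonesWeight A) c i₁ i₂ j₁ j₂ =
      straightCoeff A c.sign * (delta k i₁ j₁ * delta k i₂ j₂) +
        turnCoeff A c.sign * (delta k i₁ i₂ * delta k j₁ j₂) := by
  have key : ∀ (α β γ : k) (o : Bool), (∑ m : C, ∑ m' : C,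
      if o then γ * smoothingWeight α β i₁ m m' i₂ * (γ * smoothingWeight α β j₂ m' m j₁)
      else γ * smoothingWeight α β m' i₂ i₁ m * (γ * smoothingWeight α β m j₁ j₂ m')) =
      γ ^ 2 * β ^ 2 * (delta k i₁ j₁ * delta k i₂ j₂) + (γ ^ 2 * α ^ 2 * (Fintype.card C : k) +
        2 * γ ^ 2 * α * β) * (delta k i₁ i₂ * delta k j₁ j₂) := by
    intro α β γ o
    have : ∀ m m' : C,
      (if o then γ * smoothingWeight α β i₁ m m' i₂ * (γ * smoothingWeight α β j₂ m' m j₁)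
        else γ * smoothingWeight α β m' i₂ i₁ m * (γ * smoothingWeight α β m j₁ j₂ m')) =
      delta k m' m * (γ ^ 2 * α ^ 2 * (delta k i₁ i₂ * delta k j₁ j₂) * delta k m' m) +
      delta k m' j₁ * (delta k m j₂ * (γ ^ 2 * α * β * (delta k i₁ i₂ * delta k m' m))) +
      delta k m' i₁ * (delta k m i₂ * (γ ^ 2 * α * β * (delta k j₁ j₂ * delta k m' m))) +
      delta k m' i₁ * (delta k m i₂ * (γ ^ 2 * β ^ 2 * (delta k m' j₁ * delta k m j₂))) := by
      intro m m'
      split_ifs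
      · simp only [smoothingWeight, delta_comm j₂, delta_comm i₁, delta_comm m m']
        ring
      · simp only [smoothingWeight]
        rw [delta_comm i₂ i₁, delta_comm i₂ m, delta_comm m m', delta_comm j₁ m']
        ring
    simp only [this, Finset.sum_add_distrib, sum_delta_mul, delta_self, mul_one,
      Finset.sum_const, Finset.card_univ, nsmul_eq_mul]
    rw [delta_comm i₁ i₂, delta_comm j₁ j₂]
    ring
  have := key ((A ^ (c.sign : ℤ) : kˣ) : k) ((A ^ (-(c.sign : ℤ)) : kˣ) : k) (curlFactor A c.sign)
    c.isOver
  rw [tensor]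
  simp only [jonesWeight, bracketWeight]
  rw [this]
  have hN' : (Fintype.card C : k) =
      -((A ^ (c.sign : ℤ) : kˣ) : k) ^ 2 - ((A ^ (-(c.sign : ℤ)) : kˣ) : k) ^ 2 := by
    rw [hN]
    obtain h | h := Int.units_eq_one_or c.sign
    · simp [h]
    · simp [h]; ring
  have hcurl : curlFactor A c.sign ^ 2 = ((A ^ (-6 * (c.sign : ℤ)) : kˣ) : k) := by
    rw [curlFactor, neg_sq, ← Units.val_pow_eq_pow_val, ← zpow_natCast, ← zpow_mul]
    congr 2; push_cast; ring
  have hβ : ((A ^ (-(c.sign : ℤ)) : kˣ) : k) ^ 2 = ((A ^ (-2 * (c.sign : ℤ)) : kˣ) : k) := by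
    rw [← Units.val_pow_eq_pow_val, ← zpow_natCast, ← zpow_mul]
    congr 2; push_cast; ring
  have hα : ((A ^ (c.sign : ℤ) : kˣ) : k) ^ 4 = ((A ^ (4 * (c.sign : ℤ)) : kˣ) : k) := by
    rw [← Units.val_pow_eq_pow_val, ← zpow_natCast, ← zpow_mul]
    congr 2; push_cast; ring
  have hαβ : ((A ^ (c.sign : ℤ) : kˣ) : k) * ((A ^ (-(c.sign : ℤ)) : kˣ) : k) = 1 := by
    rw [← Units.val_mul, ← zpow_add]; simp
  have e1 : curlFactor A c.sign ^ 2 * ((A ^ (-(c.sign : ℤ)) : kˣ) : k) ^ 2 =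
      straightCoeff A c.sign := by
    rw [hcurl, hβ, straightCoeff, ← Units.val_mul, ← zpow_add]
    congr 2; ring
  have e2 : curlFactor A c.sign ^ 2 * ((A ^ (c.sign : ℤ) : kˣ) : k) ^ 4 =
      ((A ^ (-2 * (c.sign : ℤ)) : kˣ) : k) := by
    rw [hcurl, hα, ← Units.val_mul, ← zpow_add]
    congr 2; ring
  have e3 : curlFactor A c.sign ^ 2 * ((A ^ (c.sign : ℤ) : kˣ) : k) ^ 2 * (Fintype.card C : k) +
      2 * curlFactor A c.sign ^ 2 * ((A ^ (c.sign : ℤ) : kˣ) : k) *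
        ((A ^ (-(c.sign : ℤ)) : kˣ) : k) = turnCoeff A c.sign := by
    rw [turnCoeff, ← hcurl, ← e2, hN']
    generalize ((A ^ (c.sign : ℤ) : kˣ) : k) = α at *
    generalize ((A ^ (-(c.sign : ℤ)) : kˣ) : k) = β at *
    linear_combination curlFactor A c.sign ^ 2 * (1 - α * β) * hαβ
  rw [e1, e3]

/-- How clasps, given by their side and sign, change the coefficients of the two caps. -/
def capCoeff (A : kˣ) : List (Bool × ℤˣ) → k × k → k × k
  | [], v => v
  | (true, s) :: u, v => capCoeff A u (v.1 + turnCoeff A s * v.2, straightCoeff A s * v.2)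
  | (false, s) :: u, v => capCoeff A u (straightCoeff A s * v.1, turnCoeff A s * v.1 + v.2)

/-- The sides and the signs of clasps. -/
def signs (u : List (Bool × Clasp)) : List (Bool × ℤˣ) := u.map fun x => (x.1, x.2.sign)

/-- The two ways to cap off three strands span a space stable under clasps: a clasp on the two
strands joined by a cap does nothing, and on the other side it yields the same cap and the other
one. -/
lemma transfer_cap (A : kˣ) (hN : (Fintype.card C : k) = -(A : k) ^ 2 - ((A⁻¹ : kˣ) : k) ^ 2)
    (u : List (Bool × Clasp)) (m : C) (x y : k) :
    transfer (tensor (jonesWeight A)) u (fun j₁ j₂ j₃ => x * (delta k j₁ j₂ * delta k j₃ m) +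
      y * (delta k j₂ j₃ * delta k j₁ m)) = fun j₁ j₂ j₃ =>
      (capCoeff A (signs u) (x, y)).1 * (delta k j₁ j₂ * delta k j₃ m) +
        (capCoeff A (signs u) (x, y)).2 * (delta k j₂ j₃ * delta k j₁ m) := by
  induction u generalizing x y with
  | nil => rfl
  | cons z u ih =>
    obtain ⟨b, c⟩ := z
    have hs := straightCoeff_add (C := C) A hN c.sign
    simp only [signs, List.map_cons]
    cases b
    · simp only [transfer, capCoeff, tensor_jonesWeight A hN]
      rw [← signs, ← ih]
      congr 1
      funext j₁ j₂ j₃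
      have : ∀ i₃ i₂ : C, (x * (delta k j₁ i₂ * delta k i₃ m) + y * (delta k i₂ i₃ * delta k j₁ m)) *
          (straightCoeff A c.sign * (delta k i₃ j₃ * delta k i₂ j₂) +
            turnCoeff A c.sign * (delta k i₃ i₂ * delta k j₃ j₂)) =
          delta k i₂ j₂ * (delta k i₃ j₃ * (straightCoeff A c.sign *
            (x * (delta k j₁ i₂ * delta k i₃ m) + y * (delta k i₂ i₃ * delta k j₁ m)))) +
          delta k i₂ i₃ * (delta k i₃ m * (turnCoeff A c.sign * x * delta k j₃ j₂ *
            delta k j₁ i₂)) +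
          delta k i₂ i₃ * (turnCoeff A c.sign * y * delta k j₃ j₂ * delta k j₁ m *
            delta k i₂ i₃) := by
        intro i₃ i₂
        rw [delta_comm i₃ i₂]
        ring
      simp only [this, Finset.sum_add_distrib, sum_delta_mul, delta_self, mul_one,
        Finset.sum_const, Finset.card_univ, nsmul_eq_mul]
      rw [delta_comm j₃ j₂]
      linear_combination y * delta k j₂ j₃ * delta k j₁ m * hs
    · simp only [transfer, capCoeff, tensor_jonesWeight A hN]
      rw [← signs, ← ih]
      congr 1
      funext j₁ j₂ j₃
      have : ∀ i₁ i₂ : C, (x * (delta k i₁ i₂ * delta k j₃ m) + y * (delta k i₂ j₃ * delta k i₁ m)) *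
          (straightCoeff A c.sign * (delta k i₁ j₁ * delta k i₂ j₂) +
            turnCoeff A c.sign * (delta k i₁ i₂ * delta k j₁ j₂)) =
          delta k i₂ j₂ * (delta k i₁ j₁ * (straightCoeff A c.sign *
            (x * (delta k i₁ i₂ * delta k j₃ m) + y * (delta k i₂ j₃ * delta k i₁ m)))) +
          delta k i₂ i₁ * (turnCoeff A c.sign * x * delta k j₁ j₂ * delta k j₃ m *
            delta k i₁ i₂) +
          delta k i₂ i₁ * (delta k i₁ m * (turnCoeff A c.sign * y * delta k j₁ j₂ *
            delta k i₂ j₃)) := by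
        intro i₁ i₂
        rw [delta_comm i₁ i₂]
        ring
      simp only [this, Finset.sum_add_distrib, sum_delta_mul, delta_self, mul_one,
        Finset.sum_const, Finset.card_univ, nsmul_eq_mul]
      rw [delta_comm m j₃]
      linear_combination x * delta k j₁ j₂ * delta k j₃ m * hs

/-- Clasps in a row multiply their identity coefficients. The turn-back coefficient `κ` is needed
only through the relation with N, which the induction carries along as the relation between `γ` and
`κ₀`. -/
lemma twistTensor_jonesWeight (A : kˣ)
    (hN : (Fintype.card C : k) = -(A : k) ^ 2 - ((A⁻¹ : kˣ) : k) ^ 2) (t : List Clasp)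
    (s : ℤˣ) (ht : ∀ c ∈ t, c.sign = s) : ∃ κ : k,
      straightCoeff A s ^ t.length + κ * (Fintype.card C : k) = 1 ∧
      ∀ i₁ i₂ j₁ j₂ : C, twistTensor (tensor (jonesWeight A)) t i₁ i₂ j₁ j₂ =
        straightCoeff A s ^ t.length * (delta k j₁ i₁ * delta k j₂ i₂) +
          κ * (delta k i₁ i₂ * delta k j₁ j₂) := by
  have hs := straightCoeff_add (C := C) A hN s
  have gen : ∀ (γ κ₀ : k), γ + κ₀ * (Fintype.card C : k) = 1 → ∃ κ : k,
      straightCoeff A s ^ t.length * γ + κ * (Fintype.card C : k) = 1 ∧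
      ∀ i₁ i₂ j₁ j₂ j₃ : C, transfer (tensor (jonesWeight A)) (t.map fun c => (true, c))
        (fun a b _ => γ * (delta k a i₁ * delta k b i₂) + κ₀ * (delta k i₁ i₂ * delta k a b))
          j₁ j₂ j₃ = straightCoeff A s ^ t.length * γ * (delta k j₁ i₁ * delta k j₂ i₂) +
            κ * (delta k i₁ i₂ * delta k j₁ j₂) := by
    induction t with
    | nil => exact fun γ κ₀ h => ⟨κ₀, by simpa using h, by simp [transfer]⟩
    | cons c t ih =>
      intro γ κ₀ h
      obtain ⟨κ, h1, h2⟩ := ih (fun c hc => ht c (by simp [hc])) (straightCoeff A s * γ)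
        (κ₀ + turnCoeff A s * γ) (by linear_combination h + γ * hs)
      refine ⟨κ, by rw [← h1, List.length_cons]; ring, fun i₁ i₂ j₁ j₂ j₃ => ?_⟩
      rw [List.length_cons, pow_succ, mul_assoc (_ ^ _) _ γ, ← h2 i₁ i₂ j₁ j₂ j₃]
      simp only [List.map_cons, transfer, tensor_jonesWeight A hN, ht c (by simp)]
      congr 1
      funext a b _
      have : ∀ x y : C, (γ * (delta k x i₁ * delta k y i₂) + κ₀ * (delta k i₁ i₂ * delta k x y)) *
          (straightCoeff A s * (delta k x a * delta k y b) +
            turnCoeff A s * (delta k x y * delta k a b)) =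
          delta k y b * (delta k x a * (straightCoeff A s *
            (γ * (delta k x i₁ * delta k y i₂) + κ₀ * (delta k i₁ i₂ * delta k x y)))) +
          delta k y i₂ * (delta k x i₁ * (γ * turnCoeff A s * delta k a b * delta k x y)) +
          delta k y x * (κ₀ * turnCoeff A s * delta k a b * delta k i₁ i₂ * delta k x y) := by
        intro x y
        rw [delta_comm y x]
        ring
      simp only [this, Finset.sum_add_distrib, sum_delta_mul, delta_self, mul_one,
        Finset.sum_const, Finset.card_univ, nsmul_eq_mul]
      linear_combination κ₀ * delta k i₁ i₂ * delta k a b * hs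
  obtain ⟨κ, h1, h2⟩ := gen 1 0 (by simp)
  refine ⟨κ, by simpa using h1, fun i₁ i₂ j₁ j₂ => ?_⟩
  have := h2 i₁ i₂ j₁ j₂ j₁
  simpa [twistTensor] using this

/-- Gluing a tangle to its mirror image: a clasp meets the opposite clasp and cancels, so the
pairing of caps (N for equal caps, 1 for different ones) is preserved. -/
lemma capCoeff_mirror (A : kˣ)
    (hN : (Fintype.card C : k) = -(A : k) ^ 2 - ((A⁻¹ : kˣ) : k) ^ 2) (u : List (Bool × ℤˣ))
    (v v' : k × k) :
    let x := capCoeff A u v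
    let x' := capCoeff A (u.map fun z => (z.1, -z.2)) v'
    (Fintype.card C : k) * x.1 * x'.1 + x.1 * x'.2 + x.2 * x'.1 + Fintype.card C * x.2 * x'.2 =
      Fintype.card C * v.1 * v'.1 + v.1 * v'.2 + v.2 * v'.1 + Fintype.card C * v.2 * v'.2 := by
  induction u generalizing v v' with
  | nil => rfl
  | cons z u ih =>
    obtain ⟨b, s⟩ := z
    have h1 := straightCoeff_add (C := C) A hN s
    have h2 := straightCoeff_add (C := C) A hN (-s)
    have h3 := straightCoeff_mul_neg A s
    have h4 := straightCoeff_mul_turnCoeff_neg A s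
    simp only [List.map_cons]
    cases b <;> simp only [capCoeff] <;> rw [ih]
    · linear_combination v.1 * v'.2 * h1 + v.2 * v'.1 * h2 + v.1 * v'.1 * (Fintype.card C : k) * h3 +
        v.1 * v'.1 * (turnCoeff A s * h2 + h4)
    · linear_combination v.2 * v'.1 * h1 + v.1 * v'.2 * h2 + v.2 * v'.2 * (Fintype.card C : k) * h3 +
        v.2 * v'.2 * (turnCoeff A s * h2 + h4)

/-- The Jones polynomial at `A` of the closure without twists of clasps and their mirror images. -/
def closureValue (A : kˣ) (u : List (Bool × ℤˣ)) : k :=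
  let N : k := -(A : k) ^ 2 - ((A⁻¹ : kˣ) : k) ^ 2
  let x := capCoeff A u (1, 0)
  let x' := capCoeff A (u.map fun z => (z.1, -z.2)) (1, 0)
  (x.1 + N * x.2) * (x'.1 + N * x'.2)

/-- The identity term of the twists gives γ · `closureValue` · N with γ the power of
`straightCoeff`; the turn-back term gives κN² by `capCoeff_mirror`, and κN = 1 - γ. -/
lemma stateSum_jonesWeight_knotWord (A : kˣ)
    (hN : (Fintype.card C : k) = -(A : k) ^ 2 - ((A⁻¹ : kˣ) : k) ^ 2)
    (u l : List (Bool × Clasp)) (t : List Clasp) (h : (labels (all u ++ all l ++ t)).Nodup)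
    (hl : signs l = (signs u).map fun z => (z.1, -z.2)) (s : ℤˣ) (ht : ∀ c ∈ t, c.sign = s)
    (f : Assignment C) :
    stateSum (jonesWeight A) (knotWord u l t) f =
      (1 + straightCoeff A s ^ t.length * (closureValue A (signs u) - 1)) * Fintype.card C := by
  rw [stateSum_knotWord _ ?_ u l t h f]
  swap
  · intro c i₁ i₂ j₁ j₂
    rw [tensor_jonesWeight A hN, tensor_jonesWeight A hN, delta_comm i₂ i₁, delta_comm j₂ j₁,
      mul_comm (delta k i₂ j₂)]
  obtain ⟨κ, hκ, hG⟩ := twistTensor_jonesWeight (C := C) A hN t s ht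
  have hU : ∀ (u : List (Bool × Clasp)) (m : C), transfer (tensor (jonesWeight A)) u (cap m) =
      fun j₁ j₂ j₃ => (capCoeff A (signs u) (1, 0)).1 * (delta k j₁ j₂ * delta k j₃ m) +
        (capCoeff A (signs u) (1, 0)).2 * (delta k j₂ j₃ * delta k j₁ m) := by
    intro u m
    rw [← transfer_cap A hN]
    congr 1
    funext a b c
    simp [cap]
  have hinv := capCoeff_mirror (C := C) A hN (signs u) (1, 0) (1, 0)
  rw [← hl] at hinv
  rw [closureValue, ← hl, ← hN]
  simp only [closure, hU, hG]
  generalize capCoeff A (signs u) (1, 0) = x at *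
  generalize capCoeff A (signs l) (1, 0) = x' at *
  generalize straightCoeff A s ^ t.length = γ at *
  have hsum : ∀ m a b c d e : C,
      (x.1 * (delta k a b * delta k c m) + x.2 * (delta k b c * delta k a m)) *
        ((x'.1 * (delta k a d * delta k e m) + x'.2 * (delta k d e * delta k a m)) *
          (γ * (delta k e d * delta k c b) + κ * (delta k d b * delta k e c))) =
      delta k e m * (delta k d a * (delta k c m * (delta k b a * (delta k d e * (delta k b c *
        (x.1 * x'.1 * γ)))))) +
      delta k e d * (delta k d e * (delta k c m * (delta k b a * (delta k a m * (delta k b c *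
        (x.1 * x'.2 * γ)))))) +
      delta k e m * (delta k d a * (delta k c b * (delta k b c * (delta k a m * (delta k d e *
        (x.2 * x'.1 * γ)))))) +
      delta k e d * (delta k d e * (delta k c b * (delta k b c * (delta k a m * (delta k a m *
        (x.2 * x'.2 * γ)))))) +
      delta k e m * (delta k d a * (delta k c m * (delta k b a * (delta k d b * (delta k e c *
        (x.1 * x'.1 * κ)))))) +
      delta k e c * (delta k d b * (delta k c m * (delta k b a * (delta k a m * (delta k d e *
        (x.1 * x'.2 * κ)))))) +
      delta k e m * (delta k d a * (delta k c b * (delta k b d * (delta k a m * (delta k e c *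
        (x.2 * x'.1 * κ)))))) +
      delta k e c * (delta k d b * (delta k c b * (delta k d e * (delta k a m * (delta k a m *
        (x.2 * x'.2 * κ)))))) := by
    intro m a b c d e
    rw [delta_comm a b, delta_comm b c, delta_comm a d, delta_comm d e, delta_comm b d]
    ring
  simp only [hsum, Finset.sum_add_distrib, sum_delta_mul, delta_self, one_mul, Finset.sum_const,
    Finset.card_univ, nsmul_eq_mul, ← Finset.mul_sum]
  linear_combination κ * (Fintype.card C : k) * hinv + (Fintype.card C : k) * hκ

end Clasp

/-! ### Jones polynomials along the twist family. -/

namespace Clasp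

open LaurentPolynomial

lemma evalInt_jones_knotDiagram {C k : Type*} [Fintype C] [DecidableEq C] [CommRing k] [Nonempty C]
    (A : kˣ) (hN : (Fintype.card C : k) = -(A : k) ^ 2 - ((A⁻¹ : kˣ) : k) ^ 2)
    (u l : List (Bool × Clasp)) (t : List Clasp) (h : (labels (all u ++ all l ++ t)).Nodup)
    (hl : signs l = (signs u).map fun z => (z.1, -z.2)) (ht : ∀ c ∈ t, c.sign = -1) :
    evalInt A (knotDiagram u l t h).jones * (Fintype.card C : k) =
      (1 + (A : k) ^ (8 * t.length) * (closureValue A (signs u) - 1)) * Fintype.card C := by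
  have c₀ : C := Classical.arbitrary C
  rw [GaussDiagram.evalInt_jones_mul_card A hN _ fun _ => ((c₀, c₀), (c₀, c₀))]
  have h8 : (straightCoeff A (-1) : k) = (A : k) ^ 8 := by
    rw [straightCoeff, ← Units.val_pow_eq_pow_val, ← zpow_natCast]
    simp
  rw [pow_mul, ← h8]
  exact stateSum_jonesWeight_knotWord A hN u l t h hl (-1) ht _

lemma evalInt_T {k : Type*} [CommRing k] (A : kˣ) (n : ℕ) :
    evalInt A (T n : ℤ[T;T⁻¹]) = (A : k) ^ n := by
  simp [evalInt]

/-- At every admissible A the twists enter only through the factor A^(8ℓ), since each negative clasp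
has identity coefficient A⁸ = t⁻². -/
lemma jones_knotDiagram_sub_one (u l : List (Bool × Clasp)) (t : List Clasp)
    (h : (labels (all u ++ all l ++ t)).Nodup) (h₀ : (labels (all u ++ all l ++ [])).Nodup)
    (hl : signs l = (signs u).map fun z => (z.1, -z.2)) (ht : ∀ c ∈ t, c.sign = -1) :
    (knotDiagram u l t h).jones - 1 =
      T (8 * t.length) * ((knotDiagram u l [] h₀).jones - 1) := by
  refine eq_of_evalInt fun N A hN => ?_
  have hN0 : (Fintype.card (Fin (N + 1)) : ℂ) ≠ 0 := Nat.cast_ne_zero.2 (by simp)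
  have e1 := mul_right_cancel₀ hN0 (evalInt_jones_knotDiagram A hN u l t h hl ht)
  have e2 := mul_right_cancel₀ hN0 (evalInt_jones_knotDiagram A hN u l [] h₀ hl (by simp))
  have e3 := evalInt_T A (8 * t.length)
  push_cast at e3
  rw [map_sub, map_mul, map_sub, map_one, e1, e2, e3]
  simp

lemma eq_geom_sum_of_sub_one {V W : ℤ[T;T⁻¹]} {l : ℕ} (h : W - 1 = T (8 * l) * (V - 1)) :
    W = (tpow (-2) - 1) * (V - 1) * (∑ i ∈ Finset.range l, tpow (-2 * (i : ℤ))) + V := by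
  have h1 : ∀ i : ℕ, tpow (-2 * (i : ℤ)) = (tpow (-2)) ^ i := fun i => by
    rw [tpow, tpow, T_pow]; congr 1; ring
  have h2 : (T (8 * l) : ℤ[T;T⁻¹]) = (tpow (-2)) ^ l := by
    rw [tpow, T_pow]; congr 1; ring
  simp only [h1]
  rw [h2] at h
  have h3 := geom_sum_mul (tpow (-2)) l
  linear_combination h - (V - 1) * h3

lemma T_mul_injective {V : ℤ[T;T⁻¹]} (hV : V ≠ 0) {a b : ℤ} (h : T a * V = T b * V) : a = b := by
  have := mul_right_cancel₀ hV h
  by_contra hab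
  have h1 : (T a : ℤ[T;T⁻¹]).coeff a = (T b : ℤ[T;T⁻¹]).coeff a := by rw [this]
  rw [T_apply, T_apply, if_pos rfl, if_neg (Ne.symm hab)] at h1
  exact one_ne_zero h1

end Clasp

/-! ### Counting faces by a state sum. -/

namespace GaussDiagram

/-- The colours of the left and the right sides of the arcs at a crossing of sign `s` have to agree
at its four corners. -/
def faceWeight (s : ℤˣ) (a b c d : Bool × Bool) : ℤ :=
  if s = 1 then delta ℤ a.1 d.1 * delta ℤ b.2 c.2 * (delta ℤ c.1 a.2 * delta ℤ d.2 b.1)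
  else delta ℤ a.1 c.2 * delta ℤ b.2 d.1 * (delta ℤ c.1 b.1 * delta ℤ d.2 a.2)

variable (D : GaussDiagram)

lemma partner_partner (p : D.Passage) : D.partner (D.partner p) = p := Subtype.ext (opp_opp _)

lemma succ_pred (p : D.Passage) : D.succ (D.pred p) = p :=
  Subtype.ext (List.next_prev _ D.nodup _ p.2)

lemma pred_succ (p : D.Passage) : D.pred (D.succ p) = p :=
  Subtype.ext (List.prev_next _ D.nodup _ p.2)

/-- A colouring of the sides of the arcs as a colouring of the walkers of `turnLeft`. -/
def sideEquiv : (D.Passage → Bool × Bool) ≃ (D.Passage × ℤˣ → Bool) where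
  toFun c x := if x.2 = 1 then (c x.1).1 else (c (D.succ x.1)).2
  invFun g p := (g (p, 1), g (D.pred p, -1))
  left_inv c := by
    funext p
    simp [succ_pred, show ¬ (-1 : ℤˣ) = 1 by decide]
  right_inv g := by
    funext ⟨p, d⟩
    obtain rfl | rfl := Int.units_eq_one_or d
    · simp
    · simp [pred_succ, show ¬ (-1 : ℤˣ) = 1 by decide]

/-- The condition at the two walkers who arrive along the strand of a passage. -/
lemma forall_turnLeft_iff (c : D.Passage → Bool × Bool) :
    (∀ x y, y = D.turnLeft x → D.sideEquiv c x = D.sideEquiv c y) ↔ ∀ p : D.Passage,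
      if D.crossingDirection p = 1
      then (c p).1 = (c (D.succ (D.partner p))).1 ∧ (c (D.succ p)).2 = (c (D.partner p)).2
      else (c p).1 = (c (D.partner p)).2 ∧ (c (D.succ p)).2 = (c (D.succ (D.partner p))).1 := by
  have hne : ¬ (-1 : ℤˣ) = 1 := by decide
  simp only [forall_eq, Prod.forall]
  refine forall_congr' fun p => ?_
  have hd : ∀ P : ℤˣ → Prop, (∀ d, P d) ↔ P 1 ∧ P (-1) := fun P =>
    ⟨fun h => ⟨h 1, h (-1)⟩, fun h d => by
      obtain rfl | rfl := Int.units_eq_one_or d; exacts [h.1, h.2]⟩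
  rw [hd]
  obtain h | h := Int.units_eq_one_or (D.crossingDirection p)
  · simp [turnLeft, sideEquiv, h, hne, succ_pred]
  · simp [turnLeft, sideEquiv, h, hne, succ_pred]

lemma delta_mul_four (a b c d a' b' c' d' : Bool) :
    delta ℤ a a' * delta ℤ b b' * (delta ℤ c c' * delta ℤ d d') =
      if (a = a' ∧ b = b') ∧ (c = c' ∧ d = d') then 1 else 0 := by
  simp only [delta, ite_and, mul_ite, mul_one, mul_zero]
  split_ifs <;> rfl

lemma faceWeight_eq_ite (c : D.Passage → Bool × Bool) (p : D.OverPassage) :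
    faceWeight p.1.1.sign (c p.1) (c (D.succ p.1)) (c (D.partner p.1))
      (c (D.succ (D.partner p.1))) =
      if (∀ q : D.Passage, (q = p.1 ∨ q = D.partner p.1) → if D.crossingDirection q = 1
      then (c q).1 = (c (D.succ (D.partner q))).1 ∧ (c (D.succ q)).2 = (c (D.partner q)).2
      else (c q).1 = (c (D.partner q)).2 ∧ (c (D.succ q)).2 = (c (D.succ (D.partner q))).1)
      then 1 else 0 := by
  have hne : ¬ (-1 : ℤˣ) = 1 := by decide
  obtain ⟨p, hp⟩ := p
  have h1 : D.crossingDirection p = p.1.sign := by simp [crossingDirection, hp]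
  have h2 : D.crossingDirection (D.partner p) = -p.1.sign := by
    simp [crossingDirection, partner, ChordEnd.opp, hp]
  simp only [forall_eq_or_imp, forall_eq, partner_partner, h1, h2]
  obtain h | h := Int.units_eq_one_or p.1.sign
  · simp only [h, hne, if_true, if_false, faceWeight, delta_mul_four]
  · simp only [h, hne, neg_neg, if_true, if_false, faceWeight, delta_mul_four]

/-- A walker of `turnLeft` keeps to one side of an arc. So two-colourings of the walkers are
colourings of the left and right sides of arcs, and those constant along faces are cut out by local
conditions at the crossings. -/
lemma two_pow_faceCount (hD : D.word ≠ []) (f : Assignment (Bool × Bool)) :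
    (2 : ℤ) ^ D.faceCount = stateSum faceWeight D.word f := by
  classical
  rw [stateSum_eq_sum_colorings _ D hD, faceCount,
    show (2 : ℤ) = ((Fintype.card Bool : ℕ) : ℤ) by simp, ← Nat.cast_pow, card_pow_card_quot,
    Nat.cast_sum]
  symm
  refine Finset.sum_equiv D.sideEquiv (by simp) fun c _ => ?_
  rw [Nat.cast_ite, Nat.cast_one, Nat.cast_zero]
  rw [D.prod_filter_over fun p => faceWeight p.1.sign (c p) (c (D.succ p)) (c (D.partner p))
    (c (D.succ (D.partner p)))]
  simp only [faceWeight_eq_ite]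
  rw [Finset.prod_ite_zero, Finset.prod_const_one]
  simp only [Finset.mem_univ, true_implies]
  have hiff := D.forall_turnLeft_iff c
  split_ifs with h1 h2 h2
  · rfl
  · refine absurd (hiff.2 fun p => ?_) h2
    by_cases ho : p.1.isOver = true
    · exact h1 ⟨p, ho⟩ p (Or.inl rfl)
    · refine h1 ⟨D.partner p, by simpa [partner, ChordEnd.opp] using ho⟩ p (Or.inr ?_)
      rw [partner_partner]
  · exact absurd (fun p q _ => hiff.1 h2 q) h1
  · rfl

end GaussDiagram

/-! ### Faces of the clasp diagrams. -/

namespace Clasp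

open GaussDiagram

/-- The sign of the first crossing of a clasp as seen from the first strand. -/
def side (c : Clasp) : ℤˣ := if c.isOver then c.sign else -c.sign

/-- The bigon inside the clasp has a free colour, hence the 2. The regions outside the two strands
pass by the clasp, while the region between them is cut into one above and one below. -/
lemma tensor_faceWeight_of_side_one {c : Clasp} (hc : c.side = 1) (i₁ i₂ j₁ j₂ : Bool × Bool) :
    tensor faceWeight c i₁ i₂ j₁ j₂ = 2 * (delta ℤ i₁.2 j₁.2 * delta ℤ i₂.2 j₂.2 *
      (delta ℤ i₁.1 i₂.1 * delta ℤ j₁.1 j₂.1)) := by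
  have key : ∀ m m' : Bool × Bool, (if c.isOver
      then faceWeight c.sign i₁ m m' i₂ * faceWeight c.sign j₂ m' m j₁
      else faceWeight c.sign m' i₂ i₁ m * faceWeight c.sign m j₁ j₂ m') =
      delta ℤ m'.2 m.2 * (delta ℤ m'.1 i₁.2 * (delta ℤ m.1 i₂.2 * (delta ℤ m'.2 m.2 *
        (delta ℤ m'.1 j₁.2 * (delta ℤ m.1 j₂.2 * (delta ℤ i₁.1 i₂.1 * delta ℤ j₁.1 j₂.1)))))) := by
    intro m m'
    have hne : ¬ (-1 : ℤˣ) = 1 := by decide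
    cases ho : c.isOver
    · have hs : c.sign = -1 := by rw [side, ho] at hc; simpa [neg_eq_iff_eq_neg] using hc
      simp only [hs, faceWeight, hne, if_false, Bool.false_eq_true]
      rw [delta_comm i₂.2, delta_comm m.2, delta_comm j₁.2, delta_comm j₂.1]
      ring
    · have hs : c.sign = 1 := by rw [side, ho] at hc; simpa using hc
      simp only [hs, faceWeight, if_true]
      rw [delta_comm i₂.2, delta_comm m.2, delta_comm j₁.2, delta_comm j₂.1]
      ring
  rw [tensor]
  simp only [key, Fintype.sum_prod_type, sum_delta_mul, delta_self, one_mul, Finset.sum_const,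
    ← Finset.mul_sum, Finset.card_univ, Fintype.card_bool, nsmul_eq_mul]
  push_cast; ring

lemma tensor_faceWeight_of_side_neg_one {c : Clasp} (hc : c.side = -1) (i₁ i₂ j₁ j₂ : Bool × Bool) :
    tensor faceWeight c i₁ i₂ j₁ j₂ = 2 * (delta ℤ i₁.1 j₁.1 * delta ℤ i₂.1 j₂.1 *
      (delta ℤ i₁.2 i₂.2 * delta ℤ j₁.2 j₂.2)) := by
  have key : ∀ m m' : Bool × Bool, (if c.isOver
      then faceWeight c.sign i₁ m m' i₂ * faceWeight c.sign j₂ m' m j₁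
      else faceWeight c.sign m' i₂ i₁ m * faceWeight c.sign m j₁ j₂ m') =
      delta ℤ m'.2 i₁.1 * (delta ℤ m'.1 m.1 * (delta ℤ m.2 i₂.1 * (delta ℤ m'.1 m.1 *
        (delta ℤ m'.2 j₁.1 * (delta ℤ m.2 j₂.1 * (delta ℤ i₁.2 i₂.2 * delta ℤ j₁.2 j₂.2)))))) := by
    intro m m'
    have hne : ¬ (-1 : ℤˣ) = 1 := by decide
    cases ho : c.isOver
    · have hs : c.sign = 1 := by rw [side, ho] at hc; simpa using hc
      simp only [hs, faceWeight, if_true, if_false, Bool.false_eq_true]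
      rw [delta_comm i₂.2, delta_comm i₁.1, delta_comm m.1 m'.1, delta_comm j₂.1]
      ring
    · have hs : c.sign = -1 := by rw [side, ho] at hc; simpa using hc
      simp only [hs, faceWeight, hne, if_true, if_false]
      rw [delta_comm i₂.2, delta_comm i₁.1, delta_comm m.1 m'.1, delta_comm j₂.1]
      ring
  rw [tensor]
  simp only [key, Fintype.sum_prod_type, sum_delta_mul, delta_self, one_mul, Finset.sum_const,
    Finset.card_univ, Fintype.card_bool, nsmul_eq_mul]
  push_cast; ring

lemma tensor_faceWeight_symm (c : Clasp) (i₁ i₂ j₁ j₂ : Bool × Bool) :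
    tensor faceWeight c i₂ i₁ j₂ j₁ = tensor faceWeight c i₁ i₂ j₁ j₂ := by
  obtain h | h := Int.units_eq_one_or c.side
  · rw [tensor_faceWeight_of_side_one h, tensor_faceWeight_of_side_one h, delta_comm i₂.1,
      delta_comm j₂.1]
    ring
  · rw [tensor_faceWeight_of_side_neg_one h, tensor_faceWeight_of_side_neg_one h, delta_comm i₂.2,
      delta_comm j₂.2]
    ring

/-- Left clasps have side `1` and right clasps have side `-1`. -/
def IsAlternating (u : List (Bool × Clasp)) : Prop :=
  ∀ x ∈ u, x.2.side = if x.1 then 1 else -1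

/-- The colours at the faces of an alternating tangle with clasps on both sides. -/
def faceCap (m j₁ j₂ j₃ : Bool × Bool) : ℤ :=
  delta ℤ j₁.1 j₂.1 * delta ℤ j₂.2 j₃.2 * (delta ℤ j₃.1 m.1 * delta ℤ j₁.2 m.2)

lemma transfer_const_mul {C k : Type*} [Fintype C] [DecidableEq C] [CommRing k]
    (τ : Clasp → C → C → C → C → k) (u : List (Bool × Clasp)) (r : k) (ψ : C → C → C → k) :
    transfer τ u (fun a b c => r * ψ a b c) = fun a b c => r * transfer τ u ψ a b c := by
  induction u generalizing ψ with
  | nil => rfl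
  | cons x u ih =>
    obtain ⟨b, c⟩ := x
    cases b <;> simp only [transfer, ← ih, mul_assoc, Finset.mul_sum]

lemma delta_pair (a b : Bool × Bool) : delta ℤ a b = delta ℤ a.1 b.1 * delta ℤ a.2 b.2 := by
  obtain ⟨a1, a2⟩ := a
  obtain ⟨b1, b2⟩ := b
  simp only [delta, Prod.mk.injEq, ite_and, mul_ite, mul_one, mul_zero]
  split_ifs <;> rfl

/-- Once both gaps between strands are closed off from above, a further clasp completes two faces:
its bigon and the region between it and the end of the gap above. -/
lemma transfer_faceCap {u : List (Bool × Clasp)} (hu : IsAlternating u) (m : Bool × Bool) :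
    transfer (tensor faceWeight) u (faceCap m) = fun a b c => 4 ^ u.length * faceCap m a b c := by
  induction u with
  | nil => simp [transfer]
  | cons x u ih =>
    obtain ⟨b, c⟩ := x
    have hc := hu (b, c) (by simp)
    have ih := ih fun x hx => hu x (by simp [hx])
    cases b
    · have key : (fun j₁ j₂ j₃ => ∑ i₃, ∑ i₂, faceCap m j₁ i₂ i₃ *
          tensor faceWeight c i₃ i₂ j₃ j₂) = fun j₁ j₂ j₃ => 4 * faceCap m j₁ j₂ j₃ := by
        funext j₁ j₂ j₃
        have : ∀ i₃ i₂ : Bool × Bool, faceCap m j₁ i₂ i₃ * tensor faceWeight c i₃ i₂ j₃ j₂ =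
            delta ℤ i₂.2 i₃.2 * (delta ℤ i₂.1 j₂.1 * (delta ℤ i₃.1 j₃.1 * (delta ℤ i₂.2 i₃.2 *
              (delta ℤ i₃.1 m.1 * (delta ℤ j₁.1 i₂.1 * (2 * (delta ℤ j₂.2 j₃.2 *
                delta ℤ j₁.2 m.2))))))) := by
          intro i₃ i₂
          rw [tensor_faceWeight_of_side_neg_one (by simpa using hc), faceCap,
            delta_comm i₃.2, delta_comm j₃.2]
          ring
        simp only [this, Fintype.sum_prod_type, sum_delta_mul, delta_self, one_mul,
          Finset.sum_const, ← Finset.mul_sum, Finset.card_univ, Fintype.card_bool, nsmul_eq_mul]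
        rw [faceCap]
        push_cast; ring
      rw [transfer, key, transfer_const_mul, ih]
      funext a b c
      rw [List.length_cons, pow_succ]; ring
    · have key : (fun j₁ j₂ j₃ => ∑ i₁, ∑ i₂, faceCap m i₁ i₂ j₃ *
          tensor faceWeight c i₁ i₂ j₁ j₂) = fun j₁ j₂ j₃ => 4 * faceCap m j₁ j₂ j₃ := by
        funext j₁ j₂ j₃
        have : ∀ i₁ i₂ : Bool × Bool, faceCap m i₁ i₂ j₃ * tensor faceWeight c i₁ i₂ j₁ j₂ =
            delta ℤ i₂.1 i₁.1 * (delta ℤ i₂.2 j₂.2 * (delta ℤ i₁.2 j₁.2 * (delta ℤ i₂.1 i₁.1 *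
              (delta ℤ i₁.2 m.2 * (delta ℤ i₂.2 j₃.2 * (2 * (delta ℤ j₁.1 j₂.1 *
                delta ℤ j₃.1 m.1))))))) := by
          intro i₁ i₂
          rw [tensor_faceWeight_of_side_one (by simpa using hc), faceCap, delta_comm i₁.1]
          ring
        simp only [this, Fintype.sum_prod_type, sum_delta_mul, delta_self, one_mul,
          Finset.sum_const, ← Finset.mul_sum, Finset.card_univ, Fintype.card_bool, nsmul_eq_mul]
        rw [faceCap]
        push_cast; ring
      rw [transfer, key, transfer_const_mul, ih]
      funext a b c
      rw [List.length_cons, pow_succ]; ring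

/-- Under the cap, the right gap is still joined to the outside of the left strand. The first right
clasp separates them and completes only its bigon; every other clasp contributes 4. This accounts
for the factor 2 on the left. -/
lemma two_mul_transfer_cap {u : List (Bool × Clasp)} (hu : IsAlternating u)
    (hr : ∃ x ∈ u, x.1 = false) (m a b c : Bool × Bool) :
    2 * transfer (tensor faceWeight) u (cap m) a b c = 4 ^ u.length * faceCap m a b c := by
  induction u with
  | nil => simp at hr
  | cons x u ih =>
    obtain ⟨side, cl⟩ := x
    have hc := hu (side, cl) (by simp)
    have hu' : IsAlternating u := fun x hx => hu x (by simp [hx])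
    cases side
    · have key : (fun j₁ j₂ j₃ => ∑ i₃, ∑ i₂, cap m j₁ i₂ i₃ *
          tensor faceWeight cl i₃ i₂ j₃ j₂) = fun j₁ j₂ j₃ => 2 * faceCap m j₁ j₂ j₃ := by
        funext j₁ j₂ j₃
        have : ∀ i₃ i₂ : Bool × Bool, cap m j₁ i₂ i₃ * tensor faceWeight cl i₃ i₂ j₃ j₂ =
            delta ℤ i₂ j₁ * (delta ℤ i₃ m * (2 * (delta ℤ i₃.1 j₃.1 * delta ℤ i₂.1 j₂.1 *
              (delta ℤ i₃.2 i₂.2 * delta ℤ j₂.2 j₃.2)))) := by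
          intro i₃ i₂
          rw [tensor_faceWeight_of_side_neg_one (by simpa using hc), cap, delta_comm j₃.2,
            delta_comm j₁ i₂]
          ring
        simp only [this, sum_delta_mul]
        rw [faceCap, delta_comm m.1, delta_comm m.2]
        ring
      rw [transfer, key, transfer_const_mul, transfer_faceCap hu', List.length_cons, pow_succ]
      ring
    · have hr' : ∃ x ∈ u, x.1 = false := by simpa using hr
      have key : (fun j₁ j₂ j₃ => ∑ i₁, ∑ i₂, (cap m i₁ i₂ j₃ : ℤ) *
          tensor faceWeight cl i₁ i₂ j₁ j₂) = fun j₁ j₂ j₃ => 4 * cap m j₁ j₂ j₃ := by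
        funext j₁ j₂ j₃
        have : ∀ i₁ i₂ : Bool × Bool, cap m i₁ i₂ j₃ * tensor faceWeight cl i₁ i₂ j₁ j₂ =
            delta ℤ i₂.1 i₁.1 * (delta ℤ i₂.2 i₁.2 * (delta ℤ i₁.2 j₁.2 * (delta ℤ i₂.1 i₁.1 *
              (delta ℤ i₂.2 j₂.2 * (2 * (delta ℤ j₁.1 j₂.1 * delta ℤ j₃ m)))))) := by
          intro i₁ i₂
          rw [tensor_faceWeight_of_side_one (by simpa using hc), cap, delta_comm i₁.1,
            delta_comm i₁ i₂, delta_pair i₂ i₁]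
          ring
        simp only [this, Fintype.sum_prod_type, sum_delta_mul, delta_self, one_mul,
          Finset.sum_const, ← Finset.mul_sum, Finset.card_univ, Fintype.card_bool, nsmul_eq_mul]
        rw [cap, delta_pair j₁ j₂]
        push_cast; ring
      rw [transfer, key, transfer_const_mul, List.length_cons, pow_succ]
      linear_combination 4 * ih hu' hr'

/-- The first clasp of the row completes only its bigon, each later one also the region between it
and its predecessor. -/
lemma two_mul_twistTensor_faceWeight {t : List Clasp} (ht : ∀ c ∈ t, c.side = 1) (h : t ≠ [])
    (i₁ i₂ j₁ j₂ : Bool × Bool) : 2 * twistTensor (tensor faceWeight) t i₁ i₂ j₁ j₂ =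
      4 ^ t.length * (delta ℤ i₁.2 j₁.2 * delta ℤ i₂.2 j₂.2 *
        (delta ℤ i₁.1 i₂.1 * delta ℤ j₁.1 j₂.1)) := by
  have gen : ∀ t : List Clasp, (∀ c ∈ t, c.side = 1) →
      transfer (tensor faceWeight) (t.map fun c => (true, c)) (fun j₁ j₂ _ =>
        delta ℤ i₁.2 j₁.2 * delta ℤ i₂.2 j₂.2 * (delta ℤ i₁.1 i₂.1 * delta ℤ j₁.1 j₂.1)) =
      fun j₁ j₂ _ => 4 ^ t.length * (delta ℤ i₁.2 j₁.2 * delta ℤ i₂.2 j₂.2 *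
        (delta ℤ i₁.1 i₂.1 * delta ℤ j₁.1 j₂.1)) := by
    intro t ht
    induction t with
    | nil => simp [transfer]
    | cons c t ih =>
      rw [List.map_cons, transfer]
      have key : (fun j₁ j₂ (_ : Bool × Bool) => ∑ x₁ : Bool × Bool, ∑ x₂ : Bool × Bool,
          delta ℤ i₁.2 x₁.2 * delta ℤ i₂.2 x₂.2 * (delta ℤ i₁.1 i₂.1 * delta ℤ x₁.1 x₂.1) *
            tensor faceWeight c x₁ x₂ j₁ j₂) = fun j₁ j₂ _ =>
          4 * (delta ℤ i₁.2 j₁.2 * delta ℤ i₂.2 j₂.2 *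
            (delta ℤ i₁.1 i₂.1 * delta ℤ j₁.1 j₂.1)) := by
        funext j₁ j₂ _
        have : ∀ x₁ x₂ : Bool × Bool,
            delta ℤ i₁.2 x₁.2 * delta ℤ i₂.2 x₂.2 * (delta ℤ i₁.1 i₂.1 * delta ℤ x₁.1 x₂.1) *
              tensor faceWeight c x₁ x₂ j₁ j₂ =
            delta ℤ x₂.1 x₁.1 * (delta ℤ x₂.2 j₂.2 * (delta ℤ x₁.2 j₁.2 * (delta ℤ x₂.1 x₁.1 *
              (delta ℤ i₂.2 x₂.2 * (delta ℤ i₁.2 x₁.2 * (2 * (delta ℤ j₁.1 j₂.1 *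
                delta ℤ i₁.1 i₂.1))))))) := by
          intro x₁ x₂
          rw [tensor_faceWeight_of_side_one (ht c (by simp)), delta_comm x₁.1]
          ring
        simp only [this, Fintype.sum_prod_type, sum_delta_mul, delta_self, one_mul,
          Finset.sum_const, ← Finset.mul_sum, Finset.card_univ, Fintype.card_bool, nsmul_eq_mul]
        push_cast; ring
      rw [key, transfer_const_mul, ih fun c hc => ht c (by simp [hc])]
      funext a b _
      rw [List.length_cons, pow_succ]; ring
  obtain ⟨c, t, rfl⟩ := List.exists_cons_of_ne_nil h
  rw [twistTensor, List.map_cons, transfer]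
  have key : (fun j₁ j₂ (_ : Bool × Bool) => ∑ x₁ : Bool × Bool, ∑ x₂ : Bool × Bool,
      delta ℤ x₁ i₁ * delta ℤ x₂ i₂ * tensor faceWeight c x₁ x₂ j₁ j₂) = fun j₁ j₂ _ =>
      2 * (delta ℤ i₁.2 j₁.2 * delta ℤ i₂.2 j₂.2 * (delta ℤ i₁.1 i₂.1 * delta ℤ j₁.1 j₂.1)) := by
    funext j₁ j₂ _
    have : ∀ x₁ x₂ : Bool × Bool,
        delta ℤ x₁ i₁ * delta ℤ x₂ i₂ * tensor faceWeight c x₁ x₂ j₁ j₂ =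
        delta ℤ x₂ i₂ * (delta ℤ x₁ i₁ * tensor faceWeight c x₁ x₂ j₁ j₂) := fun _ _ => by ring
    simp only [this, sum_delta_mul]
    rw [tensor_faceWeight_of_side_one (ht c (by simp))]
  rw [key, transfer_const_mul, gen t fun c hc => ht c (by simp [hc])]
  rw [List.length_cons, pow_succ]
  ring

end Clasp

/-! ### Planarity. -/

namespace Clasp

open GaussDiagram

lemma closure_mul {C k : Type*} [Fintype C] [CommRing k] (U L G : C → C → C → C → k) (r s p : k) :
    closure (fun m a b c => r * U m a b c) (fun m a b c => s * L m a b c)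
      (fun a b c d => p * G a b c d) = r * s * p * closure U L G := by
  simp only [closure, Finset.mul_sum]
  refine Finset.sum_congr rfl fun _ _ => Finset.sum_congr rfl fun _ _ =>
    Finset.sum_congr rfl fun _ _ => Finset.sum_congr rfl fun _ _ =>
    Finset.sum_congr rfl fun _ _ => Finset.sum_congr rfl fun _ _ => ?_
  ring

lemma closure_faceCap_twisted : closure faceCap faceCap (fun i₁ i₂ j₁ j₂ : Bool × Bool =>
    delta ℤ i₁.2 j₁.2 * delta ℤ i₂.2 j₂.2 * (delta ℤ i₁.1 i₂.1 * delta ℤ j₁.1 j₂.1)) = 2 ^ 5 := by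
  have : ∀ m a b c d e : Bool × Bool, faceCap m a b c * (faceCap m a d e *
      (delta ℤ d.2 e.2 * delta ℤ b.2 c.2 * (delta ℤ d.1 b.1 * delta ℤ e.1 c.1))) =
      delta ℤ e.2 d.2 * (delta ℤ e.1 m.1 * (delta ℤ d.1 a.1 * (delta ℤ c.2 b.2 *
        (delta ℤ c.1 m.1 * (delta ℤ b.1 a.1 * (delta ℤ a.2 m.2 * (delta ℤ e.1 c.1 *
          (delta ℤ d.1 b.1 * (delta ℤ e.2 d.2 * (delta ℤ c.2 b.2 * delta ℤ a.2 m.2))))))))))  := by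
    intro m a b c d e
    rw [faceCap, faceCap, delta_comm d.2, delta_comm b.2, delta_comm a.1 d.1, delta_comm a.1 b.1]
    ring
  simp only [closure, this, Fintype.sum_prod_type, sum_delta_mul, delta_self, one_mul, mul_one,
    Finset.sum_const, ← Finset.mul_sum, Finset.card_univ, Fintype.card_bool, nsmul_eq_mul]
  norm_num

lemma closure_faceCap_straight : closure faceCap faceCap (fun i₁ i₂ j₁ j₂ : Bool × Bool =>
    delta ℤ j₁ i₁ * delta ℤ j₂ i₂) = 2 ^ 4 := by
  have : ∀ m a b c d e : Bool × Bool, faceCap m a b c * (faceCap m a d e *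
      (delta ℤ e d * delta ℤ c b)) =
      delta ℤ e.2 d.2 * (delta ℤ e.1 m.1 * (delta ℤ d.1 a.1 * (delta ℤ c.2 b.2 *
        (delta ℤ c.1 m.1 * (delta ℤ b.1 a.1 * (delta ℤ a.2 m.2 * (delta ℤ c.1 b.1 *
          (delta ℤ e.1 d.1 * (delta ℤ e.2 d.2 * (delta ℤ c.2 b.2 * delta ℤ a.2 m.2)))))))))) := by
    intro m a b c d e
    rw [faceCap, faceCap, delta_comm d.2, delta_comm b.2, delta_comm a.1 d.1, delta_comm a.1 b.1,
      delta_pair e d, delta_pair c b]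
    ring
  simp only [closure, this, Fintype.sum_prod_type, sum_delta_mul, delta_self, one_mul, mul_one,
    Finset.sum_const, ← Finset.mul_sum, Finset.card_univ, Fintype.card_bool, nsmul_eq_mul]
  norm_num [delta]

lemma length_ends (l : List Clasp) : (ends l).length = 4 * l.length := by
  induction l with
  | nil => rfl
  | cons c l ih => simp [ih, down, up]; ring

lemma twistTensor_nil {C k : Type*} [Fintype C] [DecidableEq C] [CommRing k]
    (τ : Clasp → C → C → C → C → k) :
    twistTensor τ [] = fun i₁ i₂ j₁ j₂ => delta k j₁ i₁ * delta k j₂ i₂ := rfl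

/-- With m clasps there are 2m crossings, and 2m + 2 faces are needed. The cleared factors 2, one
for each tangle and one for a nonempty twist region, are made up by `closure_faceCap_twisted` or
`closure_faceCap_straight`; an empty row is separate, since it does not divide the region between
its strands. -/
theorem isPlanar_knotDiagram {u l : List (Bool × Clasp)} {t : List Clasp}
    (h : (labels (all u ++ all l ++ t)).Nodup) (hu : IsAlternating u) (hl : IsAlternating l)
    (hur : ∃ x ∈ u, x.1 = false) (hlr : ∃ x ∈ l, x.1 = false) (ht : ∀ c ∈ t, c.side = 1) :
    (knotDiagram u l t h).IsPlanar := by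
  have hlen : (knotDiagram u l t h).word.length = 4 * (u.length + l.length + t.length) := by
    rw [show (knotDiagram u l t h).word = knotWord u l t from rfl,
      (knotWord_perm u l t).length_eq, length_ends]
    simp [all, add_assoc]
  refine Or.inr ?_
  rw [hlen]
  have hpos : 0 < u.length := by
    obtain ⟨x, hx, _⟩ := hur
    exact List.length_pos_of_mem hx
  have hne : (knotDiagram u l t h).word ≠ [] := by
    rw [← List.length_pos_iff, hlen]; omega
  have hZ : (2 : ℤ) ^ (knotDiagram u l t h).faceCount =
      closure (fun m => transfer (tensor faceWeight) u (cap m))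
        (fun m => transfer (tensor faceWeight) l (cap m)) (twistTensor (tensor faceWeight) t) := by
    rw [GaussDiagram.two_pow_faceCount _ hne fun _ => (((true, true), (true, true)),
      ((true, true), (true, true)))]
    exact stateSum_knotWord _ tensor_faceWeight_symm u l t h _
  suffices hface : (knotDiagram u l t h).faceCount = 2 * (u.length + l.length + t.length) + 2 by
    omega
  have hpow : (4 : ℤ) = 2 ^ 2 := by norm_num
  refine Int.pow_right_injective (a := 2) (by norm_num) ?_
  beta_reduce
  by_cases ht0 : t = []
  · subst ht0
    have h2 := closure_mul (fun m => transfer (tensor faceWeight) u (cap m))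
      (fun m => transfer (tensor faceWeight) l (cap m)) (twistTensor (tensor faceWeight) []) 2 2 1
    simp only [two_mul_transfer_cap hu hur, two_mul_transfer_cap hl hlr, twistTensor_nil] at h2
    rw [closure_mul, closure_faceCap_straight, ← twistTensor_nil (tensor faceWeight), ← hZ,
      hpow, ← pow_mul, ← pow_mul] at h2
    rw [List.length_nil, add_zero, mul_add, pow_add, pow_add]
    linarith
  · have h2 := closure_mul (fun m => transfer (tensor faceWeight) u (cap m))
      (fun m => transfer (tensor faceWeight) l (cap m)) (twistTensor (tensor faceWeight) t) 2 2 2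
    simp only [two_mul_transfer_cap hu hur, two_mul_transfer_cap hl hlr,
      two_mul_twistTensor_faceWeight ht ht0] at h2
    rw [closure_mul, closure_faceCap_twisted, ← hZ, hpow, ← pow_mul, ← pow_mul, ← pow_mul] at h2
    rw [mul_add, mul_add, pow_add, pow_add, pow_add]
    linarith

end Clasp

/-! ### Words of trivial knots. -/

namespace GaussDiagram

/-- Every Gauss diagram with word `W` is a diagram of the trivial knot. -/
def IsTrivialWord (W : List ChordEnd) : Prop :=
  ∀ D : GaussDiagram, D.word = W → VirtualKnot.ofDiagram D = VirtualKnot.unknot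

lemma isTrivialWord_nil : IsTrivialWord [] := by
  intro D hD
  exact Quot.sound (.rotate D empty [] [] hD rfl)

/-- The Gauss diagram whose word is a permutation of the word of `D`. -/
def permute (D : GaussDiagram) (W : List ChordEnd) (h : W.Perm D.word) : GaussDiagram where
  word := W
  nodup := h.nodup_iff.2 D.nodup
  opp_mem e he := h.mem_iff.2 (D.opp_mem e (h.mem_iff.1 he))
  sign_eq e he f hf := D.sign_eq e (h.mem_iff.1 he) f (h.mem_iff.1 hf)

/-- The Gauss diagram with a set of chords left out of the word. -/
lemma exists_word_eq (D : GaussDiagram) {R B : List ChordEnd} (h : D.word.Perm (R ++ B))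
    (hB : ∀ b ∈ B, b.opp ∈ B) : ∃ D' : GaussDiagram, D'.word = R := by
  have hsub : ∀ e ∈ R, e ∈ D.word := fun e he => h.mem_iff.2 (List.mem_append_left _ he)
  have hne := D.label_ne_of_perm h hB
  refine ⟨⟨R, ?_, ?_, fun e he f hf => D.sign_eq e (hsub e he) f (hsub f hf)⟩, rfl⟩
  · exact (List.nodup_append'.1 (h.nodup_iff.1 D.nodup)).1
  · intro e he
    have := h.mem_iff.1 (D.opp_mem e (hsub e he))
    rcases List.mem_append.1 this with h1 | h1
    · exact h1
    · exact absurd rfl (hne e he e (by simpa [opp_opp] using hB _ h1))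

lemma IsTrivialWord.r1 {u v : List ChordEnd} (h : IsTrivialWord (u ++ v)) (e : ChordEnd) :
    IsTrivialWord (u ++ [e, e.opp] ++ v) := by
  intro D hD
  obtain ⟨D', hD'⟩ := D.exists_word_eq (R := u ++ v) (B := [e, e.opp]) (by
    rw [hD, List.append_assoc, List.append_assoc]
    exact List.Perm.append_left _ List.perm_append_comm) (by simp [opp_opp])
  rw [← h D' hD']
  exact Quot.sound (.r1 D D' u v e hD hD')

lemma IsTrivialWord.rotate {u v : List ChordEnd} (h : IsTrivialWord (u ++ v)) :
    IsTrivialWord (v ++ u) := by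
  intro D hD
  rw [← h (D.permute (u ++ v) (by rw [hD]; exact List.perm_append_comm)) rfl]
  exact Quot.sound (.rotate _ _ v u hD rfl)

lemma IsTrivialWord.r2_over {u v w : List ChordEnd} (h : IsTrivialWord (u ++ v ++ w)) (i j : ℕ)
    (s : ℤˣ) : IsTrivialWord (u ++ [⟨i, true, s⟩, ⟨j, true, -s⟩] ++ v ++
      [⟨j, false, -s⟩, ⟨i, false, s⟩] ++ w) := by
  intro D hD
  obtain ⟨D', hD'⟩ := D.exists_word_eq (R := u ++ v ++ w)
    (B := [⟨i, true, s⟩, ⟨j, true, -s⟩] ++ [⟨j, false, -s⟩, ⟨i, false, s⟩]) (by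
      rw [hD, List.perm_iff_count]
      intro e
      simp only [List.count_append]
      omega) (by simp [ChordEnd.opp])
  rw [← h D' hD']
  exact Quot.sound (.r2_antiparallel D D' u v w i j s hD hD')

/-- The move lists the over block first; if the under block comes first, moving the base point
exchanges them. -/
lemma IsTrivialWord.r2 {u v w : List ChordEnd} (h : IsTrivialWord (u ++ v ++ w)) (i j : ℕ)
    (o : Bool) (s : ℤˣ) : IsTrivialWord (u ++ [⟨i, o, s⟩, ⟨j, o, -s⟩] ++ v ++
      [⟨j, !o, -s⟩, ⟨i, !o, s⟩] ++ w) := by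
  cases o
  · have h1 : IsTrivialWord ([] ++ (w ++ u) ++ v) := by
      have : IsTrivialWord (w ++ (u ++ v)) := h.rotate
      simpa using this
    have h2 := h1.r2_over j i (-s)
    rw [neg_neg] at h2
    have h3 : IsTrivialWord (([⟨j, true, -s⟩, ⟨i, true, s⟩] ++ w) ++
        (u ++ [⟨i, false, s⟩, ⟨j, false, -s⟩] ++ v)) := by simpa using h2
    simpa using h3.rotate
  · exact h.r2_over i j s

end GaussDiagram

/-! ### Clasp tangles as words in the free group. -/

namespace Clasp

open GaussDiagram

/-- The strand turns around directly after the last clasp, so the two crossings of that clasp are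
nested curls. -/
lemma isTrivialWord_twist (t : List Clasp) : IsTrivialWord (downs t ++ ups t) := by
  induction t using List.reverseRecOn with
  | nil => exact isTrivialWord_nil
  | append_singleton t c ih =>
    have h1 := (ih.r1 ⟨c.label, c.isOver, c.sign⟩)
    have h2 := IsTrivialWord.r1 (u := downs t ++ [⟨c.label, c.isOver, c.sign⟩])
      (v := [⟨c.label, !c.isOver, c.sign⟩] ++ ups t) (by simpa [ChordEnd.opp] using h1)
      ⟨c.label + 1, !c.isOver, c.sign⟩
    simpa [downs, ups, down, up, ChordEnd.opp] using h2

/-- The clasp `c'` undoes the clasp `c`. -/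
def Cancels (c c' : Clasp) : Prop := c'.isOver = (!c.isOver) ∧ c'.sign = -c.sign

/-- Two moves II: the second crossing of `c` and the first of `c'` form a bigon, and after its
removal so do the other two. -/
lemma Cancels.isTrivialWord_down_up {c c' : Clasp} (h : Cancels c c') {u v w : List ChordEnd}
    (hW : IsTrivialWord (u ++ v ++ w)) :
    IsTrivialWord (u ++ (c.down ++ c'.down) ++ v ++ (c'.up ++ c.up) ++ w) := by
  have h1 := hW.r2 c.label (c'.label + 1) c.isOver c.sign
  have h2 := IsTrivialWord.r2 (u := u ++ [⟨c.label, c.isOver, c.sign⟩])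
    (v := [⟨c'.label + 1, c.isOver, -c.sign⟩] ++ v ++ [⟨c'.label + 1, !c.isOver, -c.sign⟩])
    (w := [⟨c.label, !c.isOver, c.sign⟩] ++ w) (by simpa using h1) (c.label + 1) c'.label
    (!c.isOver) c.sign
  simpa [down, up, h.1, h.2] using h2

lemma Cancels.isTrivialWord_up_down {c c' : Clasp} (h : Cancels c c') {u v w : List ChordEnd}
    (hW : IsTrivialWord (u ++ v ++ w)) :
    IsTrivialWord (u ++ (c'.up ++ c.up) ++ v ++ (c.down ++ c'.down) ++ w) := by
  have h1 := hW.r2 (c'.label + 1) c.label c'.isOver c'.sign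
  have h2 := IsTrivialWord.r2 (u := u ++ [⟨c'.label + 1, c'.isOver, c'.sign⟩])
    (v := [⟨c.label, c'.isOver, -c'.sign⟩] ++ v ++ [⟨c.label, !c'.isOver, -c'.sign⟩])
    (w := [⟨c'.label + 1, !c'.isOver, c'.sign⟩] ++ w) (by simpa using h1) c'.label (c.label + 1)
    (!c'.isOver) c'.sign
  simpa [down, up, h.1, h.2] using h2

lemma downs_append (l l' : List Clasp) : downs (l ++ l') = downs l ++ downs l' := by simp [downs]

lemma ups_append (l l' : List Clasp) : ups (l ++ l') = ups l' ++ ups l := by simp [ups]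

lemma left_append (u v : List (Bool × Clasp)) : left (u ++ v) = left u ++ left v := by simp [left]

lemma right_append (u v : List (Bool × Clasp)) : right (u ++ v) = right u ++ right v := by
  simp [right]

lemma all_append (u v : List (Bool × Clasp)) : all (u ++ v) = all u ++ all v := by simp [all]

lemma isTrivialWord_cancel_upper (p r l : List (Bool × Clasp)) (t : List Clasp) (b : Bool)
    {c c' : Clasp} (h : Cancels c c') (hW : IsTrivialWord (knotWord (p ++ r) l t)) :
    IsTrivialWord (knotWord (p ++ (b, c) :: (b, c') :: r) l t) := by
  cases b
  · have := h.isTrivialWord_down_up (u := downs (left (p ++ r)) ++ ups (left l) ++ downs (all l) ++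
      downs t ++ ups (right l) ++ downs (right p)) (v := downs (right r) ++ ups t ++ ups (all r))
      (w := ups (all p)) (by
        simpa [knotWord, right_append, all_append, downs_append, ups_append] using hW)
    simpa [knotWord, left_append, right_append, all_append, downs_append, ups_append] using this
  · have := h.isTrivialWord_down_up (u := downs (left p)) (v := downs (left r) ++ ups (left l) ++
      downs (all l) ++ downs t ++ ups (right l) ++ downs (right (p ++ r)) ++ ups t ++ ups (all r))
      (w := ups (all p)) (by
        simpa [knotWord, left_append, all_append, downs_append, ups_append] using hW)
    simpa [knotWord, left_append, right_append, all_append, downs_append, ups_append] using this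

lemma isTrivialWord_cancel_lower (u p r : List (Bool × Clasp)) (t : List Clasp) (b : Bool)
    {c c' : Clasp} (h : Cancels c c') (hW : IsTrivialWord (knotWord u (p ++ r) t)) :
    IsTrivialWord (knotWord u (p ++ (b, c) :: (b, c') :: r) t) := by
  cases b
  · have := h.isTrivialWord_down_up (u := downs (left u) ++ ups (left (p ++ r)) ++ downs (all p))
      (v := downs (all r) ++ downs t ++ ups (right r))
      (w := ups (right p) ++ downs (right u) ++ ups t ++ ups (all u)) (by
        simpa [knotWord, right_append, all_append, downs_append, ups_append] using hW)
    simpa [knotWord, left_append, right_append, all_append, downs_append, ups_append] using this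
  · have := h.isTrivialWord_up_down (u := downs (left u) ++ ups (left r))
      (v := ups (left p) ++ downs (all p))
      (w := downs (all r) ++ downs t ++ ups (right (p ++ r)) ++ downs (right u) ++ ups t ++
        ups (all u)) (by
        simpa [knotWord, left_append, all_append, downs_append, ups_append] using hW)
    simpa [knotWord, left_append, right_append, all_append, downs_append, ups_append] using this

/-- The word in the free group on the two sides. -/
def letters (u : List (Bool × Clasp)) : List (Bool × Bool) := u.map fun x => (x.1, x.2.isOver)

/-- In an alternating tangle the side and the over/under choice determine the sign. Adjacent inverse
letters therefore have opposite signs as well, which is what `Cancels` requires. -/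
lemma exists_cancel_of_step {u : List (Bool × Clasp)} (hu : IsAlternating u) {L : List (Bool × Bool)}
    (h : FreeGroup.Red.Step (letters u) L) : ∃ p r b c c', Cancels c c' ∧
      u = p ++ (b, c) :: (b, c') :: r ∧ letters (p ++ r) = L := by
  generalize hv : letters u = v at h
  cases h with
  | @not L₁ L₂ x b =>
    obtain ⟨p, q, rfl, hp, hq⟩ := List.map_eq_append_iff.1 hv
    obtain ⟨⟨b₁, c⟩, q', rfl, h1, h2⟩ := List.map_eq_cons_iff.1 hq
    obtain ⟨⟨b₂, c'⟩, r, rfl, h3, h4⟩ := List.map_eq_cons_iff.1 h2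
    simp only [Prod.mk.injEq] at h1 h3
    obtain ⟨rfl, rfl⟩ := h1
    obtain ⟨rfl, h3⟩ := h3
    refine ⟨p, r, b₂, c, c', ⟨h3, ?_⟩, rfl, by simp [letters, hp, h4]⟩
    have e1 := hu (b₂, c) (by simp)
    have e2 := hu (b₂, c') (by simp)
    simp only [side, h3] at e1 e2
    rw [← e1] at e2
    cases ho : c.isOver <;> simp only [ho, Bool.not_true, Bool.not_false, if_true, if_false,
      Bool.false_eq_true] at e2
    · exact e2
    · rw [← e2, neg_neg]

lemma IsAlternating.append_of_cons_cons {p r : List (Bool × Clasp)} {a b : Bool × Clasp}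
    (h : IsAlternating (p ++ a :: b :: r)) : IsAlternating (p ++ r) :=
  fun x hx => h x (by simp only [List.mem_append, List.mem_cons] at hx ⊢; tauto)

lemma isTrivialWord_upper_of_red {u l : List (Bool × Clasp)} {t : List Clasp}
    (hu : IsAlternating u) (h : FreeGroup.Red (letters u) [])
    (hW : IsTrivialWord (knotWord [] l t)) : IsTrivialWord (knotWord u l t) := by
  generalize hv : letters u = v at h
  induction h using Relation.ReflTransGen.head_induction_on generalizing u with
  | refl =>
    obtain rfl : u = [] := List.map_eq_nil_iff.1 hv
    exact hW
  | head h _ ih =>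
    rw [← hv] at h
    obtain ⟨p, r, b, c, c', hc, rfl, hL⟩ := exists_cancel_of_step hu h
    exact isTrivialWord_cancel_upper p r l t b hc (ih hu.append_of_cons_cons hL)

lemma isTrivialWord_lower_of_red {u l : List (Bool × Clasp)} {t : List Clasp}
    (hl : IsAlternating l) (h : FreeGroup.Red (letters l) [])
    (hW : IsTrivialWord (knotWord u [] t)) : IsTrivialWord (knotWord u l t) := by
  generalize hv : letters l = v at h
  induction h using Relation.ReflTransGen.head_induction_on generalizing l with
  | refl =>
    obtain rfl : l = [] := List.map_eq_nil_iff.1 hv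
    exact hW
  | head h _ ih =>
    rw [← hv] at h
    obtain ⟨p, r, b, c, c', hc, rfl, hL⟩ := exists_cancel_of_step hl h
    exact isTrivialWord_cancel_lower u p r t b hc (ih hl.append_of_cons_cons hL)

lemma red_nil_of_mk_eq_one {L : List (Bool × Bool)} (h : FreeGroup.mk L = 1) :
    FreeGroup.Red L [] := by
  obtain ⟨M, h1, h2⟩ := FreeGroup.Red.exact.1 (h.trans FreeGroup.one_eq_mk)
  rwa [FreeGroup.Red.nil_iff.1 h2] at h1

theorem isTrivialWord_knotWord {u l : List (Bool × Clasp)} (t : List Clasp)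
    (hu : IsAlternating u) (hl : IsAlternating l) (hu1 : FreeGroup.mk (letters u) = 1)
    (hl1 : FreeGroup.mk (letters l) = 1) : IsTrivialWord (knotWord u l t) := by
  refine isTrivialWord_upper_of_red hu (red_nil_of_mk_eq_one hu1)
    (isTrivialWord_lower_of_red hl (red_nil_of_mk_eq_one hl1) ?_)
  simpa [knotWord] using isTrivialWord_twist t

/-! ### Virtualizing whole clasps. -/

/-- The clasp is virtualized or kept as a whole. -/
def Respects (S : Finset ℕ) (l : List Clasp) : Prop :=
  ∀ c ∈ l, c.label ∈ S ↔ c.label + 1 ∈ S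

lemma filter_downs {S : Finset ℕ} {l : List Clasp} (h : Respects S l) :
    (downs l).filter (fun e => e.label ∉ S) = downs (l.filter fun c => c.label ∉ S) := by
  induction l with
  | nil => rfl
  | cons c l ih =>
    have hc := h c (by simp)
    have := ih fun c hc => h c (by simp [hc])
    rw [downs_cons, List.filter_append, this, List.filter_cons]
    by_cases hS : c.label ∈ S
    · simp [down, hS, hc.1 hS]
    · have hS' : c.label + 1 ∉ S := fun h' => hS (hc.2 h')
      simp [down, hS, hS']

lemma filter_ups {S : Finset ℕ} {l : List Clasp} (h : Respects S l) :
    (ups l).filter (fun e => e.label ∉ S) = ups (l.filter fun c => c.label ∉ S) := by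
  induction l with
  | nil => rfl
  | cons c l ih =>
    have hc := h c (by simp)
    have := ih fun c hc => h c (by simp [hc])
    rw [ups_cons, List.filter_append, this, List.filter_cons]
    by_cases hS : c.label ∈ S
    · simp [up, hS, hc.1 hS]
    · have hS' : c.label + 1 ∉ S := fun h' => hS (hc.2 h')
      simp [up, hS, hS']

lemma filter_left (S : Finset ℕ) (u : List (Bool × Clasp)) :
    (left u).filter (fun c => c.label ∉ S) = left (u.filter fun x => x.2.label ∉ S) := by
  simp only [left, List.filter_map, List.filter_filter, Function.comp_def, Bool.and_comm]

lemma filter_right (S : Finset ℕ) (u : List (Bool × Clasp)) :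
    (right u).filter (fun c => c.label ∉ S) = right (u.filter fun x => x.2.label ∉ S) := by
  simp only [right, List.filter_map, List.filter_filter, Function.comp_def, Bool.and_comm]

lemma filter_all (S : Finset ℕ) (u : List (Bool × Clasp)) :
    (all u).filter (fun c => c.label ∉ S) = all (u.filter fun x => x.2.label ∉ S) := by
  simp only [all, List.filter_map, Function.comp_def]

lemma Respects.left {S : Finset ℕ} {u : List (Bool × Clasp)} (h : Respects S (all u)) :
    Respects S (left u) := by
  intro c hc
  obtain ⟨x, hx, rfl⟩ := List.mem_map.1 hc
  exact h _ (List.mem_map.2 ⟨x, (List.mem_filter.1 hx).1, rfl⟩)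

lemma Respects.right {S : Finset ℕ} {u : List (Bool × Clasp)} (h : Respects S (all u)) :
    Respects S (right u) := by
  intro c hc
  obtain ⟨x, hx, rfl⟩ := List.mem_map.1 hc
  exact h _ (List.mem_map.2 ⟨x, (List.mem_filter.1 hx).1, rfl⟩)

lemma filter_knotWord {S : Finset ℕ} {u l : List (Bool × Clasp)} {t : List Clasp}
    (hu : Respects S (all u)) (hl : Respects S (all l)) (ht : Respects S t) :
    (knotWord u l t).filter (fun e => e.label ∉ S) =
      knotWord (u.filter fun x => x.2.label ∉ S) (l.filter fun x => x.2.label ∉ S)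
        (t.filter fun c => c.label ∉ S) := by
  simp only [knotWord, List.filter_append, filter_downs hu.left, filter_downs hu.right,
    filter_ups hu, filter_ups hl.left, filter_ups hl.right, filter_downs hl, filter_downs ht,
    filter_ups ht, filter_left, filter_right, filter_all]

end Clasp

/-! ### Coloured commutator words. -/

/-- The inverse of a word of letters with exponents. -/
def invWord {α : Type*} (L : List (α × Bool)) : List (α × Bool) :=
  (L.map fun z => (z.1, !z.2)).reverse

lemma prod_map_invWord {α G : Type*} [Group G] (F : α × Bool → G)
    (hF : ∀ a b, F (a, !b) = (F (a, b))⁻¹) (L : List (α × Bool)) :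
    ((invWord L).map F).prod = (L.map F).prod⁻¹ := by
  rw [List.prod_inv_reverse, invWord, List.map_reverse, List.map_map, List.map_map]
  congr 3
  funext z
  exact hF z.1 z.2

lemma filter_invWord {α : Type*} (P : α → Bool) (L : List (α × Bool)) :
    (invWord L).filter (fun z => P z.1) = invWord (L.filter fun z => P z.1) := by
  simp only [invWord, List.filter_reverse, List.filter_map, Function.comp_def]

/-- Iterated commutators of coloured letters `true` and `false`. Leaving out the letters of any
colour makes the word trivial in the free group. -/
def commutatorWord : ℕ → List ((Bool × ℕ) × Bool)
  | 0 => [((true, 0), true), ((false, 0), true), ((true, 0), true), ((false, 0), true)]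
  | n + 1 =>
    let k : List ((Bool × ℕ) × Bool) := [((false, 0), true), ((true, 0), true), ((false, 0), true)]
    let h : List ((Bool × ℕ) × Bool) := [((true, n + 1), true)]
    k ++ commutatorWord n ++ h ++ invWord (commutatorWord n) ++ invWord h ++ invWord k

/-- If the missing colour occurs in the inner word, that word and its inverse vanish by induction
and h meets h⁻¹; if it is the new colour n + 1, then h vanishes and the inner word meets its
inverse. Conjugation by k is harmless. Losing further colours changes nothing, so `P` is constrained
at one colour only. -/
lemma prod_map_filter_commutatorWord {G : Type*} [Group G] (F : (Bool × ℕ) × Bool → G)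
    (hF : ∀ a b, F (a, !b) = (F (a, b))⁻¹) (P : Bool × ℕ → Bool) (n i : ℕ) (hi : i ≤ n)
    (hP : ∀ b, P (b, i) = false) :
    (((commutatorWord n).filter fun z => P z.1).map F).prod = 1 := by
  induction n with
  | zero =>
    obtain rfl : i = 0 := by omega
    simp [commutatorWord, hP]
  | succ n ih =>
    simp only [commutatorWord, List.filter_append, filter_invWord, List.map_append,
      List.prod_append, prod_map_invWord F hF]
    by_cases h : i ≤ n
    · rw [ih h]; group
    · obtain rfl : i = n + 1 := by omega
      have : List.filter (fun z : (Bool × ℕ) × Bool => P z.1) [((true, n + 1), true)] = [] := by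
        simp [hP]
      rw [this]
      simp only [List.map_nil, List.prod_nil]
      group

lemma exists_mem_commutatorWord {n i : ℕ} (h : i ≤ n) : ∃ z ∈ commutatorWord n, z.1.2 = i := by
  induction n with
  | zero => exact ⟨((true, 0), true), by simp [commutatorWord], by simp; omega⟩
  | succ n ih =>
    by_cases h' : i ≤ n
    · obtain ⟨z, hz, rfl⟩ := ih h'
      exact ⟨z, by simp [commutatorWord, hz], rfl⟩
    · exact ⟨((true, n + 1), true), by simp [commutatorWord], by simp; omega⟩

lemma false_mem_commutatorWord (n : ℕ) : ((false, 0), true) ∈ commutatorWord n := by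
  cases n <;> simp [commutatorWord]

lemma FreeGroup.mk_eq_prod {α : Type*} (L : List (α × Bool)) :
    FreeGroup.mk L = (L.map fun x => FreeGroup.mk [x]).prod := by
  induction L with
  | nil => rfl
  | cons x L ih => rw [List.map_cons, List.prod_cons, ← ih, FreeGroup.mul_mk]; rfl

/-! ### The diagram of a word and its GPV-triviality. -/

namespace Clasp

open GaussDiagram

/-- The clasp of a letter in the upper tangle. -/
def upperClasp (z : ((Bool × ℕ) × Bool) × ℕ) : Bool × Clasp :=
  (z.1.1.1, ⟨6 * z.2, z.1.2, if z.1.2 = z.1.1.1 then 1 else -1⟩)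

/-- The clasp of a letter in the lower tangle. -/
def lowerClasp (z : ((Bool × ℕ) × Bool) × ℕ) : Bool × Clasp :=
  (z.1.1.1, ⟨6 * z.2 + 2, !z.1.2, if z.1.2 = z.1.1.1 then -1 else 1⟩)

/-- The upper tangle of a word. -/
def upper (L : List ((Bool × ℕ) × Bool)) : List (Bool × Clasp) := L.zipIdx.map upperClasp

/-- The lower tangle of a word. -/
def lower (L : List ((Bool × ℕ) × Bool)) : List (Bool × Clasp) := L.zipIdx.map lowerClasp

/-- A twist region. -/
def twists (l : ℕ) : List Clasp := (List.range l).map fun r => ⟨6 * r + 4, false, -1⟩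

lemma nodup_labels {l : List Clasp} (h : (l.map label).Nodup) (he : ∀ c ∈ l, c.label % 2 = 0) :
    (labels l).Nodup := by
  induction l with
  | nil => simp
  | cons c l ih =>
    rw [List.map_cons, List.nodup_cons] at h
    rw [labels_cons, List.nodup_append']
    refine ⟨by simp, ih h.2 fun c hc => he c (by simp [hc]), ?_⟩
    intro n hn hn'
    simp only [labels, List.mem_flatMap, List.mem_cons, List.not_mem_nil, or_false] at hn hn'
    obtain ⟨d, hd, hn'⟩ := hn'
    have h1 := he c (by simp)
    have h2 := he d (by simp [hd])
    refine h.1 (List.mem_map.2 ⟨d, hd, ?_⟩)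
    omega

lemma map_label_upper (L : List ((Bool × ℕ) × Bool)) :
    (all (upper L)).map label = (List.range L.length).map fun i => 6 * i := by
  rw [all, upper, List.map_map, List.map_map, List.range_eq_range', ← List.zipIdx_map_snd 0 L, List.map_map]
  rfl

lemma map_label_lower (L : List ((Bool × ℕ) × Bool)) :
    (all (lower L)).map label = (List.range L.length).map fun i => 6 * i + 2 := by
  rw [all, lower, List.map_map, List.map_map, List.range_eq_range', ← List.zipIdx_map_snd 0 L, List.map_map]
  rfl

/-- Residues modulo 6 keep labels apart: 0, 1 for upper clasps, 2, 3 for lower clasps, 4, 5 for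
twists, with the quotient as the position. -/
lemma nodup_labels_word (L : List ((Bool × ℕ) × Bool)) (l : ℕ) :
    (labels (all (upper L) ++ all (lower L) ++ twists l)).Nodup := by
  have ht : (twists l).map label = (List.range l).map fun i => 6 * i + 4 := by
    rw [twists, List.map_map]; rfl
  have hmap : (all (upper L) ++ all (lower L) ++ twists l).map label =
      (List.range L.length).map (fun i => 6 * i) ++ (List.range L.length).map (fun i => 6 * i + 2) ++
        (List.range l).map fun i => 6 * i + 4 := by
    rw [List.map_append, List.map_append, map_label_upper, map_label_lower, ht]
  refine nodup_labels ?_ ?_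
  · rw [hmap, List.nodup_append', List.nodup_append']
    refine ⟨⟨List.nodup_range.map fun a b h => ?_, List.nodup_range.map fun a b h => ?_, ?_⟩,
      List.nodup_range.map fun a b h => ?_, ?_⟩
    · omega
    · omega
    · intro n hn hn'
      simp only [List.mem_map] at hn hn'
      omega
    · omega
    · intro n hn hn'
      simp only [List.mem_map, List.mem_append] at hn hn'
      omega
  · intro c hc
    have := List.mem_map_of_mem (f := label) hc
    rw [hmap] at this
    simp only [List.mem_map, List.mem_append] at this
    omega

/-- The diagram of the closure of a word, its mirror image and `l` twists. -/
def wordDiagram (L : List ((Bool × ℕ) × Bool)) (l : ℕ) : GaussDiagram :=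
  knotDiagram (upper L) (lower L) (twists l) (nodup_labels_word L l)

lemma isAlternating_upper (L : List ((Bool × ℕ) × Bool)) : IsAlternating (upper L) := by
  intro x hx
  obtain ⟨⟨⟨⟨g, i⟩, e⟩, j⟩, _, rfl⟩ := List.mem_map.1 hx
  cases g <;> cases e <;> simp [upperClasp, side]

lemma isAlternating_lower (L : List ((Bool × ℕ) × Bool)) : IsAlternating (lower L) := by
  intro x hx
  obtain ⟨⟨⟨⟨g, i⟩, e⟩, j⟩, _, rfl⟩ := List.mem_map.1 hx
  cases g <;> cases e <;> simp [lowerClasp, side]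

theorem isPlanar_wordDiagram {L : List ((Bool × ℕ) × Bool)} (hL : ∃ z ∈ L, z.1.1 = false) (l : ℕ) :
    (wordDiagram L l).IsPlanar := by
  obtain ⟨z, hz, hzf⟩ := hL
  rw [← List.zipIdx_map_fst 0 L, List.mem_map] at hz
  obtain ⟨y, hy, rfl⟩ := hz
  refine isPlanar_knotDiagram _ (isAlternating_upper L) (isAlternating_lower L)
    ⟨_, List.mem_map_of_mem hy, hzf⟩ ⟨_, List.mem_map_of_mem hy, hzf⟩ ?_
  intro c hc
  obtain ⟨r, _, rfl⟩ := List.mem_map.1 hc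
  simp [side]

/-- The crossings of the letters with colour `i`. -/
def colourCrossings (L : List ((Bool × ℕ) × Bool)) (i : ℕ) : Finset ℕ :=
  (Finset.range (6 * L.length)).filter fun n =>
    n % 6 < 4 ∧ (L[n / 6]?).map (fun z => z.1.2) = some i

/-- The quotient by 6 is the position of the letter, and residues below 4 exclude the twists. The
range bound is implied, since a colour exists only at positions inside `L`. -/
lemma mem_colourCrossings {L : List ((Bool × ℕ) × Bool)} {i n : ℕ} :
    n ∈ colourCrossings L i ↔ n % 6 < 4 ∧ (L[n / 6]?).map (fun z => z.1.2) = some i := by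
  rw [colourCrossings, Finset.mem_filter, Finset.mem_range, and_iff_right_iff_imp]
  rintro ⟨_, h⟩
  obtain ⟨z, hz, _⟩ := Option.map_eq_some_iff.1 h
  have := (List.getElem?_eq_some_iff.1 hz).1
  omega

/-- Filtering clasps by their labels is filtering letters by a predicate `Q` on their generator and
colour; positions serve only to make labels distinct. -/
lemma filter_letter {α : Type*} (f : ((Bool × ℕ) × Bool) × ℕ → α) (P : α → Bool)
    (Q : Bool × ℕ → Bool) (L : List ((Bool × ℕ) × Bool)) {β : Type*} (g : α → β)
    (g' : (Bool × ℕ) × Bool → β) (hg : ∀ z, g (f z) = g' z.1)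
    (h : ∀ z ∈ L.zipIdx, P (f z) = Q z.1.1) :
    ((L.zipIdx.map f).filter P).map g = (L.filter fun z => Q z.1).map g' := by
  conv_rhs => rw [← List.zipIdx_map_fst 0 L, List.filter_map, List.map_map]
  rw [List.filter_map, List.map_map, List.filter_congr (q := (fun z => Q z.1) ∘ Prod.fst) h]
  exact List.map_congr_left fun z _ => hg z

theorem gpvTrivial_commutatorWord (n l : ℕ) :
    (VirtualKnot.ofDiagram (wordDiagram (commutatorWord n) l)).GPVTrivial (n + 1) := by
  set L := commutatorWord n with hL
  have hcross : ∀ c, c ∈ (wordDiagram L l).crossings ↔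
      c ∈ labels (all (upper L) ++ all (lower L) ++ twists l) := by
    intro c
    rw [crossings, List.mem_toFinset, show (wordDiagram L l).word =
      knotWord (upper L) (lower L) (twists l) from rfl,
      ((knotWord_perm _ _ _).map ChordEnd.label).mem_iff]
    constructor
    · intro h
      obtain ⟨e, he, rfl⟩ := List.mem_map.1 h
      exact label_mem_of_mem_ends he
    · intro h
      obtain ⟨x, hx, hc⟩ := List.mem_flatMap.1 h
      simp only [List.mem_cons, List.not_mem_nil, or_false] at hc
      refine List.mem_map.2 ?_
      rcases hc with rfl | rfl
      · exact ⟨⟨x.label, x.isOver, x.sign⟩, List.mem_flatMap.2 ⟨x, hx, by simp [down]⟩, rfl⟩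
      · exact ⟨⟨x.label + 1, x.isOver, x.sign⟩, List.mem_flatMap.2 ⟨x, hx, by simp [up]⟩, rfl⟩
  refine ⟨_, fun i => colourCrossings L i, rfl, fun i => ⟨?_, ?_⟩, fun i j hij => ?_,
    fun s hs => ?_⟩
  · obtain ⟨z, hz, hzi⟩ := exists_mem_commutatorWord (n := n) (i := i) (by omega)
    obtain ⟨j, hj⟩ := List.mem_iff_getElem?.1 hz
    refine ⟨6 * j, mem_colourCrossings.2 ⟨by omega, ?_⟩⟩
    rw [show 6 * j / 6 = j by omega, hj, Option.map_some, hzi]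
  · intro c hc
    rw [mem_colourCrossings] at hc
    obtain ⟨z, hz, _⟩ := Option.map_eq_some_iff.1 hc.2
    have hz' : (z, c / 6) ∈ L.zipIdx := List.mem_zipIdx_iff_getElem?.2 hz
    rw [hcross, labels_append, labels_append, List.mem_append, List.mem_append]
    refine Or.inl ?_
    have hlt := hc.1
    by_cases h2 : c % 6 < 2
    · refine Or.inl (List.mem_flatMap.2 ⟨(upperClasp (z, c / 6)).2,
        List.mem_map_of_mem (List.mem_map_of_mem hz'), ?_⟩)
      simp only [upperClasp, List.mem_cons, List.not_mem_nil, or_false]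
      omega
    · refine Or.inr (List.mem_flatMap.2 ⟨(lowerClasp (z, c / 6)).2,
        List.mem_map_of_mem (List.mem_map_of_mem hz'), ?_⟩)
      simp only [lowerClasp, List.mem_cons, List.not_mem_nil, or_false]
      omega
  · rw [Finset.disjoint_left]
    intro c hc hc'
    have h1 := (mem_colourCrossings.1 hc).2
    rw [(mem_colourCrossings.1 hc').2] at h1
    exact hij (Fin.ext (Option.some.inj h1).symm)
  · set S := s.biUnion fun i => colourCrossings L i with hS
    have hmem : ∀ c, c ∈ S ↔ ∃ i ∈ s, c % 6 < 4 ∧ (L[c / 6]?).map (fun z => z.1.2) = some (i : ℕ) := by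
      intro c
      rw [hS, Finset.mem_biUnion]
      simp only [mem_colourCrossings]
    -- The letters that survive are those with no colour in `s`.
    let Q : Bool × ℕ → Bool := fun y => decide (¬ ∃ i ∈ s, y.2 = (i : ℕ))
    have hletter : ∀ z ∈ L.zipIdx, ∀ r < 4, (6 * z.2 + r ∈ S ↔ ∃ i ∈ s, z.1.1.2 = (i : ℕ)) := by
      intro z hz r hr
      rw [hmem, show (6 * z.2 + r) / 6 = z.2 by omega, show (6 * z.2 + r) % 6 = r by omega,
        List.mem_zipIdx_iff_getElem?.1 hz]
      simp [hr]
    have hu : Respects S (all (upper L)) := by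
      intro c hc
      obtain ⟨x, hx, rfl⟩ := List.mem_map.1 hc
      obtain ⟨z, hz, rfl⟩ := List.mem_map.1 hx
      exact (hletter z hz 0 (by omega)).trans (hletter z hz 1 (by omega)).symm
    have hl : Respects S (all (lower L)) := by
      intro c hc
      obtain ⟨x, hx, rfl⟩ := List.mem_map.1 hc
      obtain ⟨z, hz, rfl⟩ := List.mem_map.1 hx
      exact (hletter z hz 2 (by omega)).trans (hletter z hz 3 (by omega)).symm
    have ht : Respects S (twists l) := by
      intro c hc
      obtain ⟨r, _, rfl⟩ := List.mem_map.1 hc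
      rw [hmem, hmem]
      constructor <;> rintro ⟨i, _, h, _⟩ <;> exfalso <;> dsimp only at h <;> omega
    -- A single missing colour already trivializes both words.
    obtain ⟨i, hi⟩ := hs
    have hQ : ∀ b, Q (b, (i : ℕ)) = false := fun b => decide_eq_false (not_not.2 ⟨i, hi, rfl⟩)
    have htriv := isTrivialWord_knotWord ((twists l).filter fun c => c.label ∉ S)
      (u := (upper L).filter fun x => x.2.label ∉ S) (l := (lower L).filter fun x => x.2.label ∉ S)
      (fun x hx => isAlternating_upper L x (List.mem_filter.1 hx).1)
      (fun x hx => isAlternating_lower L x (List.mem_filter.1 hx).1) ?_ ?_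
    · exact htriv _ (filter_knotWord hu hl ht)
    · rw [letters, upper, filter_letter upperClasp _ Q L _ (fun z => (z.1.1, z.2)) (fun _ => rfl),
        FreeGroup.mk_eq_prod, List.map_map]
      · refine prod_map_filter_commutatorWord _ ?_ Q n i (by omega) hQ
        intro a b
        simp [FreeGroup.inv_mk, FreeGroup.invRev]
      · intro z hz
        refine decide_eq_decide.2 (not_congr ?_)
        exact hletter z hz 0 (by omega)
    -- The lower tangle has all exponents inverted. Inverting both generators still sends opposite
    -- letters to inverse elements, so the same lemma applies.
    · rw [letters, lower, filter_letter lowerClasp _ Q L _ (fun z => (z.1.1, !z.2)) (fun _ => rfl),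
        FreeGroup.mk_eq_prod, List.map_map]
      · refine prod_map_filter_commutatorWord _ ?_ Q n i (by omega) hQ
        intro a b
        simp [FreeGroup.inv_mk, FreeGroup.invRev]
      · intro z hz
        refine decide_eq_decide.2 (not_congr ?_)
        exact hletter z hz 2 (by omega)

end Clasp

/-! ### Nontriviality at A = 2 modulo 11. -/

namespace Clasp

/-- The sides and the signs of the clasps of a word, or of its mirror image if `ε = -1`. -/
def wordSigns (ε : ℤˣ) (L : List ((Bool × ℕ) × Bool)) : List (Bool × ℤˣ) :=
  L.map fun z => (z.1.1, if z.2 = z.1.1 then ε else -ε)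

lemma signs_upper (L : List ((Bool × ℕ) × Bool)) : signs (upper L) = wordSigns 1 L := by
  rw [wordSigns, signs, upper, List.map_map]
  conv_rhs => rw [← List.zipIdx_map_fst 0 L, List.map_map]
  rfl

lemma map_neg_wordSigns (L : List ((Bool × ℕ) × Bool)) :
    (wordSigns 1 L).map (fun z => (z.1, -z.2)) = wordSigns (-1) L := by
  rw [wordSigns, wordSigns, List.map_map]
  refine List.map_congr_left fun z _ => ?_
  simp only [Function.comp_apply]
  split_ifs <;> simp

lemma signs_lower (L : List ((Bool × ℕ) × Bool)) :
    signs (lower L) = (signs (upper L)).map fun z => (z.1, -z.2) := by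
  rw [signs_upper, map_neg_wordSigns, wordSigns, signs, lower, List.map_map]
  conv_rhs => rw [← List.zipIdx_map_fst 0 L, List.map_map]
  refine List.map_congr_left fun z _ => ?_
  simp [lowerClasp]

/-- The unit `2` modulo `11`. -/
def unitTwo : (ZMod 11)ˣ := ⟨2, 6, by decide, by decide⟩

lemma straightCoeff_unitTwo (s : ℤˣ) : straightCoeff unitTwo s = if s = 1 then 4 else 3 := by
  obtain rfl | rfl := Int.units_eq_one_or s
  · decide
  · decide

lemma turnCoeff_unitTwo (s : ℤˣ) : turnCoeff unitTwo s = if s = 1 then 2 else 5 := by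
  obtain rfl | rfl := Int.units_eq_one_or s
  · decide
  · decide

/-- The action of a clasp on the coefficients of the caps modulo `11`. -/
def stepMod (x : Bool × ℤˣ) (v : ZMod 11 × ZMod 11) : ZMod 11 × ZMod 11 :=
  if x.1 then (v.1 + (if x.2 = 1 then 2 else 5) * v.2, (if x.2 = 1 then 4 else 3) * v.2)
  else ((if x.2 = 1 then 4 else 3) * v.1, (if x.2 = 1 then 2 else 5) * v.1 + v.2)

lemma capCoeff_unitTwo (u : List (Bool × ℤˣ)) (v : ZMod 11 × ZMod 11) :
    capCoeff unitTwo u v = u.foldl (fun v x => stepMod x v) v := by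
  induction u generalizing v with
  | nil => rfl
  | cons x u ih =>
    obtain ⟨b, s⟩ := x
    cases b <;> simp [capCoeff, ih, stepMod, straightCoeff_unitTwo, turnCoeff_unitTwo]

/-- The action of a word on the coefficients of the caps modulo `11`. -/
def actMod (ε : ℤˣ) (L : List ((Bool × ℕ) × Bool)) (v : ZMod 11 × ZMod 11) : ZMod 11 × ZMod 11 :=
  (wordSigns ε L).foldl (fun v x => stepMod x v) v

lemma actMod_append (ε : ℤˣ) (L L' : List ((Bool × ℕ) × Bool)) (v : ZMod 11 × ZMod 11) :
    actMod ε (L ++ L') v = actMod ε L' (actMod ε L v) := by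
  rw [actMod, wordSigns, List.map_append, List.foldl_append]
  rfl

lemma invWord_append {α : Type*} (L L' : List (α × Bool)) :
    invWord (L ++ L') = invWord L' ++ invWord L := by simp [invWord]

lemma invWord_invWord {α : Type*} (L : List (α × Bool)) : invWord (invWord L) = L := by
  simp [invWord, Function.comp_def]

-- The word k = bab and the letter h = a are chosen such that the commutator step fixes the action
-- of abab on the caps modulo 11. The check runs over all 121 vectors and both mirror images; the
-- inverse word is included because the recursion uses it.
set_option maxRecDepth 100000 in
lemma actMod_commutatorWord_one : ∀ (v : ZMod 11 × ZMod 11) (b : Bool),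
    actMod (if b then 1 else -1) (commutatorWord 1) v =
      actMod (if b then 1 else -1) (commutatorWord 0) v ∧
    actMod (if b then 1 else -1) (invWord (commutatorWord 1)) v =
      actMod (if b then 1 else -1) (invWord (commutatorWord 0)) v := by
  decide

lemma commutatorWord_succ (n : ℕ) : commutatorWord (n + 1) =
    [((false, 0), true), ((true, 0), true), ((false, 0), true)] ++ commutatorWord n ++
      [((true, n + 1), true)] ++ invWord (commutatorWord n) ++ invWord [((true, n + 1), true)] ++
      invWord [((false, 0), true), ((true, 0), true), ((false, 0), true)] := rfl

/-- The action ignores colours, so each commutator step is the first one with the inner word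
replaced by one of equal action, and `actMod_commutatorWord_one` applies again. -/
lemma actMod_commutatorWord (ε : ℤˣ) (n : ℕ) (v : ZMod 11 × ZMod 11) :
    actMod ε (commutatorWord n) v = actMod ε (commutatorWord 0) v ∧
    actMod ε (invWord (commutatorWord n)) v = actMod ε (invWord (commutatorWord 0)) v := by
  have h1 : ∀ v, actMod ε (commutatorWord 1) v = actMod ε (commutatorWord 0) v ∧
      actMod ε (invWord (commutatorWord 1)) v = actMod ε (invWord (commutatorWord 0)) v := by
    intro v
    obtain rfl | rfl := Int.units_eq_one_or ε
    · exact actMod_commutatorWord_one v true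
    · exact actMod_commutatorWord_one v false
  induction n generalizing v with
  | zero => exact ⟨rfl, rfl⟩
  | succ n ih =>
    have hcol : ∀ v, actMod ε [((true, n + 1), true)] v = actMod ε [((true, 1), true)] v :=
      fun _ => rfl
    have hcol' : ∀ v, actMod ε (invWord [((true, n + 1), true)]) v =
        actMod ε (invWord [((true, 1), true)]) v := fun _ => rfl
    rw [← (h1 v).1, ← (h1 v).2, show (1 : ℕ) = 0 + 1 from rfl, commutatorWord_succ n,
      commutatorWord_succ 0]
    simp only [invWord_append, invWord_invWord, actMod_append, hcol, hcol', (ih _).1, (ih _).2,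
      zero_add, and_self]

/-- The point `2` modulo `11` detects the closures of the commutator words. -/
lemma closureValue_commutatorWord (n : ℕ) :
    closureValue unitTwo (wordSigns 1 (commutatorWord n)) = 3 := by
  rw [closureValue, map_neg_wordSigns, capCoeff_unitTwo, capCoeff_unitTwo]
  have h1 := (actMod_commutatorWord 1 n (1, 0)).1
  have h2 := (actMod_commutatorWord (-1) n (1, 0)).1
  rw [actMod, actMod] at h1 h2
  rw [h1, h2]
  decide

lemma jones_wordDiagram_ne_one (n : ℕ) : (wordDiagram (commutatorWord n) 0).jones ≠ 1 := by
  intro h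
  -- Four colours, since the inverse of 2 is 6 and -2² - 6² = -40 = 4 modulo 11. The evaluation
  -- would give 3 · 4 = 1 · 4 if the polynomial were 1.
  have h1 := evalInt_jones_knotDiagram (C := Fin 4) unitTwo (by decide)
    (upper (commutatorWord n)) (lower (commutatorWord n)) (twists 0) (nodup_labels_word _ _)
    (signs_lower _) (by simp [twists])
  rw [signs_upper, closureValue_commutatorWord, show knotDiagram _ _ _ _ =
    wordDiagram (commutatorWord n) 0 from rfl, h, map_one, twists] at h1
  simp only [List.range_zero, List.map_nil, List.length_nil, mul_zero, pow_zero] at h1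
  revert h1
  decide

lemma jones_wordDiagram_sub_one (L : List ((Bool × ℕ) × Bool)) (l : ℕ) :
    (wordDiagram L l).jones - 1 =
      LaurentPolynomial.T (8 * l) * ((wordDiagram L 0).jones - 1) := by
  have h := jones_knotDiagram_sub_one (upper L) (lower L) (twists l) (nodup_labels_word L l)
    (nodup_labels_word L 0) (signs_lower L) (by simp [twists])
  rwa [show (twists l).length = l by simp [twists]] at h

end Clasp

/-! ### The theorem. -/

theorem lemma2 (n : ℕ) (hn : 0 < n) :
    ∃ (K₀ : VirtualKnot) (V : ℤ[T;T⁻¹]) (K : ℕ → VirtualKnot),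
      K₀.IsClassical ∧ K₀.HasJones V ∧ V ≠ 1 ∧
      (∀ l : ℕ, 0 < l →
        (K l).IsClassical ∧ K l ≠ VirtualKnot.unknot ∧ (K l).GPVTrivial n ∧
        (K l).HasJones
          ((tpow (-2) - 1) * (V - 1) * (∑ i ∈ Finset.range l, tpow (-2 * (i : ℤ))) + V)) ∧
      ∀ l l' : ℕ, 0 < l → 0 < l' → l ≠ l' → ¬ (K l).SameUnoriented (K l') := by
  -- `commutatorWord m` uses the m + 1 colours 0, …, m.
  obtain ⟨m, rfl⟩ : ∃ m, n = m + 1 := ⟨n - 1, by omega⟩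
  have hV := Clasp.jones_wordDiagram_ne_one m
  have hjones := Clasp.jones_wordDiagram_sub_one (commutatorWord m)
  have hplanar := Clasp.isPlanar_wordDiagram ⟨_, false_mem_commutatorWord m, rfl⟩
  refine ⟨VirtualKnot.ofDiagram (Clasp.wordDiagram (commutatorWord m) 0),
    (Clasp.wordDiagram (commutatorWord m) 0).jones,
    fun l => VirtualKnot.ofDiagram (Clasp.wordDiagram (commutatorWord m) l),
    ⟨_, rfl, hplanar 0⟩, VirtualKnot.hasJones _, hV, fun l hl => ⟨⟨_, rfl, hplanar l⟩, ?_,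
      Clasp.gpvTrivial_commutatorWord m l, ?_⟩, fun l l' _ _ hne h => ?_⟩
  · intro h
    have h1 := congrArg VirtualKnot.jones h
    rw [VirtualKnot.jones_ofDiagram, VirtualKnot.jones_unknot] at h1
    have h2 := hjones l
    rw [h1, sub_self] at h2
    -- If V_ℓ were 1, cancelling the power of `T` would force V_0 = 1.
    exact hV (sub_eq_zero.1 (((LaurentPolynomial.isUnit_T _).mul_right_eq_zero).1 h2.symm))
  · have h := VirtualKnot.hasJones (VirtualKnot.ofDiagram (Clasp.wordDiagram (commutatorWord m) l))
    rwa [VirtualKnot.jones_ofDiagram, Clasp.eq_geom_sum_of_sub_one (hjones l)] at h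
  · have h1 := VirtualKnot.jones_eq_of_sameUnoriented h
    rw [VirtualKnot.jones_ofDiagram, VirtualKnot.jones_ofDiagram] at h1
    have h2 := hjones l
    rw [h1, hjones l'] at h2
    -- V_0 - 1 is nonzero, so its multiples by different powers of `T` differ.
    have := Clasp.T_mul_injective (sub_ne_zero.2 hV) h2
    omega
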